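/- Let $n\ge 2$ and let $(M,g_0)$ be a compact connected $n$-dimensional smooth Riemannian manifold with nonempty smooth boundary $\partial M$ (possibly disconnected). For a Riemannian metric $g$ on $M$ let $R_g$ denote its scalar curvature and $H_g=\mathrm{div}_g\,\eta_g$ the mean curvature of $\partial M$ with respect to the exterior unit conormal $\eta_g$. Let $g=\mu^2 g_0$, with $\mu$ a positive smooth function on $M$, be a metric in the conformal class of $g_0$ such that $g=g_0$ on $\partial M$. Assume that $$\int_M (R_g-R_{g_0})\,d\mathrm{vol}_{g_0}+2\int_{\partial M}(H_g-H_{g_0})\,d\mathcal H^{n-1}_{g_0}\ \ge\ 0,$$ where $\mathrm{vol}_{g_0}$ is the Riemannian volume of $g_0$ and $\mathcal H^{n-1}_{g_0}$ the induced area measure on $\partial M$. If $$\int_M R_{g_0}\,(1-\mu^{-2})\,d\mathrm{vol}_{g_0}\ \ge\ 0,$$ then $g=g_0$ on all of $M$. -/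

import Mathlib

open Set MeasureTheory
open scoped Manifold ContDiff

noncomputable section

namespace BoundaryGeometry

/-! ### Riemannian calculus of a metric given by its coefficient matrix

Coordinates run through a set `S` of `ℝ^(m+1)` (in the application: the closed half-space), and all
derivatives are taken within `S`, hence one-sided at the boundary of `S`. -/

section Coordinates

variable {m : ℕ}

/-- The coordinate space `ℝⁿ`, `n = m + 1`, with its Euclidean norm. -/
abbrev Coord (m : ℕ) : Type := EuclideanSpace ℝ (Fin (m + 1))

/-- The partial derivative `∂ᵢ F`, taken within `S`. -/
def pderiv (S : Set (Coord m)) (i : Fin (m + 1)) (F : Coord m → ℝ) (y : Coord m) : ℝ :=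
  fderivWithin ℝ F S y (EuclideanSpace.single i 1)

/-- The Christoffel symbols of the Levi-Civita connection:
`Γᵏᵢⱼ = ½ ∑ₗ gᵏˡ (∂ᵢ gⱼₗ + ∂ⱼ gᵢₗ - ∂ₗ gᵢⱼ)`. -/
def christoffel (S : Set (Coord m)) (G : Coord m → Matrix (Fin (m + 1)) (Fin (m + 1)) ℝ)
    (k i j : Fin (m + 1)) (y : Coord m) : ℝ :=
  (1 / 2) * ∑ l, (G y)⁻¹ k l *
    (pderiv S i (fun z => G z j l) y + pderiv S j (fun z => G z i l) y
      - pderiv S l (fun z => G z i j) y)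

/-- The Ricci tensor:
`Ricⱼₖ = ∑ᵢ (∂ᵢ Γⁱⱼₖ - ∂ⱼ Γⁱᵢₖ) + ∑ᵢ ∑ₚ (Γⁱᵢₚ Γᵖⱼₖ - Γⁱⱼₚ Γᵖᵢₖ)`. -/
def ricci (S : Set (Coord m)) (G : Coord m → Matrix (Fin (m + 1)) (Fin (m + 1)) ℝ)
    (j k : Fin (m + 1)) (y : Coord m) : ℝ :=
  ∑ i, (pderiv S i (christoffel S G i j k) y - pderiv S j (christoffel S G i i k) y)
    + ∑ i, ∑ p, (christoffel S G i i p y * christoffel S G p j k y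
        - christoffel S G i j p y * christoffel S G p i k y)

/-- The scalar curvature `R = ∑ⱼₖ gʲᵏ Ricⱼₖ` (equal to `n (n - 1)` on the unit `n`-sphere). -/
def scalar (S : Set (Coord m)) (G : Coord m → Matrix (Fin (m + 1)) (Fin (m + 1)) ℝ)
    (y : Coord m) : ℝ :=
  ∑ j, ∑ k, (G y)⁻¹ j k * ricci S G j k y

/-- The divergence of a vector field with components `Xᵏ`, i.e. the trace of its covariant
derivative: `div X = ∑ₖ ∂ₖ Xᵏ + ∑ᵢₖ Γⁱᵢₖ Xᵏ`. -/
def divergence (S : Set (Coord m)) (G : Coord m → Matrix (Fin (m + 1)) (Fin (m + 1)) ℝ)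
    (X : Fin (m + 1) → Coord m → ℝ) (y : Coord m) : ℝ :=
  ∑ k, pderiv S k (X k) y + ∑ i, ∑ k, christoffel S G i i k y * X k y

/-- The components of the unit vector field `η = -∇y₀ / |∇y₀|`, that is `ηᵏ = -gᵏ⁰ / √g⁰⁰`. It is
orthogonal to the level sets of the coordinate `y₀`. Where the manifold is `{y₀ ≥ 0}`, it restricts
on the boundary `{y₀ = 0}` to the exterior unit conormal. -/
def conormal (G : Coord m → Matrix (Fin (m + 1)) (Fin (m + 1)) ℝ)
    (k : Fin (m + 1)) (y : Coord m) : ℝ :=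
  -((G y)⁻¹ k 0 / √((G y)⁻¹ 0 0))

/-- The parametrization `z ↦ (0, z)` of the hyperplane `{y₀ = 0}`. -/
def boundaryIncl (z : EuclideanSpace ℝ (Fin m)) : Coord m :=
  WithLp.toLp 2 (Fin.cons (0 : ℝ) (fun a => z a))

end Coordinates

/-! ### Riemannian metrics on a manifold with boundary -/

section Manifold

variable {m : ℕ} {M : Type*} [TopologicalSpace M] [ChartedSpace (EuclideanHalfSpace (m + 1)) M]
  [IsManifold (𝓡∂ (m + 1)) ∞ M]

/-- Smooth Riemannian metrics on an `(m+1)`-dimensional smooth manifold with boundary. -/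
abbrev SmoothMetric (m : ℕ) (M : Type*) [TopologicalSpace M]
    [ChartedSpace (EuclideanHalfSpace (m + 1)) M] [IsManifold (𝓡∂ (m + 1)) ∞ M] : Type _ :=
  Bundle.ContMDiffRiemannianMetric (𝓡∂ (m + 1)) ∞ (Coord m)
    (fun p : M => TangentSpace (𝓡∂ (m + 1)) p)

/-- The coordinate vector field `∂ᵢ` of the chart at `x`, at the point with coordinates `y`. -/
def coordVector (x : M) (y : Coord m) (i : Fin (m + 1)) :
    TangentSpace (𝓡∂ (m + 1)) ((extChartAt (𝓡∂ (m + 1)) x).symm y) :=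
  mfderivWithin 𝓘(ℝ, Coord m) (𝓡∂ (m + 1)) (extChartAt (𝓡∂ (m + 1)) x).symm
    (range (𝓡∂ (m + 1))) y (EuclideanSpace.single i (1 : ℝ) : Coord m)

/-- The coefficients `gᵢⱼ = g(∂ᵢ, ∂ⱼ)` of the metric in the chart at `x`. -/
def coeff (g : SmoothMetric m M) (x : M) (y : Coord m) :
    Matrix (Fin (m + 1)) (Fin (m + 1)) ℝ :=
  Matrix.of fun i j => g.inner ((extChartAt (𝓡∂ (m + 1)) x).symm y)
    (coordVector x y i) (coordVector x y j)

/-- The scalar curvature `R_g` at `p`, computed in the chart at `p`. -/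
def scalarCurvature (g : SmoothMetric m M) (p : M) : ℝ :=
  scalar (range (𝓡∂ (m + 1))) (coeff g p) (extChartAt (𝓡∂ (m + 1)) p p)

/-- The mean curvature `H_g = div_g η_g` of the boundary at a boundary point `p`, computed in the
chart at `p`; here `η_g` is a unit vector field that extends the exterior conormal. (Only used at
boundary points.) -/
def meanCurvature (g : SmoothMetric m M) (p : M) : ℝ :=
  divergence (range (𝓡∂ (m + 1))) (coeff g p) (conormal (coeff g p))
    (extChartAt (𝓡∂ (m + 1)) p p)

variable [MeasurableSpace M]

/-- The Riemannian volume on the domain of the chart at `x`: the image of `√(det gᵢⱼ) dy`. -/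
def chartVolume (g : SmoothMetric m M) (x : M) : Measure M :=
  (((volume : Measure (Coord m)).restrict (extChartAt (𝓡∂ (m + 1)) x).target).withDensity
    (fun y => ENNReal.ofReal √(coeff g x y).det)).map (extChartAt (𝓡∂ (m + 1)) x).symm

/-- The Riemannian volume measure. The measures `chartVolume g x` are the restrictions of one
measure to the chart domains, which is therefore their supremum. -/
def volumeMeasure (g : SmoothMetric m M) : Measure M :=
  ⨆ x : M, chartVolume g x

/-- The Riemannian area on the part of the boundary in the domain of the chart at `x`: the image
of `√(det h) dz`, where `h` consists of the coefficients `g_ab`, `a, b ≥ 1`, on `{y₀ = 0}` of the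
metric induced on the boundary. -/
def chartArea (g : SmoothMetric m M) (x : M) : Measure M :=
  (((volume : Measure (EuclideanSpace ℝ (Fin m))).restrict
      (boundaryIncl ⁻¹' (extChartAt (𝓡∂ (m + 1)) x).target)).withDensity
    (fun z => ENNReal.ofReal
      √((coeff g x (boundaryIncl z)).submatrix Fin.succ Fin.succ).det)).map
    (fun z => (extChartAt (𝓡∂ (m + 1)) x).symm (boundaryIncl z))

/-- The area measure (`(n-1)`-dimensional Hausdorff measure with respect to `g`) of the boundary,
as a measure on `M` that is carried by the boundary. The measures `chartArea g x` are the
restrictions of one measure to the chart domains, which is therefore their supremum. -/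
def boundaryArea (g : SmoothMetric m M) : Measure M :=
  ⨆ x : M, chartArea g x

end Manifold

end BoundaryGeometry

end

/-! Write `n = m + 1` and `f = log μ`. The conformal change of scalar curvature is `R_g = μ⁻²
(R_{g₀} - 2m Δf - m(m-1) |∇f|²)`. Since `∇μ⁻² = -2 μ⁻² ∇f`, moving the weight `μ⁻²` inside the
divergence costs a further `-4m μ⁻² |∇f|²` and gives `R_g - R_{g₀} = -R_{g₀} (1 - μ⁻²) - 2m div(μ⁻²
∇f) - m(m+3) μ⁻² |∇f|²` (`scalar_sub_scalar`). On the boundary `μ = 1`, hence `H_g - H_{g₀} = m ∂_η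
f` (`meanCurvature_sub`). By the divergence theorem the middle term integrates to `-2m ∫ ∂_η f` over
the boundary, and twice the mean curvature integral cancels it exactly. So
(`integral_curvature_sub`) the first integral hypothesis reads `0 ≤ -∫ R_{g₀} (1 - μ⁻²) - m(m+3) ∫
μ⁻² |∇f|²`. With the second one, `∫ μ⁻² |∇f|² = 0`. The integrand is continuous and nonnegative and
nonempty open sets have positive volume, so `∇f = 0`. By connectedness `f` is constant, and it
vanishes on the nonempty boundary.

Most of the work is the calculus behind these lines. Curvature, gradient pairing and normal
derivative at `p` are coordinate expressions in the chart at `p`, one-sided at the boundary. Their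
independence of the chart follows from transformation laws under isometric changes of coordinates
(`christoffel_law`, `curvature_law`, `scalar_eq`, `gradPairing_eq`, `conormalDeriv_eq`). The chart
measures are glued by the change of variables formula (`iSup_measure_restrict`). The divergence
theorem (`integral_divergence`) is reduced by a partition of unity to a box in the half-space
(`integral_sum_pderiv`).

Chart independence of the mean curvature itself is never needed: only the difference `H_g - H_{g₀}`
enters, and in the chart at `p` it is a multiple of the normal derivative of `f`, which is
independent of the chart on the boundary. -/

noncomputable section

namespace BoundaryGeometry

section

variable {m : ℕ}

/-! ### Partial derivatives on relatively open coordinate domains -/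

/-- `U` is a relatively open part of `S`, and `S` is the closure of its interior along `U`. -/
structure IsCoordDomain (S U : Set (Coord m)) : Prop where
  uniqueDiffOn : UniqueDiffOn ℝ S
  subset : U ⊆ S
  mem_nhdsWithin : ∀ z ∈ U, U ∈ nhdsWithin z S
  mem_closure_interior : ∀ z ∈ U, z ∈ closure (interior S)

/-- Smoothness within `S` at all points of `U`. -/
def SmoothAlong (S U : Set (Coord m)) (F : Coord m → ℝ) : Prop :=
  ∀ z ∈ U, ContDiffWithinAt ℝ ∞ F S z

variable {S U V : Set (Coord m)} {F F' : Coord m → ℝ}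

namespace SmoothAlong

theorem differentiableWithinAt (hF : SmoothAlong S U F) {y : Coord m} (hy : y ∈ U) :
    DifferentiableWithinAt ℝ F S y :=
  (hF y hy).differentiableWithinAt (by simp)

theorem const (c : ℝ) : SmoothAlong S U (fun _ => c) := fun _ _ => contDiffWithinAt_const

theorem add (hF : SmoothAlong S U F) (hF' : SmoothAlong S U F') :
    SmoothAlong S U (fun z => F z + F' z) := fun z hz => (hF z hz).add (hF' z hz)

theorem sub (hF : SmoothAlong S U F) (hF' : SmoothAlong S U F') :
    SmoothAlong S U (fun z => F z - F' z) := fun z hz => (hF z hz).sub (hF' z hz)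

theorem neg (hF : SmoothAlong S U F) : SmoothAlong S U (fun z => - F z) :=
  fun z hz => (hF z hz).neg

theorem mul (hF : SmoothAlong S U F) (hF' : SmoothAlong S U F') :
    SmoothAlong S U (fun z => F z * F' z) := fun z hz => (hF z hz).mul (hF' z hz)

theorem inv (hF : SmoothAlong S U F) (h0 : ∀ z ∈ U, F z ≠ 0) :
    SmoothAlong S U (fun z => (F z)⁻¹) := fun z hz => (hF z hz).inv (h0 z hz)

theorem sqrt (hF : SmoothAlong S U F) (h0 : ∀ z ∈ U, F z ≠ 0) :
    SmoothAlong S U (fun z => √(F z)) := fun z hz => (hF z hz).sqrt (h0 z hz)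

theorem log (hF : SmoothAlong S U F) (h0 : ∀ z ∈ U, F z ≠ 0) :
    SmoothAlong S U (fun z => Real.log (F z)) := fun z hz => (hF z hz).log (h0 z hz)

theorem sum {α : Type*} {s : Finset α} {f : α → Coord m → ℝ}
    (hf : ∀ a ∈ s, SmoothAlong S U (f a)) : SmoothAlong S U (fun z => ∑ a ∈ s, f a z) :=
  fun z hz => ContDiffWithinAt.sum fun a ha => hf a ha z hz

theorem prod {α : Type*} {s : Finset α} {f : α → Coord m → ℝ}
    (hf : ∀ a ∈ s, SmoothAlong S U (f a)) : SmoothAlong S U (fun z => ∏ a ∈ s, f a z) :=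
  fun z hz => contDiffWithinAt_prod fun a ha => hf a ha z hz

theorem congr (hU : IsCoordDomain S U) (hF : SmoothAlong S U F) (h : ∀ z ∈ U, F' z = F z) :
    SmoothAlong S U F' := fun z hz => (hF z hz).congr_of_eventuallyEq
      (Filter.eventually_of_mem (hU.mem_nhdsWithin z hz) h) (h z hz)

theorem mono (hF : SmoothAlong S U F) (h : V ⊆ U) : SmoothAlong S V F := fun z hz => hF z (h hz)

theorem pderiv (hU : IsCoordDomain S U) (hF : SmoothAlong S U F) (i : Fin (m + 1)) :
    SmoothAlong S U (pderiv S i F) := fun z hz =>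
  ContDiffWithinAt.clm_apply
    ((hF z hz).fderivWithin_right (m := ∞) hU.uniqueDiffOn (by simp) (hU.subset hz))
    contDiffWithinAt_const

theorem continuousOn (hU : IsCoordDomain S U) (hF : SmoothAlong S U F) : ContinuousOn F U :=
  fun z hz => (hF z hz).continuousWithinAt.mono hU.subset

end SmoothAlong

theorem pderiv_congr (hU : IsCoordDomain S U) (h : ∀ z ∈ U, F z = F' z) {y : Coord m} (hy : y ∈ U)
    (i : Fin (m + 1)) : pderiv S i F y = pderiv S i F' y := by
  unfold pderiv
  rw [Filter.EventuallyEq.fderivWithin_eq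
    (Filter.eventually_of_mem (hU.mem_nhdsWithin y hy) h) (h y hy)]

theorem pderiv_const (c : ℝ) {y : Coord m}
    (i : Fin (m + 1)) : pderiv S i (fun _ => c) y = 0 := by
  simp [pderiv]

section Rules

variable (hU : IsCoordDomain S U) {y : Coord m} (hy : y ∈ U) (i : Fin (m + 1))
include hU hy

theorem pderiv_add (hF : SmoothAlong S U F) (hF' : SmoothAlong S U F') :
    pderiv S i (fun z => F z + F' z) y = pderiv S i F y + pderiv S i F' y := by
  unfold pderiv
  rw [fderivWithin_fun_add (hU.uniqueDiffOn y (hU.subset hy)) (hF.differentiableWithinAt hy)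
    (hF'.differentiableWithinAt hy)]
  rfl

theorem pderiv_sub (hF : SmoothAlong S U F) (hF' : SmoothAlong S U F') :
    pderiv S i (fun z => F z - F' z) y = pderiv S i F y - pderiv S i F' y := by
  unfold pderiv
  rw [fderivWithin_fun_sub (hU.uniqueDiffOn y (hU.subset hy)) (hF.differentiableWithinAt hy)
    (hF'.differentiableWithinAt hy)]
  rfl

theorem pderiv_mul (hF : SmoothAlong S U F) (hF' : SmoothAlong S U F') :
    pderiv S i (fun z => F z * F' z) y = pderiv S i F y * F' y + F y * pderiv S i F' y := by
  unfold pderiv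
  rw [fderivWithin_fun_mul (hU.uniqueDiffOn y (hU.subset hy)) (hF.differentiableWithinAt hy)
    (hF'.differentiableWithinAt hy)]
  simp; ring

theorem pderiv_sum {α : Type*} {s : Finset α} {f : α → Coord m → ℝ}
    (hf : ∀ a ∈ s, SmoothAlong S U (f a)) :
    pderiv S i (fun z => ∑ a ∈ s, f a z) y = ∑ a ∈ s, pderiv S i (f a) y := by
  unfold pderiv
  rw [fderivWithin_fun_sum (hU.uniqueDiffOn y (hU.subset hy))
    fun a ha => (hf a ha).differentiableWithinAt hy]
  simp

theorem pderiv_comp_real (hF : SmoothAlong S U F) {f : ℝ → ℝ} {f' : ℝ}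
    (hf : HasDerivAt f f' (F y)) :
    pderiv S i (fun z => f (F z)) y = f' * pderiv S i F y := by
  unfold pderiv
  have := hf.comp_hasFDerivWithinAt y (hF.differentiableWithinAt hy).hasFDerivWithinAt
  rw [show (fun z => f (F z)) = f ∘ F from rfl,
    this.fderivWithin (hU.uniqueDiffOn y (hU.subset hy))]
  simp

/-- At a boundary point of `S` the symmetry of second derivatives passes to the limit from interior
points; this is what `mem_closure_interior` is for. -/
theorem pderiv_comm (hF : SmoothAlong S U F) (j : Fin (m + 1)) :
    pderiv S i (pderiv S j F) y = pderiv S j (pderiv S i F) y := by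
  have hd := ((hF y hy).fderivWithin_right (m := ∞) hU.uniqueDiffOn (by simp)
    (hU.subset hy)).differentiableWithinAt (by simp)
  have key : ∀ a b : Fin (m + 1), pderiv S a (pderiv S b F) y =
      fderivWithin ℝ (fderivWithin ℝ F S) S y (EuclideanSpace.single a 1)
        (EuclideanSpace.single b 1) := by
    intro a b
    have hu := hU.uniqueDiffOn y (hU.subset hy)
    change fderivWithin ℝ (fun z => fderivWithin ℝ F S z (EuclideanSpace.single b 1)) S y _ = _
    rw [fderivWithin_clm_apply hu hd (differentiableWithinAt_const _)]
    simp
  rw [key, key]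
  exact ((hF y hy).isSymmSndFDerivWithinAt 
    (by simpa using WithTop.coe_le_coe.2 (le_top : (2 : ℕ∞) ≤ ⊤))
    hU.uniqueDiffOn (hU.mem_closure_interior y hy) (hU.subset hy)).eq _ _

end Rules

/-! ### Changes of coordinates -/

/-- A smooth map between coordinate domains. -/
structure IsTransition (S U V : Set (Coord m)) (ψ : Coord m → Coord m) : Prop where
  source : IsCoordDomain S U
  target : IsCoordDomain S V
  mapsTo : MapsTo ψ U V
  smooth : ∀ a, SmoothAlong S U (fun z => ψ z a)

/-- The Jacobi matrix. -/
def jac (S : Set (Coord m)) (ψ : Coord m → Coord m) (z : Coord m) :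
    Matrix (Fin (m + 1)) (Fin (m + 1)) ℝ :=
  Matrix.of fun a i => pderiv S i (fun w => ψ w a) z

namespace IsTransition

variable {ψ : Coord m → Coord m}

theorem contDiffWithinAt (h : IsTransition S U V ψ) {y : Coord m} (hy : y ∈ U) :
    ContDiffWithinAt ℝ ∞ ψ S y :=
  contDiffWithinAt_euclidean.2 fun a => h.smooth a y hy

/-- Since `U` is a neighbourhood within `S` and `ψ` maps it into `V ⊆ S`, the chain rule is
available for derivatives taken within `S`. -/
theorem tendsto (h : IsTransition S U V ψ) {y : Coord m} (hy : y ∈ U) :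
    Filter.Tendsto ψ (nhdsWithin y S) (nhdsWithin (ψ y) S) :=
  tendsto_nhdsWithin_iff.2 ⟨(h.contDiffWithinAt hy).continuousWithinAt,
    Filter.eventually_of_mem (h.source.mem_nhdsWithin y hy)
      fun _ hz => h.target.subset (h.mapsTo hz)⟩

theorem smoothAlong_comp (h : IsTransition S U V ψ) (hF : SmoothAlong S V F) :
    SmoothAlong S U (fun z => F (ψ z)) := by
  intro z hz
  exact (hF (ψ z) (h.mapsTo hz)).comp_of_preimage_mem_nhdsWithin z
    (h.contDiffWithinAt hz) ((h.tendsto hz).eventually self_mem_nhdsWithin)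

theorem smoothAlong_jac (h : IsTransition S U V ψ) (a i : Fin (m + 1)) :
    SmoothAlong S U (fun z => jac S ψ z a i) := (h.smooth a).pderiv h.source i

theorem fderivWithin_apply (h : IsTransition S U V ψ) {y : Coord m} (hy : y ∈ U) (v : Coord m)
    (a : Fin (m + 1)) : fderivWithin ℝ ψ S y v a = fderivWithin ℝ (fun w => ψ w a) S y v := by
  have hd := ((h.contDiffWithinAt hy).differentiableWithinAt (by simp)).hasFDerivWithinAt
  have := (EuclideanSpace.proj (𝕜 := ℝ) a).hasFDerivAt.comp_hasFDerivWithinAt y hd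
  rw [show (fun w => ψ w a) = (EuclideanSpace.proj (𝕜 := ℝ) a) ∘ ψ from rfl,
    this.fderivWithin (h.source.uniqueDiffOn y (h.source.subset hy))]
  rfl

theorem pderiv_comp (h : IsTransition S U V ψ) (hF : SmoothAlong S V F) {y : Coord m} (hy : y ∈ U)
    (i : Fin (m + 1)) :
    pderiv S i (fun z => F (ψ z)) y = ∑ a, jac S ψ y a i * pderiv S a F (ψ y) := by
  have hd := ((h.contDiffWithinAt hy).differentiableWithinAt (by simp)).hasFDerivWithinAt
  have := (hF.differentiableWithinAt (h.mapsTo hy)).hasFDerivWithinAt.comp_of_tendsto y hd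
    (h.tendsto hy)
  unfold pderiv
  rw [show (fun z => F (ψ z)) = F ∘ ψ from rfl,
    this.fderivWithin (h.source.uniqueDiffOn y (h.source.subset hy))]
  have hv : fderivWithin ℝ ψ S y (EuclideanSpace.single i 1)
      = ∑ a, jac S ψ y a i • EuclideanSpace.single a (1 : ℝ) := by
    ext b
    rw [h.fderivWithin_apply hy]
    simp [jac, pderiv, Pi.single_apply, EuclideanSpace.single]
  rw [ContinuousLinearMap.comp_apply, hv]
  simp

end IsTransition

end

section

variable {m : ℕ} {S U V : Set (Coord m)}
  {G G' : Coord m → Matrix (Fin (m + 1)) (Fin (m + 1)) ℝ} {y : Coord m}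

/-! ### Metrics given by coefficient matrices -/

/-- Smooth families of positive definite matrices on a coordinate domain. -/
structure IsMetric (S U : Set (Coord m)) (G : Coord m → Matrix (Fin (m + 1)) (Fin (m + 1)) ℝ) :
    Prop where
  dom : IsCoordDomain S U
  smooth : ∀ i j, SmoothAlong S U (fun z => G z i j)
  posDef : ∀ z ∈ U, (G z).PosDef

theorem SmoothAlong.det {n : ℕ} {A : Coord m → Matrix (Fin n) (Fin n) ℝ}
    (hA : ∀ i j, SmoothAlong S U (fun z => A z i j)) : SmoothAlong S U (fun z => (A z).det) := by
  simp only [Matrix.det_apply, Units.smul_def, zsmul_eq_mul]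
  exact .sum fun σ _ => (SmoothAlong.const _).mul (.prod fun i _ => hA _ _)

namespace IsMetric

variable (hG : IsMetric S U G)
include hG

theorem symm (hy : y ∈ U) (i j : Fin (m + 1)) : G y i j = G y j i := by
  simpa using (hG.posDef y hy).isHermitian.apply j i

theorem det_pos (hy : y ∈ U) : 0 < (G y).det := (hG.posDef y hy).det_pos

theorem isUnit_det (hy : y ∈ U) : IsUnit (G y).det := (hG.det_pos hy).ne'.isUnit

theorem transpose_eq (hy : y ∈ U) : (G y).transpose = G y := by
  ext i j; exact hG.symm hy j i

theorem inv_symm (hy : y ∈ U) (i j : Fin (m + 1)) : (G y)⁻¹ i j = (G y)⁻¹ j i := by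
  have := Matrix.transpose_nonsing_inv (G y)
  rw [hG.transpose_eq hy] at this
  exact congrFun (congrFun this j) i

theorem smooth_det : SmoothAlong S U (fun z => (G z).det) := .det hG.smooth

theorem smooth_inv (i j : Fin (m + 1)) : SmoothAlong S U (fun z => (G z)⁻¹ i j) := by
  have : (fun z => (G z)⁻¹ i j) = fun z => ((G z).det)⁻¹ * (G z).adjugate i j := by
    ext z; simp [Matrix.inv_def]
  rw [this]
  refine (hG.smooth_det.inv fun z hz => (hG.det_pos hz).ne').mul ?_
  simp only [Matrix.adjugate_apply]
  refine .det fun a b => ?_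
  by_cases h : a = j
  · subst h; simpa using SmoothAlong.const _
  · simpa [Matrix.updateRow_ne h] using hG.smooth a b

theorem smooth_christoffel (k i j : Fin (m + 1)) : SmoothAlong S U (christoffel S G k i j) :=
  (SmoothAlong.const _).mul <| .sum fun l _ => (hG.smooth_inv k l).mul <|
    (((hG.smooth j l).pderiv hG.dom i).add ((hG.smooth i l).pderiv hG.dom j)).sub
      ((hG.smooth i j).pderiv hG.dom l)

theorem pderiv_symm (hy : y ∈ U) (l i j : Fin (m + 1)) :
    pderiv S l (fun z => G z i j) y = pderiv S l (fun z => G z j i) y :=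
  pderiv_congr hG.dom (fun _ hz => hG.symm hz i j) hy l

theorem christoffel_symm (hy : y ∈ U) (k i j : Fin (m + 1)) :
    christoffel S G k i j y = christoffel S G k j i y := by
  unfold christoffel
  congr 1
  refine Finset.sum_congr rfl fun l _ => ?_
  rw [hG.pderiv_symm hy l i j]; ring

theorem sum_mul_inv (hy : y ∈ U) (i j : Fin (m + 1)) :
    ∑ k, G y i k * (G y)⁻¹ k j = if i = j then 1 else 0 := by
  rw [← Matrix.mul_apply, Matrix.mul_nonsing_inv _ (hG.isUnit_det hy), Matrix.one_apply]

theorem sum_inv_mul (hy : y ∈ U) (i j : Fin (m + 1)) :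
    ∑ k, (G y)⁻¹ i k * G y k j = if i = j then 1 else 0 := by
  rw [← Matrix.mul_apply, Matrix.nonsing_inv_mul _ (hG.isUnit_det hy), Matrix.one_apply]

/-- The Christoffel symbols of the first kind. -/
theorem sum_mul_christoffel (hy : y ∈ U) (l i j : Fin (m + 1)) :
    ∑ k, G y l k * christoffel S G k i j y = (1 / 2) *
      (pderiv S i (fun z => G z j l) y + pderiv S j (fun z => G z i l) y
        - pderiv S l (fun z => G z i j) y) := by
  have : ∀ k, G y l k * christoffel S G k i j y = (1 / 2) * ∑ a, (G y l k * (G y)⁻¹ k a) *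
      (pderiv S i (fun z => G z j a) y + pderiv S j (fun z => G z i a) y
        - pderiv S a (fun z => G z i j) y) := by
    intro k
    simp only [christoffel, Finset.mul_sum]
    exact Finset.sum_congr rfl fun a _ => by ring
  simp only [this]
  rw [← Finset.mul_sum, Finset.sum_comm]
  simp only [← Finset.sum_mul, hG.sum_mul_inv hy]
  simp

end IsMetric

/-! ### The transformation law of the Christoffel symbols -/

/-- `ψ` is an isometric change of coordinates from `(U, G')` to `(V, G)`. -/
structure IsIsometry (S U V : Set (Coord m)) (G' G : Coord m → Matrix (Fin (m + 1)) (Fin (m + 1)) ℝ)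
    (ψ : Coord m → Coord m) : Prop where
  transition : IsTransition S U V ψ
  source : IsMetric S U G'
  target : IsMetric S V G
  eq : ∀ z ∈ U, G' z = (jac S ψ z).transpose * G (ψ z) * jac S ψ z

namespace IsIsometry

variable {ψ : Coord m → Coord m} (h : IsIsometry S U V G' G ψ)
include h

/-- `IsTransition` asks for no inverse of `ψ`. Invertibility of the Jacobi matrix `J` comes from
`det G' = (det J)² det G` and `det G' ≠ 0`. -/
theorem isUnit_det_jac (hy : y ∈ U) : IsUnit (jac S ψ y).det := by
  have := h.source.isUnit_det hy
  rw [h.eq y hy, Matrix.det_mul, Matrix.det_mul] at this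
  exact isUnit_of_mul_isUnit_right this

theorem apply (hy : y ∈ U) (i j : Fin (m + 1)) : G' y i j =
    ∑ a, ∑ b, jac S ψ y a i * jac S ψ y b j * G (ψ y) a b := by
  rw [h.eq y hy, Matrix.mul_apply, Finset.sum_comm]
  refine Finset.sum_congr rfl fun b _ => ?_
  rw [Matrix.mul_apply, Finset.sum_mul]
  exact Finset.sum_congr rfl fun a _ => by simp [Matrix.transpose_apply]; ring

/-- The product rule for `G' = Jᵀ G J`. The two sums with second derivatives of `ψ` are brought to
one shape, with `j` and `l` exchanged, so that they cancel in the combination defining the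
Christoffel symbols. -/
theorem pderiv_coeff (hy : y ∈ U) (i j l : Fin (m + 1)) :
    pderiv S i (fun z => G' z j l) y =
      (∑ a, ∑ b, pderiv S i (fun z => jac S ψ z a j) y * jac S ψ y b l * G (ψ y) a b)
      + (∑ a, ∑ b, pderiv S i (fun z => jac S ψ z a l) y * jac S ψ y b j * G (ψ y) a b)
      + ∑ a, ∑ b, ∑ c, jac S ψ y a j * jac S ψ y b l * jac S ψ y c i
          * pderiv S c (fun z => G z a b) (ψ y) := by
  have hd := h.transition.source
  have hJ := h.transition.smoothAlong_jac
  have hGs := fun a b => h.transition.smoothAlong_comp (h.target.smooth a b)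
  rw [pderiv_congr hd (fun z hz => h.apply hz j l) hy,
    pderiv_sum hd hy i fun a _ => .sum fun b _ => ((hJ a j).mul (hJ b l)).mul (hGs a b)]
  have e : (∑ a, ∑ b, pderiv S i (fun z => jac S ψ z a l) y * jac S ψ y b j * G (ψ y) a b)
      = ∑ a, ∑ b, pderiv S i (fun z => jac S ψ z b l) y * jac S ψ y a j * G (ψ y) a b := by
    rw [Finset.sum_comm]
    refine Finset.sum_congr rfl fun a _ => Finset.sum_congr rfl fun b _ => ?_
    rw [h.target.symm (h.transition.mapsTo hy)]
  rw [e, ← Finset.sum_add_distrib, ← Finset.sum_add_distrib]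
  refine Finset.sum_congr rfl fun a _ => ?_
  rw [pderiv_sum hd hy i fun b _ => ((hJ a j).mul (hJ b l)).mul (hGs a b),
    ← Finset.sum_add_distrib, ← Finset.sum_add_distrib]
  refine Finset.sum_congr rfl fun b _ => ?_
  rw [pderiv_mul hd hy i ((hJ a j).mul (hJ b l)) (hGs a b), pderiv_mul hd hy i (hJ a j) (hJ b l),
    h.transition.pderiv_comp (h.target.smooth a b) hy, Finset.mul_sum, add_mul]
  congr 1
  · ring
  · exact Finset.sum_congr rfl fun c _ => by ring

theorem pderiv_jac_comm (hy : y ∈ U) (i j c : Fin (m + 1)) :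
    pderiv S i (fun z => jac S ψ z c j) y = pderiv S j (fun z => jac S ψ z c i) y :=
  pderiv_comm h.transition.source hy i (h.transition.smooth c) j

/-- With the free index lowered, both sides become symbols of the first kind, which are sums of
derivatives of coefficients. Of the six second-derivative sums from `pderiv_coeff`, four cancel in
pairs and the remaining two coincide, which gives the inhomogeneous term. -/
theorem christoffel_law (hy : y ∈ U) (c i j : Fin (m + 1)) :
    ∑ k, jac S ψ y c k * christoffel S G' k i j y =
      (∑ a, ∑ b, jac S ψ y a i * jac S ψ y b j * christoffel S G c a b (ψ y))
        + pderiv S i (fun z => jac S ψ z c j) y := by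
  -- `A = Jᵀ G` lowers the index: it is invertible and `A J = G'`, so it suffices to compare both
  -- sides after applying it.
  set A := (jac S ψ y).transpose * G (ψ y) with hA
  have hAu : IsUnit A.det := by
    rw [hA, Matrix.det_mul, Matrix.det_transpose]
    exact (h.isUnit_det_jac hy).mul (h.target.isUnit_det (h.transition.mapsTo hy))
  have hinj : Function.Injective A.mulVec :=
    Matrix.mulVec_injective_iff_isUnit.2 ((Matrix.isUnit_iff_isUnit_det A).2 hAu)
  suffices hs : A.mulVec (fun c => ∑ k, jac S ψ y c k * christoffel S G' k i j y) =
      A.mulVec (fun c => (∑ a, ∑ b, jac S ψ y a i * jac S ψ y b j * christoffel S G c a b (ψ y))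
        + pderiv S i (fun z => jac S ψ z c j) y) from congrFun (hinj hs) c
  ext l
  have hL : A.mulVec (fun c => ∑ k, jac S ψ y c k * christoffel S G' k i j y) l =
      ∑ k, G' y l k * christoffel S G' k i j y := by
    have : (fun c => ∑ k, jac S ψ y c k * christoffel S G' k i j y) =
      (jac S ψ y).mulVec (fun k => christoffel S G' k i j y) := rfl
    rw [this, Matrix.mulVec_mulVec, hA, ← h.eq y hy]
    rfl
  have hAc : ∀ c, A l c = ∑ b, jac S ψ y b l * G (ψ y) b c := fun c => rfl
  have hR : ∑ c, A l c * pderiv S i (fun z => jac S ψ z c j) y =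
      ∑ a, ∑ b, pderiv S i (fun z => jac S ψ z a j) y * jac S ψ y b l * G (ψ y) a b := by
    refine Finset.sum_congr rfl fun a _ => ?_
    rw [hAc, Finset.sum_mul]
    refine Finset.sum_congr rfl fun b _ => ?_
    rw [h.target.symm (h.transition.mapsTo hy) b a]; ring
  have hR2 : ∑ c, A l c * (∑ a, ∑ b, jac S ψ y a i * jac S ψ y b j * christoffel S G c a b (ψ y))
      = ∑ a, ∑ b, ∑ d, jac S ψ y a i * jac S ψ y b j * jac S ψ y d l * ((1 / 2) *
        (pderiv S a (fun z => G z b d) (ψ y) + pderiv S b (fun z => G z a d) (ψ y)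
        - pderiv S d (fun z => G z a b) (ψ y))) := by
    simp only [← h.target.sum_mul_christoffel (h.transition.mapsTo hy), Finset.mul_sum, hAc,
      Finset.sum_mul]
    rw [Finset.sum_comm]
    refine Finset.sum_congr rfl fun a _ => ?_
    rw [Finset.sum_comm]
    refine Finset.sum_congr rfl fun b _ => ?_
    rw [Finset.sum_comm]
    exact Finset.sum_congr rfl fun d _ => Finset.sum_congr rfl fun c _ => by ring
  rw [hL, h.source.sum_mul_christoffel hy, Matrix.mulVec, dotProduct]
  simp only [mul_add, Finset.sum_add_distrib]
  rw [hR, hR2, h.pderiv_coeff hy i j l, h.pderiv_coeff hy j i l, h.pderiv_coeff hy l i j]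
  have e1 : ∀ p q r, (∑ a, ∑ b, pderiv S p (fun z => jac S ψ z a q) y * jac S ψ y b r * G (ψ y) a b)
    = ∑ a, ∑ b, pderiv S q (fun z => jac S ψ z a p) y * jac S ψ y b r * G (ψ y) a b := by
    intro p q r
    simp only [h.pderiv_jac_comm hy p q]
  have e2 : ∀ f : Fin (m + 1) → Fin (m + 1) → Fin (m + 1) → ℝ,
      ∑ a, ∑ b, ∑ c, f a b c = ∑ a, ∑ c, ∑ b, f a b c :=
    fun f => Finset.sum_congr rfl fun a _ => Finset.sum_comm
  have e3 : ∀ f : Fin (m + 1) → Fin (m + 1) → Fin (m + 1) → ℝ,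
      ∑ a, ∑ b, ∑ c, f a b c = ∑ c, ∑ a, ∑ b, f a b c :=
    fun f => (e2 f).trans Finset.sum_comm
  rw [e1 j i l, e1 l i j, e1 l j i, e3 (fun a b c => jac S ψ y a j * jac S ψ y b l *
    jac S ψ y c i * _), e2 (fun a b c => jac S ψ y a i * jac S ψ y b l * jac S ψ y c j * _)]
  -- `K₁`, `K₂`, `K₃` are the second-derivative sums identified by symmetry in `e1`; only `K₁`
  -- survives.
  have e4 : ∀ X Y Z W K₁ K₂ K₃ : ℝ, W = (1 / 2) * (X + Y - Z) →
      (1 / 2) * (K₁ + K₂ + X + (K₁ + K₃ + Y) - (K₂ + K₃ + Z)) = W + K₁ := by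
    intros; linarith
  refine e4 _ _ _ _ _ _ _ ?_
  simp only [Finset.mul_sum, ← Finset.sum_add_distrib, ← Finset.sum_sub_distrib]
  exact Finset.sum_congr rfl fun a _ => Finset.sum_congr rfl fun b _ =>
    Finset.sum_congr rfl fun d _ => by ring

end IsIsometry

end

section

variable {m : ℕ} {S U V : Set (Coord m)}
  {G G' : Coord m → Matrix (Fin (m + 1)) (Fin (m + 1)) ℝ} {y : Coord m}

/-! ### The transformation law of the curvature -/

/-- The entrywise partial derivative of a matrix-valued function. -/
def mpderiv (S : Set (Coord m)) (i : Fin (m + 1))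
    (A : Coord m → Matrix (Fin (m + 1)) (Fin (m + 1)) ℝ) (y : Coord m) :
    Matrix (Fin (m + 1)) (Fin (m + 1)) ℝ :=
  Matrix.of fun a b => pderiv S i (fun z => A z a b) y

/-- The connection matrices `(Γᵢ)ᵏⱼ = Γᵏᵢⱼ`. -/
def connection (S : Set (Coord m)) (G : Coord m → Matrix (Fin (m + 1)) (Fin (m + 1)) ℝ)
    (i : Fin (m + 1)) (y : Coord m) : Matrix (Fin (m + 1)) (Fin (m + 1)) ℝ :=
  Matrix.of fun k j => christoffel S G k i j y

/-- The curvature matrices `∂ᵢΓⱼ - ∂ⱼΓᵢ + ΓᵢΓⱼ - ΓⱼΓᵢ`. -/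
def curvature (S : Set (Coord m)) (G : Coord m → Matrix (Fin (m + 1)) (Fin (m + 1)) ℝ)
    (i j : Fin (m + 1)) (y : Coord m) : Matrix (Fin (m + 1)) (Fin (m + 1)) ℝ :=
  mpderiv S i (connection S G j) y - mpderiv S j (connection S G i) y
    + (connection S G i y * connection S G j y - connection S G j y * connection S G i y)

theorem ricci_eq_sum_curvature (S : Set (Coord m))
    (G : Coord m → Matrix (Fin (m + 1)) (Fin (m + 1)) ℝ) (j k : Fin (m + 1)) (y : Coord m) :
    ricci S G j k y = ∑ i, curvature S G i j y i k := by
  simp only [ricci, curvature, Matrix.add_apply, Matrix.sub_apply, Matrix.mul_apply,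
    Finset.sum_add_distrib, Finset.sum_sub_distrib]
  rfl

theorem scalar_eq_trace (S : Set (Coord m))
    (G : Coord m → Matrix (Fin (m + 1)) (Fin (m + 1)) ℝ) (y : Coord m) :
    scalar S G y = ((G y)⁻¹ * (Matrix.of fun j k => ricci S G j k y).transpose).trace := by
  simp [scalar, Matrix.trace, Matrix.mul_apply]

theorem mpderiv_mul (hU : IsCoordDomain S U) (hy : y ∈ U) (i : Fin (m + 1))
    {A B : Coord m → Matrix (Fin (m + 1)) (Fin (m + 1)) ℝ}
    (hA : ∀ a b, SmoothAlong S U (fun z => A z a b))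
    (hB : ∀ a b, SmoothAlong S U (fun z => B z a b)) :
    mpderiv S i (fun z => A z * B z) y = mpderiv S i A y * B y + A y * mpderiv S i B y := by
  ext a b
  simp only [mpderiv, Matrix.of_apply, Matrix.mul_apply, Matrix.add_apply]
  rw [pderiv_sum hU hy i fun c _ => (hA a c).mul (hB c b), ← Finset.sum_add_distrib]
  exact Finset.sum_congr rfl fun c _ => pderiv_mul hU hy i (hA a c) (hB c b)

theorem mpderiv_add (hU : IsCoordDomain S U) (hy : y ∈ U) (i : Fin (m + 1))
    {A B : Coord m → Matrix (Fin (m + 1)) (Fin (m + 1)) ℝ}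
    (hA : ∀ a b, SmoothAlong S U (fun z => A z a b))
    (hB : ∀ a b, SmoothAlong S U (fun z => B z a b)) :
    mpderiv S i (fun z => A z + B z) y = mpderiv S i A y + mpderiv S i B y := by
  ext a b
  exact pderiv_add hU hy i (hA a b) (hB a b)

theorem mpderiv_congr (hU : IsCoordDomain S U)
    {A B : Coord m → Matrix (Fin (m + 1)) (Fin (m + 1)) ℝ} (h : ∀ z ∈ U, A z = B z)
    (hy : y ∈ U) (i : Fin (m + 1)) : mpderiv S i A y = mpderiv S i B y := by
  ext a b
  exact pderiv_congr hU (fun z hz => by rw [h z hz]) hy i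

namespace IsIsometry

variable {ψ : Coord m → Coord m} (h : IsIsometry S U V G' G ψ)
include h

/-- The pull-back of the connection matrices, before the change of frame. -/
theorem connection_law (hy : y ∈ U) (i : Fin (m + 1)) :
    jac S ψ y * connection S G' i y =
      (∑ a, jac S ψ y a i • connection S G a (ψ y)) * jac S ψ y + mpderiv S i (jac S ψ) y := by
  ext c l
  rw [Matrix.add_apply, Matrix.mul_apply, Matrix.mul_apply]
  refine (h.christoffel_law hy c i l).trans ?_
  congr 1
  rw [Finset.sum_comm]
  refine Finset.sum_congr rfl fun b _ => ?_
  rw [Matrix.sum_apply, Finset.sum_mul]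
  exact Finset.sum_congr rfl fun a _ => by simp [connection]; ring

theorem mpderiv_pullback (hy : y ∈ U) (i j : Fin (m + 1)) :
    mpderiv S i (fun z => ∑ a, jac S ψ z a j • connection S G a (ψ z)) y =
      (∑ b, pderiv S i (fun z => jac S ψ z b j) y • connection S G b (ψ y))
      + ∑ a, ∑ b, (jac S ψ y a i * jac S ψ y b j) • mpderiv S a (connection S G b) (ψ y) := by
  have hd := h.transition.source
  have hJ := h.transition.smoothAlong_jac
  ext c d
  have hc := fun b => h.transition.smoothAlong_comp (h.target.smooth_christoffel c b d)
  simp only [mpderiv, Matrix.of_apply, Matrix.sum_apply, Matrix.add_apply, Matrix.smul_apply,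
    smul_eq_mul, connection]
  rw [pderiv_sum hd hy i fun b _ => (hJ b j).mul (hc b), Finset.sum_comm,
    ← Finset.sum_add_distrib]
  refine Finset.sum_congr rfl fun b _ => ?_
  rw [pderiv_mul hd hy i (hJ b j) (hc b),
    h.transition.pderiv_comp (h.target.smooth_christoffel c b d) hy, Finset.mul_sum]
  congr 1
  exact Finset.sum_congr rfl fun a _ => by ring

/-- Gauge covariance of curvature. Differentiating `J Γ'ₗ = Cₗ J + ∂ₗJ`, with `Cₗ` the pulled-back
connection, and antisymmetrizing removes the second derivatives of `J`; the remaining terms with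
`∂J` cancel against those produced by the commutator. -/
theorem curvature_law (hy : y ∈ U) (i j : Fin (m + 1)) :
    jac S ψ y * curvature S G' i j y =
      (∑ a, ∑ b, (jac S ψ y a i * jac S ψ y b j) • curvature S G a b (ψ y)) * jac S ψ y := by
  have hd := h.transition.source
  have hJ := h.transition.smoothAlong_jac
  set C : Fin (m + 1) → Coord m → Matrix (Fin (m + 1)) (Fin (m + 1)) ℝ :=
    fun i z => ∑ a, jac S ψ z a i • connection S G a (ψ z) with hC
  have hCs : ∀ i a b, SmoothAlong S U (fun z => C i z a b) := by
    intro i a b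
    simp only [hC, Matrix.sum_apply]
    exact .sum fun c _ => (hJ c i).mul
      (h.transition.smoothAlong_comp (h.target.smooth_christoffel a c b))
  have hlaw : ∀ k, ∀ z ∈ U, jac S ψ z * connection S G' k z =
      C k z * jac S ψ z + mpderiv S k (jac S ψ) z := fun k z hz => h.connection_law hz k
  have hdiff : ∀ k l, mpderiv S k (jac S ψ) y * connection S G' l y
      + jac S ψ y * mpderiv S k (connection S G' l) y =
      mpderiv S k (C l) y * jac S ψ y + C l y * mpderiv S k (jac S ψ) y
        + mpderiv S k (mpderiv S l (jac S ψ)) y := by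
    intro k l
    have hgs : ∀ a b, SmoothAlong S U (fun z => connection S G' l z a b) :=
      fun a b => h.source.smooth_christoffel a l b
    rw [← mpderiv_mul hd hy k hJ hgs, mpderiv_congr hd (hlaw l) hy k,
      mpderiv_add hd hy k _ _, mpderiv_mul hd hy k (hCs l) hJ]
    · intro a b
      simp only [Matrix.mul_apply]
      exact .sum fun c _ => (hCs l a c).mul (hJ c b)
    · exact fun a b => (hJ a b).pderiv hd l
  have hsymm : mpderiv S i (mpderiv S j (jac S ψ)) y = mpderiv S j (mpderiv S i (jac S ψ)) y := by
    ext a b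
    exact pderiv_comm hd hy i (hJ a b) j
  -- The curvature of the pull-back is the pull-back of the curvature: the derivatives of the
  -- factors `J` are symmetric in `i`, `j` and drop out.
  have hcurv : (∑ a, ∑ b, (jac S ψ y a i * jac S ψ y b j) • curvature S G a b (ψ y)) =
      mpderiv S i (C j) y - mpderiv S j (C i) y + (C i y * C j y - C j y * C i y) := by
    have e1 : ∑ b, pderiv S i (fun z => jac S ψ z b j) y • connection S G b (ψ y) =
        ∑ b, pderiv S j (fun z => jac S ψ z b i) y • connection S G b (ψ y) := by
      simp only [h.pderiv_jac_comm hy i j]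
    rw [h.mpderiv_pullback hy, h.mpderiv_pullback hy, e1, add_sub_add_left_eq_sub]
    rw [Finset.sum_comm (f := fun a b => (jac S ψ y a j * jac S ψ y b i) • _)]
    have e2 : ∀ i j, C i y * C j y = ∑ a, ∑ b, (jac S ψ y a i * jac S ψ y b j) •
        (connection S G a (ψ y) * connection S G b (ψ y)) := by
      intro i j
      simp only [hC, Finset.sum_mul_sum, smul_mul_smul_comm]
    rw [e2 i j, e2 j i,
      Finset.sum_comm (f := fun a b => (jac S ψ y a j * jac S ψ y b i) • (_ * _))]
    simp only [← Finset.sum_sub_distrib, ← Finset.sum_add_distrib]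
    refine Finset.sum_congr rfl fun a _ => Finset.sum_congr rfl fun b _ => ?_
    simp only [curvature, smul_add, smul_sub]
    rw [mul_comm (jac S ψ y b j)]
  rw [hcurv]
  have h1 := hdiff i j
  have h2 := hdiff j i
  rw [hsymm] at h1
  have l1 := hlaw i y hy
  have l2 := hlaw j y hy
  set J := jac S ψ y
  set Ji := mpderiv S i (jac S ψ) y
  set Jj := mpderiv S j (jac S ψ) y
  set Gi := connection S G' i y
  set Gj := connection S G' j y
  have h3 : J * (mpderiv S i (connection S G' j) y - mpderiv S j (connection S G' i) y) =
      (mpderiv S i (C j) y - mpderiv S j (C i) y) * J + C j y * Ji - C i y * Jj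
        - Ji * Gj + Jj * Gi := by
    rw [mul_sub, eq_sub_of_add_eq' h1, eq_sub_of_add_eq' h2]
    noncomm_ring
  have h4 : J * (Gi * Gj - Gj * Gi) = (C i y * C j y - C j y * C i y) * J
      + C i y * Jj - C j y * Ji + Ji * Gj - Jj * Gi := by
    have q1 : J * (Gi * Gj) = C i y * (C j y * J + Jj) + Ji * Gj := by
      rw [← mul_assoc, l1, add_mul, mul_assoc, l2]
    have q2 : J * (Gj * Gi) = C j y * (C i y * J + Ji) + Jj * Gi := by
      rw [← mul_assoc, l2, add_mul, mul_assoc, l1]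
    rw [mul_sub, q1, q2]
    noncomm_ring
  rw [curvature, mul_add, h3, h4]
  noncomm_ring

/-- In the contraction, the `J⁻¹` carried by the upper index meets the `J` carried by the first
lower index; only the factors for the two free indices remain. -/
theorem ricci_law (hy : y ∈ U) : (Matrix.of fun j l => ricci S G' j l y) =
    (jac S ψ y).transpose * (Matrix.of fun j l => ricci S G j l (ψ y)) * jac S ψ y := by
  have hu := h.isUnit_det_jac hy
  set J := jac S ψ y with hJ
  ext j l
  have h1 : ∀ i, curvature S G' i j y i l = ∑ a, ∑ b, ∑ d, ∑ c,
      (J a i * J⁻¹ i c) * (J b j * J d l * curvature S G a b (ψ y) c d) := by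
    intro i
    have : curvature S G' i j y = J⁻¹ * ((∑ a, ∑ b, (J a i * J b j) • curvature S G a b (ψ y)) * J) := by
      rw [← h.curvature_law hy, ← mul_assoc, Matrix.nonsing_inv_mul _ hu, one_mul]
    rw [this]
    simp only [Finset.sum_mul, Finset.mul_sum, Matrix.sum_apply]
    refine Finset.sum_congr rfl fun a _ => Finset.sum_congr rfl fun b _ => ?_
    simp only [Matrix.mul_apply, Finset.mul_sum, Matrix.smul_apply, smul_eq_mul]
    rw [Finset.sum_comm]
    exact Finset.sum_congr rfl fun d _ => Finset.sum_congr rfl fun c _ => by ring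
  rw [Matrix.of_apply, ricci_eq_sum_curvature]
  simp only [h1]
  have h2 : ∀ a c, ∑ i, J a i * J⁻¹ i c = if a = c then 1 else 0 := by
    intro a c
    rw [← Matrix.mul_apply, Matrix.mul_nonsing_inv _ hu, Matrix.one_apply]
  calc _ = ∑ a, ∑ b, ∑ d, ∑ c, (∑ i, J a i * J⁻¹ i c) *
        (J b j * J d l * curvature S G a b (ψ y) c d) := by
        rw [Finset.sum_comm]
        refine Finset.sum_congr rfl fun a _ => ?_
        rw [Finset.sum_comm]
        refine Finset.sum_congr rfl fun b _ => ?_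
        rw [Finset.sum_comm]
        refine Finset.sum_congr rfl fun d _ => ?_
        rw [Finset.sum_comm]
        simp only [Finset.sum_mul]
    _ = ∑ d, ∑ b, ∑ a, J b j * J d l * curvature S G a b (ψ y) a d := by
        simp only [h2, ite_mul, one_mul, zero_mul, Finset.sum_ite_eq, Finset.mem_univ, if_true]
        rw [Finset.sum_comm]
        simp only [Finset.sum_comm (f := fun a d => J _ j * J d l * curvature S G a _ (ψ y) a d)]
        rw [Finset.sum_comm]
    _ = _ := by
        rw [Matrix.mul_apply]
        refine Finset.sum_congr rfl fun d _ => ?_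
        rw [Matrix.mul_apply, Finset.sum_mul]
        refine Finset.sum_congr rfl fun b _ => ?_
        rw [Matrix.of_apply, ricci_eq_sum_curvature, Matrix.transpose_apply, Finset.mul_sum,
          Finset.sum_mul]
        exact Finset.sum_congr rfl fun a _ => by ring

theorem inv_law (hy : y ∈ U) :
    (G' y)⁻¹ = (jac S ψ y)⁻¹ * (G (ψ y))⁻¹ * ((jac S ψ y)⁻¹).transpose := by
  rw [h.eq y hy, Matrix.mul_inv_rev, Matrix.mul_inv_rev, Matrix.transpose_nonsing_inv, mul_assoc]

/-- The factors `J` of the Ricci matrix cancel the `J⁻¹` of the inverse metric under the cyclic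
trace. -/
theorem scalar_eq (hy : y ∈ U) : scalar S G' y = scalar S G (ψ y) := by
  have hu := h.isUnit_det_jac hy
  rw [scalar_eq_trace, scalar_eq_trace, h.ricci_law hy, h.inv_law hy, Matrix.transpose_mul,
    Matrix.transpose_mul, Matrix.transpose_transpose, Matrix.trace_mul_comm]
  set J := jac S ψ y
  set R := (Matrix.of fun j l => ricci S G j l (ψ y)).transpose
  have e : J.transpose * (R * J) * (J⁻¹ * (G (ψ y))⁻¹ * J⁻¹.transpose) =
      J.transpose * (R * (G (ψ y))⁻¹ * J⁻¹.transpose) := by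
    simp only [mul_assoc]
    rw [← mul_assoc J, Matrix.mul_nonsing_inv _ hu, one_mul]
  rw [e, Matrix.trace_mul_comm, mul_assoc, ← Matrix.transpose_mul, Matrix.mul_nonsing_inv _ hu,
    Matrix.transpose_one, mul_one, Matrix.trace_mul_comm]

end IsIsometry

theorem IsMetric.smooth_scalar (hG : IsMetric S U G) : SmoothAlong S U (scalar S G) :=
  .sum fun j _ => .sum fun k _ => (hG.smooth_inv j k).mul <|
    (SmoothAlong.sum fun i _ => ((hG.smooth_christoffel i j k).pderiv hG.dom i).sub
      ((hG.smooth_christoffel i i k).pderiv hG.dom j)).add <|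
    .sum fun i _ => .sum fun p _ =>
      ((hG.smooth_christoffel i i p).mul (hG.smooth_christoffel p j k)).sub
        ((hG.smooth_christoffel i j p).mul (hG.smooth_christoffel p i k))

end

section

variable {m : ℕ} {S U V : Set (Coord m)}
  {G G' : Coord m → Matrix (Fin (m + 1)) (Fin (m + 1)) ℝ} {y : Coord m}

/-! ### Gradient, divergence and the volume density -/

/-- The components `Xᵏ = ∑ₗ gᵏˡ ∂ₗ f` of the gradient. -/
def gradient (S : Set (Coord m)) (G : Coord m → Matrix (Fin (m + 1)) (Fin (m + 1)) ℝ)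
    (f : Coord m → ℝ) (k : Fin (m + 1)) (y : Coord m) : ℝ :=
  ∑ l, (G y)⁻¹ k l * pderiv S l f y

/-- The inner product `∑ₖₗ gᵏˡ ∂ₖ f ∂ₗ h` of two gradients. -/
def gradPairing (S : Set (Coord m)) (G : Coord m → Matrix (Fin (m + 1)) (Fin (m + 1)) ℝ)
    (f h : Coord m → ℝ) (y : Coord m) : ℝ :=
  ∑ k, pderiv S k f y * gradient S G h k y

/-- The derivative of `f` in the direction of the conormal. -/
def conormalDeriv (S : Set (Coord m)) (G : Coord m → Matrix (Fin (m + 1)) (Fin (m + 1)) ℝ)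
    (f : Coord m → ℝ) (y : Coord m) : ℝ :=
  ∑ k, pderiv S k f y * conormal G k y

theorem pderiv_prod {α : Type*} [DecidableEq α] (hU : IsCoordDomain S U) (hy : y ∈ U)
    (i : Fin (m + 1)) (s : Finset α) {f : α → Coord m → ℝ} (hf : ∀ a, SmoothAlong S U (f a)) :
    pderiv S i (fun z => ∏ a ∈ s, f a z) y =
      ∑ a ∈ s, (∏ b ∈ s.erase a, f b y) * pderiv S i (f a) y := by
  unfold pderiv
  have := HasFDerivWithinAt.finsetProd (u := s) (x := y) (s := S) (g := fun a z => f a z)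
    fun a _ => ((hf a).differentiableWithinAt hy).hasFDerivWithinAt
  rw [HasFDerivWithinAt.fderivWithin this (hU.uniqueDiffOn y (hU.subset hy))]
  simp

/-- Jacobi's formula. -/
theorem pderiv_det (hU : IsCoordDomain S U) (hy : y ∈ U) (i : Fin (m + 1)) {n : ℕ}
    {A : Coord m → Matrix (Fin n) (Fin n) ℝ}
    (hA : ∀ a b, SmoothAlong S U (fun z => A z a b)) :
    pderiv S i (fun z => (A z).det) y =
      ∑ a, ∑ b, (A y).adjugate a b * pderiv S i (fun z => A z b a) y := by
  -- By Cramer's rule the inner sum is the determinant with column `a` replaced by its derivative.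
  -- Jacobi's formula thus becomes the product rule applied to each term of the Leibniz expansion.
  have h1 : ∀ a, ∑ b, (A y).adjugate a b * pderiv S i (fun z => A z b a) y =
      ((A y).updateCol a (fun b => pderiv S i (fun z => A z b a) y)).det := by
    intro a
    rw [← Matrix.cramer_apply, Matrix.cramer_eq_adjugate_mulVec]
    rfl
  simp only [h1]
  simp only [Matrix.det_apply, Units.smul_def, zsmul_eq_mul]
  rw [pderiv_sum hU hy i fun σ _ => (SmoothAlong.const _).mul (.prod fun c _ => hA _ _),
    Finset.sum_comm]
  refine Finset.sum_congr rfl fun σ _ => ?_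
  rw [pderiv_mul hU hy i (.const _) (.prod fun c _ => hA _ _), pderiv_const, zero_mul, zero_add,
    pderiv_prod hU hy i _ fun c => hA _ _, Finset.mul_sum]
  refine Finset.sum_congr rfl fun a _ => ?_
  congr 1
  rw [← Finset.prod_erase_mul _ _ (Finset.mem_univ a)]
  congr 1
  · refine Finset.prod_congr rfl fun b hb => ?_
    rw [Matrix.updateCol_ne (Finset.ne_of_mem_erase hb)]
  · simp

namespace IsMetric

variable (hG : IsMetric S U G)
include hG

theorem smooth_gradient {f : Coord m → ℝ} (hf : SmoothAlong S U f) (k : Fin (m + 1)) :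
    SmoothAlong S U (gradient S G f k) :=
  .sum fun l _ => (hG.smooth_inv k l).mul (hf.pderiv hG.dom l)

theorem smooth_gradPairing {f h : Coord m → ℝ} (hf : SmoothAlong S U f) (hh : SmoothAlong S U h) :
    SmoothAlong S U (gradPairing S G f h) :=
  .sum fun k _ => (hf.pderiv hG.dom k).mul (hG.smooth_gradient hh k)

theorem inv_zero_zero_pos (hy : y ∈ U) : 0 < (G y)⁻¹ 0 0 :=
  (hG.posDef y hy).inv.diag_pos

theorem smooth_conormal (k : Fin (m + 1)) : SmoothAlong S U (conormal G k) :=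
  ((hG.smooth_inv k 0).mul (((hG.smooth_inv 0 0).sqrt
    fun _ hz => (hG.inv_zero_zero_pos hz).ne').inv
    fun _ hz => (Real.sqrt_pos.2 (hG.inv_zero_zero_pos hz)).ne')).neg

theorem smooth_conormalDeriv {f : Coord m → ℝ} (hf : SmoothAlong S U f) :
    SmoothAlong S U (conormalDeriv S G f) :=
  .sum fun k _ => (hf.pderiv hG.dom k).mul (hG.smooth_conormal k)

theorem sum_mul_gradient (hy : y ∈ U) (f : Coord m → ℝ) (k : Fin (m + 1)) :
    ∑ i, G y k i * gradient S G f i y = pderiv S k f y := by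
  simp only [gradient, Finset.mul_sum]
  rw [Finset.sum_comm]
  simp only [← mul_assoc, ← Finset.sum_mul, hG.sum_mul_inv hy]
  simp

/-- Of the three derivatives in the symbol, two cancel because `gⁱˡ` is symmetric. What remains is
half the logarithmic derivative of `det G`. -/
theorem trace_christoffel (hy : y ∈ U) (k : Fin (m + 1)) :
    ∑ i, christoffel S G i i k y =
      (1 / 2) * ∑ i, ∑ l, (G y)⁻¹ i l * pderiv S k (fun z => G z i l) y := by
  simp only [christoffel, ← Finset.mul_sum]
  congr 1
  have h1 : ∑ i, ∑ l, (G y)⁻¹ i l * pderiv S i (fun z => G z k l) y =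
      ∑ i, ∑ l, (G y)⁻¹ i l * pderiv S l (fun z => G z i k) y := by
    rw [Finset.sum_comm]
    refine Finset.sum_congr rfl fun i _ => Finset.sum_congr rfl fun l _ => ?_
    rw [hG.inv_symm hy, hG.pderiv_symm hy]
  simp only [mul_sub, mul_add, Finset.sum_sub_distrib, Finset.sum_add_distrib]
  rw [h1]; ring

theorem pderiv_sqrt_det (hy : y ∈ U) (k : Fin (m + 1)) :
    pderiv S k (fun z => √(G z).det) y = √(G y).det * ∑ i, christoffel S G i i k y := by
  have hpos := hG.det_pos hy
  rw [pderiv_comp_real hG.dom hy k hG.smooth_det (f := Real.sqrt) (Real.hasDerivAt_sqrt hpos.ne'),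
    pderiv_det hG.dom hy k hG.smooth, hG.trace_christoffel hy]
  have h1 : ∀ a b, (G y).adjugate a b = (G y).det * (G y)⁻¹ a b := by
    intro a b
    rw [Matrix.inv_def]
    simp [hpos.ne']
  have h2 : ∀ a b, (G y).adjugate a b * pderiv S k (fun z => G z b a) y =
      (G y).det * ((G y)⁻¹ a b * pderiv S k (fun z => G z a b) y) := by
    intro a b; rw [h1, hG.pderiv_symm hy, mul_assoc]
  simp only [h2, ← Finset.mul_sum]
  have h3 : √(G y).det ≠ 0 := (Real.sqrt_pos.2 hpos).ne'
  have h4 : (G y).det = √(G y).det * √(G y).det := (Real.mul_self_sqrt hpos.le).symm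
  generalize (∑ a, ∑ b, (G y)⁻¹ a b * pderiv S k (fun z => G z a b) y) = t
  rw [← mul_assoc]
  nth_rewrite 2 [h4]
  field_simp

/-- The trace of the connection is the logarithmic derivative of `√det G`, so the Riemannian
divergence times the volume density is a Euclidean divergence. This reduces the divergence theorem
to flat space. -/
theorem sum_pderiv_density_mul (hy : y ∈ U) {X : Fin (m + 1) → Coord m → ℝ}
    (hX : ∀ k, SmoothAlong S U (X k)) :
    ∑ k, pderiv S k (fun z => √(G z).det * X k z) y = √(G y).det * divergence S G X y := by
  have hs : SmoothAlong S U (fun z => √(G z).det) :=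
    hG.smooth_det.sqrt fun _ hz => (hG.det_pos hz).ne'
  simp only [pderiv_mul hG.dom hy _ hs (hX _), hG.pderiv_sqrt_det hy, divergence,
    Finset.sum_add_distrib, mul_add, Finset.mul_sum]
  rw [add_comm, Finset.sum_comm (f := fun i k => √(G y).det * (christoffel S G i i k y * X k y))]
  congr 1
  refine Finset.sum_congr rfl fun k _ => ?_
  rw [Finset.sum_mul]
  exact Finset.sum_congr rfl fun i _ => by ring

theorem divergence_mul (hy : y ∈ U) {f : Coord m → ℝ} {X : Fin (m + 1) → Coord m → ℝ}
    (hf : SmoothAlong S U f) (hX : ∀ k, SmoothAlong S U (X k)) :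
    divergence S G (fun k z => f z * X k z) y =
      f y * divergence S G X y + ∑ k, pderiv S k f y * X k y := by
  simp only [divergence, pderiv_mul hG.dom hy _ hf (hX _), Finset.sum_add_distrib, mul_add,
    Finset.mul_sum]
  have : ∀ i k, christoffel S G i i k y * (f y * X k y) = f y * (christoffel S G i i k y * X k y) :=
    fun i k => by ring
  simp only [this]
  ring

/-- The trace of the Hessian is the divergence of the gradient. -/
theorem trace_hessian (hy : y ∈ U) {f : Coord m → ℝ} (hf : SmoothAlong S U f) :
    ∑ j, ∑ k, (G y)⁻¹ j k *
      (pderiv S j (pderiv S k f) y - ∑ p, pderiv S p f y * christoffel S G p j k y) =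
      divergence S G (gradient S G f) y := by
  have hX := hG.smooth_gradient hf
  set X := gradient S G f with hXdef
  -- Writing `∂ₖ f = ∑ᵢ gₖᵢ Xⁱ` before differentiating makes the derivatives `∂ⱼ Xⁱ` of the
  -- divergence appear.
  have h1 : ∀ j k, pderiv S j (pderiv S k f) y =
      ∑ i, (pderiv S j (fun z => G z k i) y * X i y + G y k i * pderiv S j (X i) y) := by
    intro j k
    rw [← pderiv_congr hG.dom (fun z hz => hG.sum_mul_gradient hz f k) hy j,
      pderiv_sum hG.dom hy j fun i _ => (hG.smooth k i).mul (hX i)]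
    exact Finset.sum_congr rfl fun i _ => pderiv_mul hG.dom hy j (hG.smooth k i) (hX i)
  have h2 : ∀ j k, ∑ p, pderiv S p f y * christoffel S G p j k y =
      ∑ i, X i y * ((1 / 2) * (pderiv S j (fun z => G z k i) y + pderiv S k (fun z => G z j i) y
        - pderiv S i (fun z => G z j k) y)) := by
    intro j k
    simp only [← hG.sum_mul_christoffel hy, ← hG.sum_mul_gradient hy f, Finset.sum_mul,
      Finset.mul_sum]
    rw [Finset.sum_comm]
    refine Finset.sum_congr rfl fun i _ => Finset.sum_congr rfl fun p _ => ?_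
    rw [hG.symm hy p i]; ring
  have h3 : ∀ j k, (G y)⁻¹ j k *
      (pderiv S j (pderiv S k f) y - ∑ p, pderiv S p f y * christoffel S G p j k y) =
      (∑ i, ((G y)⁻¹ j k * G y k i) * pderiv S j (X i) y) +
      ∑ i, ((1 / 2) * X i y * ((G y)⁻¹ j k * pderiv S j (fun z => G z k i) y)
        - (1 / 2) * X i y * ((G y)⁻¹ j k * pderiv S k (fun z => G z j i) y)
        + (1 / 2) * ((G y)⁻¹ j k * pderiv S i (fun z => G z j k) y) * X i y) := by
    intro j k
    rw [h1, h2, ← Finset.sum_sub_distrib, Finset.mul_sum, ← Finset.sum_add_distrib]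
    exact Finset.sum_congr rfl fun i _ => by ring
  simp only [h3, Finset.sum_add_distrib, Finset.sum_sub_distrib, divergence]
  have h4 : ∑ j, ∑ k, ∑ i, ((G y)⁻¹ j k * G y k i) * pderiv S j (X i) y =
      ∑ k, pderiv S k (X k) y := by
    refine Finset.sum_congr rfl fun j _ => ?_
    rw [Finset.sum_comm]
    simp only [← Finset.sum_mul, hG.sum_inv_mul hy]
    simp
  have h5 : ∑ j, ∑ k, ∑ i, (1 / 2) * X i y * ((G y)⁻¹ j k * pderiv S j (fun z => G z k i) y) =
      ∑ j, ∑ k, ∑ i, (1 / 2) * X i y * ((G y)⁻¹ j k * pderiv S k (fun z => G z j i) y) := by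
    rw [Finset.sum_comm]
    refine Finset.sum_congr rfl fun j _ => Finset.sum_congr rfl fun k _ => ?_
    rw [hG.inv_symm hy]
  have h6 : ∑ j, ∑ k, ∑ i, (1 / 2) * ((G y)⁻¹ j k * pderiv S i (fun z => G z j k) y) * X i y =
      ∑ i, ∑ k, christoffel S G i i k y * X k y := by
    rw [Finset.sum_comm (f := fun i k => christoffel S G i i k y * X k y)]
    simp only [← Finset.sum_mul, hG.trace_christoffel hy]
    simp only [Finset.sum_mul, Finset.mul_sum]
    rw [Finset.sum_comm (s := Finset.univ) (t := Finset.univ)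
      (f := fun i j => ∑ l, (1 / 2) * ((G y)⁻¹ j l * pderiv S i (fun z => G z j l) y) * X i y)]
    exact Finset.sum_congr rfl fun j _ => Finset.sum_comm
  rw [h4, h5, h6, sub_self, zero_add]

end IsMetric

/-! ### Invariance of gradient pairings and conormal derivatives -/

namespace IsIsometry

variable {ψ : Coord m → Coord m} (h : IsIsometry S U V G' G ψ)
include h

theorem gradient_law (hy : y ∈ U) {f : Coord m → ℝ} (hf : SmoothAlong S V f) :
    (fun k => gradient S G' (fun z => f (ψ z)) k y) =
      (jac S ψ y)⁻¹.mulVec (fun k => gradient S G f k (ψ y)) := by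
  have h1 : (fun l => pderiv S l (fun z => f (ψ z)) y) =
      (jac S ψ y).transpose.mulVec (fun l => pderiv S l f (ψ y)) := by
    ext l; exact h.transition.pderiv_comp hf hy l
  have h2 : (fun k => gradient S G' (fun z => f (ψ z)) k y) =
      (G' y)⁻¹.mulVec (fun l => pderiv S l (fun z => f (ψ z)) y) := rfl
  rw [h2, h1, h.inv_law hy, Matrix.mulVec_mulVec, mul_assoc, ← Matrix.transpose_mul,
    Matrix.mul_nonsing_inv _ (h.isUnit_det_jac hy), Matrix.transpose_one, mul_one,
    ← Matrix.mulVec_mulVec]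
  rfl

theorem gradPairing_eq (hy : y ∈ U) {f k : Coord m → ℝ} (hf : SmoothAlong S V f)
    (hk : SmoothAlong S V k) :
    gradPairing S G' (fun z => f (ψ z)) (fun z => k (ψ z)) y = gradPairing S G f k (ψ y) := by
  have h1 : (fun l => pderiv S l (fun z => f (ψ z)) y) =
      (jac S ψ y).transpose.mulVec (fun l => pderiv S l f (ψ y)) := by
    ext l; exact h.transition.pderiv_comp hf hy l
  change (fun l => pderiv S l (fun z => f (ψ z)) y) ⬝ᵥ (fun l => gradient S G' _ l y) = _
  rw [h.gradient_law hy hk, h1, Matrix.mulVec_transpose, ← Matrix.dotProduct_mulVec,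
    Matrix.mulVec_mulVec, Matrix.mul_nonsing_inv _ (h.isUnit_det_jac hy), Matrix.one_mulVec]
  rfl

/-- The hypothesis `hJ` says that `ψ` pulls the covector `dy₀` back to `c dy₀`. The conormal is the
normalized dual of `-dy₀`, so a positive factor `c` has no effect. Without such a condition the
field depends on the coordinates, hence invariance is obtained at boundary points only. -/
theorem conormalDeriv_eq (hy : y ∈ U) {f : Coord m → ℝ} (hf : SmoothAlong S V f) {c : ℝ}
    (hc : 0 < c) (hJ : ∀ i, jac S ψ y 0 i = if i = 0 then c else 0) :
    conormalDeriv S G' (fun z => f (ψ z)) y = conormalDeriv S G f (ψ y) := by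
  have hu := h.isUnit_det_jac hy
  set J := jac S ψ y with hJd
  have h0 : J⁻¹.transpose.mulVec (Pi.single 0 1) = c⁻¹ • Pi.single 0 1 := by
    have : J.transpose.mulVec (Pi.single 0 1) = c • Pi.single 0 1 := by
      ext i
      simp [Matrix.mulVec_single, hJ, Pi.single_apply]
    have h2 : J⁻¹.transpose.mulVec (J.transpose.mulVec (Pi.single 0 1)) = Pi.single 0 1 := by
      rw [Matrix.mulVec_mulVec, ← Matrix.transpose_mul, Matrix.mul_nonsing_inv _ hu,
        Matrix.transpose_one, Matrix.one_mulVec]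
    rw [this, Matrix.mulVec_smul] at h2
    rw [← h2, smul_smul, inv_mul_cancel₀ hc.ne', one_smul, h2]
  have hcol : ∀ (A : Matrix (Fin (m + 1)) (Fin (m + 1)) ℝ) k, A k 0 = A.mulVec (Pi.single 0 1) k :=
    fun A k => by simp [Matrix.mulVec_single]
  have h1 : (G' y)⁻¹.mulVec (Pi.single 0 1) =
      c⁻¹ • J⁻¹.mulVec ((G (ψ y))⁻¹.mulVec (Pi.single 0 1)) := by
    rw [h.inv_law hy, ← Matrix.mulVec_mulVec, h0, Matrix.mulVec_smul, Matrix.mulVec_mulVec]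
  set v := (G (ψ y))⁻¹.mulVec (Pi.single 0 1) with hv
  have hrow : J⁻¹.mulVec v 0 = c⁻¹ * v 0 := by
    have hr : ∀ k, J⁻¹ 0 k = c⁻¹ * (Pi.single 0 1 : Fin (m + 1) → ℝ) k := by
      intro k
      rw [← Matrix.transpose_apply J⁻¹ k 0, hcol J⁻¹.transpose, h0]; rfl
    simp [Matrix.mulVec, dotProduct, hr, Pi.single_apply]
  -- The norm `√g⁰⁰` of `dy₀` scales by `c⁻¹`, just as the vector dual to it does in `h1`.
  have h00 : (G' y)⁻¹ 0 0 = c⁻¹ ^ 2 * (G (ψ y))⁻¹ 0 0 := by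
    rw [hcol (G' y)⁻¹, h1, Pi.smul_apply, smul_eq_mul, hrow, hcol (G (ψ y))⁻¹]; ring
  have hd : (fun l => pderiv S l (fun z => f (ψ z)) y) =
      J.transpose.mulVec (fun l => pderiv S l f (ψ y)) := by
    ext l; exact h.transition.pderiv_comp hf hy l
  have hdot : (fun l => pderiv S l (fun z => f (ψ z)) y) ⬝ᵥ J⁻¹.mulVec v =
      (fun l => pderiv S l f (ψ y)) ⬝ᵥ v := by
    rw [hd, Matrix.mulVec_transpose, ← Matrix.dotProduct_mulVec, Matrix.mulVec_mulVec,
      Matrix.mul_nonsing_inv _ hu, Matrix.one_mulVec]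
  have hform : ∀ (A : Coord m → Matrix (Fin (m + 1)) (Fin (m + 1)) ℝ) (k : Coord m → ℝ) (z : Coord m),
      conormalDeriv S A k z = -((fun l => pderiv S l k z) ⬝ᵥ (A z)⁻¹.mulVec (Pi.single 0 1)) /
        √((A z)⁻¹ 0 0) := by
    intro A k z
    simp only [conormalDeriv, conormal, dotProduct, ← hcol, neg_div, Finset.sum_div,
      ← Finset.sum_neg_distrib]
    exact Finset.sum_congr rfl fun l _ => by ring
  rw [hform, hform, h1, dotProduct_smul, hdot, h00, Real.sqrt_mul (by positivity),
    Real.sqrt_sq (by positivity), smul_eq_mul]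
  have hc' : c⁻¹ ≠ 0 := inv_ne_zero hc.ne'
  rw [← mul_neg, mul_div_mul_left _ _ hc']

end IsIsometry

end

section

variable {m : ℕ} {S U V : Set (Coord m)}
  {G G' : Coord m → Matrix (Fin (m + 1)) (Fin (m + 1)) ℝ} {y : Coord m} {u : Coord m → ℝ}

/-! ### Conformal changes of the metric -/

/-- `G' = u² G` on `U`. -/
structure IsConformal (S U : Set (Coord m)) (G G' : Coord m → Matrix (Fin (m + 1)) (Fin (m + 1)) ℝ)
    (u : Coord m → ℝ) : Prop where
  metric : IsMetric S U G
  smooth : SmoothAlong S U u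
  pos : ∀ z ∈ U, 0 < u z
  eq : ∀ z ∈ U, ∀ i j, G' z i j = u z ^ 2 * G z i j

/-- The logarithm of the conformal factor. -/
def logFactor (u : Coord m → ℝ) (z : Coord m) : ℝ := Real.log (u z)

namespace IsConformal

variable (h : IsConformal S U G G' u)
include h

theorem smooth_log : SmoothAlong S U (logFactor u) :=
  h.smooth.log fun z hz => (h.pos z hz).ne'

theorem pderiv_factor (hy : y ∈ U) (i : Fin (m + 1)) :
    pderiv S i u y = u y * pderiv S i (logFactor u) y := by
  have := pderiv_comp_real h.metric.dom hy i h.smooth (Real.hasDerivAt_log (h.pos y hy).ne')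
  rw [show logFactor u = fun z => Real.log (u z) from rfl, this,
    mul_inv_cancel_left₀ (h.pos y hy).ne']

theorem inv_eq (hy : y ∈ U) (i j : Fin (m + 1)) :
    (G' y)⁻¹ i j = (u y ^ 2)⁻¹ * (G y)⁻¹ i j := by
  have hu := (h.pos y hy).ne'
  have : (G' y)⁻¹ = (u y ^ 2)⁻¹ • (G y)⁻¹ := by
    refine Matrix.inv_eq_right_inv ?_
    have e : G' y = u y ^ 2 • G y := by ext i j; exact h.eq y hy i j
    rw [e, smul_mul_smul_comm, Matrix.mul_nonsing_inv _ (h.metric.isUnit_det hy),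
      mul_inv_cancel₀ (pow_ne_zero 2 hu), one_smul]
  rw [this]; rfl

theorem pderiv_coeff (hy : y ∈ U) (i j l : Fin (m + 1)) : pderiv S i (fun z => G' z j l) y =
    u y ^ 2 * (pderiv S i (fun z => G z j l) y + 2 * pderiv S i (logFactor u) y * G y j l) := by
  have hd := h.metric.dom
  rw [pderiv_congr hd (fun z hz => (h.eq z hz j l).trans (by rw [pow_two])) hy i,
    pderiv_mul hd hy i (h.smooth.mul h.smooth) (h.metric.smooth j l),
    pderiv_mul hd hy i h.smooth h.smooth, h.pderiv_factor hy]
  ring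

/-- The derivative of `u²` is `2 u²` times that of `log u`, and `u²` cancels against the inverse
metric. The added tensor is `connDiff`. -/
theorem christoffel_eq (hy : y ∈ U) (k i j : Fin (m + 1)) :
    christoffel S G' k i j y = christoffel S G k i j y
      + ((if k = i then 1 else 0) * pderiv S j (logFactor u) y
        + (if k = j then 1 else 0) * pderiv S i (logFactor u) y
        - G y i j * gradient S G (logFactor u) k y) := by
  have hu := (h.pos y hy).ne'
  have h1 : ∀ l, (G' y)⁻¹ k l * (pderiv S i (fun z => G' z j l) y + pderiv S j (fun z => G' z i l) y
      - pderiv S l (fun z => G' z i j) y) =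
      (G y)⁻¹ k l * (pderiv S i (fun z => G z j l) y + pderiv S j (fun z => G z i l) y
        - pderiv S l (fun z => G z i j) y)
      + (2 * (((G y)⁻¹ k l * G y l j) * pderiv S i (logFactor u) y)
        + 2 * (((G y)⁻¹ k l * G y l i) * pderiv S j (logFactor u) y)
        - 2 * (G y i j * ((G y)⁻¹ k l * pderiv S l (logFactor u) y))) := by
    intro l
    rw [h.inv_eq hy, h.pderiv_coeff hy, h.pderiv_coeff hy, h.pderiv_coeff hy,
      h.metric.symm hy l j, h.metric.symm hy l i]
    field_simp
    ring
  simp only [christoffel, h1, Finset.sum_add_distrib, Finset.sum_sub_distrib, ← Finset.mul_sum,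
    ← Finset.sum_mul, h.metric.sum_inv_mul hy, gradient]
  ring

theorem trace_christoffel_eq (hy : y ∈ U) (k : Fin (m + 1)) :
    ∑ i, christoffel S G' i i k y =
      ∑ i, christoffel S G i i k y + (m + 1) * pderiv S k (logFactor u) y := by
  simp only [h.christoffel_eq hy, Finset.sum_add_distrib, Finset.sum_sub_distrib]
  have : ∑ i, G y i k * gradient S G (logFactor u) i y = pderiv S k (logFactor u) y := by
    rw [← h.metric.sum_mul_gradient hy]
    exact Finset.sum_congr rfl fun i _ => by rw [h.metric.symm hy]
  simp [this]

theorem conormal_eq (hy : y ∈ U) (k : Fin (m + 1)) :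
    conormal G' k y = (u y)⁻¹ * conormal G k y := by
  have hu := h.pos y hy
  simp only [conormal, h.inv_eq hy]
  rw [Real.sqrt_mul (by positivity), ← inv_pow, Real.sqrt_sq (by positivity), pow_two]
  field_simp

/-- The conformal change of the mean curvature of the level sets of `y₀`. -/
theorem divergence_conormal (hy : y ∈ U) :
    divergence S G' (conormal G') y =
      (u y)⁻¹ * (divergence S G (conormal G) y + m * conormalDeriv S G (logFactor u) y) := by
  have hu := (h.pos y hy).ne'
  have hd := h.metric.dom
  -- Differentiating the factor `u⁻¹` subtracts one conormal derivative of `log u`, and the trace of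
  -- the connection adds `m + 1`; this leaves the coefficient `m`.
  have h1 : ∀ k, pderiv S k (conormal G' k) y = (u y)⁻¹ * (pderiv S k (conormal G k) y
      - pderiv S k (logFactor u) y * conormal G k y) := by
    intro k
    rw [pderiv_congr hd (fun z hz => h.conormal_eq hz k) hy k,
      pderiv_mul hd hy k (h.smooth.inv fun z hz => (h.pos z hz).ne') (h.metric.smooth_conormal k),
      pderiv_comp_real hd hy k h.smooth (hasDerivAt_inv hu), h.pderiv_factor hy]
    field_simp
    ring
  simp only [divergence, conormalDeriv]
  rw [Finset.sum_comm, Finset.sum_comm (f := fun i k => christoffel S G i i k y * _)]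
  simp only [← Finset.sum_mul, h.trace_christoffel_eq hy, h.conormal_eq hy, h1,
    Finset.mul_sum, ← Finset.sum_add_distrib]
  exact Finset.sum_congr rfl fun k _ => by ring

end IsConformal

/-- The difference `δᵏᵢ φⱼ + δᵏⱼ φᵢ - gᵢⱼ Xᵏ` of the Levi-Civita connections of two conformal
metrics. -/
def connDiff {ι : Type*} [DecidableEq ι] (g : ι → ι → ℝ) (φ X : ι → ℝ) (k i j : ι) : ℝ :=
  (if k = i then 1 else 0) * φ j + (if k = j then 1 else 0) * φ i - g i j * X k

/-! ### Contractions of the difference tensor at a single point -/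

section Algebra

variable {ι : Type*} [DecidableEq ι] [Fintype ι] (g : ι → ι → ℝ) (φ X : ι → ℝ)

theorem sum_mul_connDiff (a : ι → ℝ) (j k : ι) :
    ∑ p, a p * connDiff g φ X p j k = a j * φ k + a k * φ j - g j k * ∑ p, a p * X p := by
  simp only [connDiff, mul_sub, mul_add, Finset.sum_sub_distrib, Finset.sum_add_distrib,
    Finset.mul_sum]
  simp
  exact Finset.sum_congr rfl fun p _ => by ring

theorem sum_connDiff_mul (b : ι → ℝ) (i j : ι) :
    ∑ p, connDiff g φ X i j p * b p =
      (if i = j then 1 else 0) * (∑ p, φ p * b p) + b i * φ j - X i * ∑ p, g j p * b p := by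
  simp only [connDiff, sub_mul, add_mul, Finset.sum_sub_distrib, Finset.sum_add_distrib,
    Finset.mul_sum]
  simp [mul_left_comm, mul_comm]

variable {g φ X} (hg : ∀ i j, g i j = g j i) (hX : ∀ j, ∑ p, g j p * X p = φ j)
include hg hX

theorem sum_connDiff_trace (k : ι) : ∑ i, connDiff g φ X i i k = Fintype.card ι * φ k := by
  have := hX k
  simp only [hg k] at this
  simp only [connDiff, Finset.sum_sub_distrib, Finset.sum_add_distrib, this]
  simp

/-- This is the part of `Ric(Γ + T)` quadratic in the difference tensor `T`. The first product
contributes the dimension through the trace of `T`, the second subtracts two dimension-free copies.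
-/
theorem connDiff_quadratic (j k : ι) :
    ∑ i, ∑ p, (connDiff g φ X i i p * connDiff g φ X p j k
      - connDiff g φ X i j p * connDiff g φ X p i k) =
      (Fintype.card ι - 2) * (φ j * φ k - g j k * ∑ p, φ p * X p) := by
  have h1 : ∑ i, ∑ p, connDiff g φ X i i p * connDiff g φ X p j k =
      Fintype.card ι * (2 * φ j * φ k - g j k * ∑ p, φ p * X p) := by
    rw [Finset.sum_comm]
    simp only [← Finset.sum_mul, sum_connDiff_trace hg hX, mul_assoc]
    rw [← Finset.mul_sum, sum_mul_connDiff]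
    ring
  have h2 : ∀ i, ∑ p, g j p * connDiff g φ X p i k = g j i * φ k + g j k * φ i - g i k * φ j := by
    intro i
    rw [sum_mul_connDiff, hX]
  have h3 : ∑ i, X i * (g j i * φ k + g j k * φ i - g i k * φ j) = g j k * ∑ p, φ p * X p := by
    have e : ∀ i, X i * (g j i * φ k + g j k * φ i - g i k * φ j) =
      (g j i * X i) * φ k + g j k * (φ i * X i) - (g k i * X i) * φ j := by
      intro i; rw [hg i k]; ring
    simp only [e, Finset.sum_add_distrib, Finset.sum_sub_distrib, ← Finset.sum_mul, hX,
      ← Finset.mul_sum]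
    ring
  have h4 : ∑ i, ∑ p, connDiff g φ X i j p * connDiff g φ X p i k =
      (Fintype.card ι + 2) * (φ j * φ k) - 2 * (g j k * ∑ p, φ p * X p) := by
    simp only [sum_connDiff_mul, h2, Finset.sum_sub_distrib, Finset.sum_add_distrib, h3]
    simp only [← Finset.sum_mul, sum_connDiff_trace hg hX, ite_mul, one_mul, zero_mul,
      Finset.sum_ite_eq', Finset.mem_univ, if_true]
    rw [sum_mul_connDiff]
    ring
  simp only [Finset.sum_sub_distrib]
  rw [h1, h4]; ring

/-- This is the part of `Ric(Γ + T)` bilinear in `Γ` and `T`, for any symmetric `Γ`. For the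
Levi-Civita connection the last sum is the derivative of `gⱼₖ` along `X`, which cancels against a
term from the derivatives of `T`. -/
theorem connDiff_linear {Γ : ι → ι → ι → ℝ} (hΓ : ∀ k i j, Γ k i j = Γ k j i) (j k : ι) :
    ∑ i, ∑ p, (Γ i i p * connDiff g φ X p j k + connDiff g φ X i i p * Γ p j k
      - Γ i j p * connDiff g φ X p i k - connDiff g φ X i j p * Γ p i k) =
      (Fintype.card ι - 2) * (∑ p, φ p * Γ p j k) - g j k * (∑ p, (∑ i, Γ i i p) * X p)
      + ∑ i, X i * ∑ p, (g k p * Γ p i j + g j p * Γ p i k) := by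
  have h1 : ∑ i, ∑ p, Γ i i p * connDiff g φ X p j k =
      (∑ i, Γ i i j) * φ k + (∑ i, Γ i i k) * φ j - g j k * (∑ p, (∑ i, Γ i i p) * X p) := by
    rw [Finset.sum_comm]
    simp only [← Finset.sum_mul]
    rw [sum_mul_connDiff]
  have h2 : ∑ i, ∑ p, connDiff g φ X i i p * Γ p j k =
      Fintype.card ι * (∑ p, φ p * Γ p j k) := by
    rw [Finset.sum_comm]
    simp only [← Finset.sum_mul, sum_connDiff_trace hg hX, mul_assoc]
    rw [← Finset.mul_sum]
  have h3 : ∑ i, ∑ p, Γ i j p * connDiff g φ X p i k =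
      (∑ i, Γ i i j) * φ k + (∑ p, φ p * Γ p j k) - ∑ i, X i * ∑ p, g k p * Γ p i j := by
    simp only [sum_mul_connDiff, Finset.sum_sub_distrib, Finset.sum_add_distrib]
    have e1 : ∀ i, Γ i j i * φ k = Γ i i j * φ k := fun i => by rw [hΓ]
    have e2 : ∑ i, g i k * ∑ p, Γ i j p * X p = ∑ i, X i * ∑ p, g k p * Γ p i j := by
      simp only [Finset.mul_sum]
      rw [Finset.sum_comm]
      refine Finset.sum_congr rfl fun p _ => Finset.sum_congr rfl fun i _ => ?_
      rw [hg i k, hΓ i j p]; ring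
    simp only [e1, e2, Finset.sum_mul, mul_comm (φ _)]
  have h4 : ∑ i, ∑ p, connDiff g φ X i j p * Γ p i k =
      (∑ p, φ p * Γ p j k) + (∑ i, Γ i i k) * φ j - ∑ i, X i * ∑ p, g j p * Γ p i k := by
    simp only [sum_connDiff_mul, Finset.sum_sub_distrib, Finset.sum_add_distrib, Finset.sum_mul]
    simp
  simp only [Finset.sum_sub_distrib, Finset.sum_add_distrib, mul_add]
  rw [h1, h2, h3, h4]
  ring

end Algebra

namespace IsConformal

variable (h : IsConformal S U G G' u)
include h

/-- The conformal change of the Ricci tensor. -/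
theorem ricci_eq (hy : y ∈ U) (j k : Fin (m + 1)) :
    ricci S G' j k y = ricci S G j k y
      - (m - 1) * (pderiv S j (pderiv S k (logFactor u)) y
        - ∑ p, pderiv S p (logFactor u) y * christoffel S G p j k y)
      - G y j k * divergence S G (gradient S G (logFactor u)) y
      + (m - 1) * (pderiv S j (logFactor u) y * pderiv S k (logFactor u) y
        - G y j k * gradPairing S G (logFactor u) (logFactor u) y) := by
  have hd := h.metric.dom
  set φ : Fin (m + 1) → Coord m → ℝ := fun i => pderiv S i (logFactor u) with hφ
  set X : Fin (m + 1) → Coord m → ℝ := gradient S G (logFactor u) with hXd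
  set T : Fin (m + 1) → Fin (m + 1) → Fin (m + 1) → Coord m → ℝ := fun k i j z =>
    connDiff (G z) (fun i => φ i z) (fun i => X i z) k i j with hT
  have hφs : ∀ i, SmoothAlong S U (φ i) := fun i => h.smooth_log.pderiv hd i
  have hXs : ∀ i, SmoothAlong S U (X i) := h.metric.smooth_gradient h.smooth_log
  have hgs := h.metric.symm hy
  have hgX : ∀ j, ∑ p, G y j p * X p y = φ j y := h.metric.sum_mul_gradient hy _
  have hTs : ∀ k i j, SmoothAlong S U (T k i j) := fun k i j =>
    (((SmoothAlong.const _).mul (hφs j)).add ((SmoothAlong.const _).mul (hφs i))).sub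
      ((h.metric.smooth i j).mul (hXs k))
  have hΓ : ∀ k i j, ∀ z ∈ U, christoffel S G' k i j z = christoffel S G k i j z + T k i j z :=
    fun k i j z hz => h.christoffel_eq hz k i j
  have hdΓ : ∀ l k i j, pderiv S l (christoffel S G' k i j) y =
      pderiv S l (christoffel S G k i j) y + pderiv S l (T k i j) y := fun l k i j => by
    rw [pderiv_congr hd (hΓ k i j) hy, pderiv_add hd hy l (h.metric.smooth_christoffel k i j)
      (hTs k i j)]
  have hdT : ∀ l k i j, pderiv S l (T k i j) y =
      (if k = i then 1 else 0) * pderiv S l (φ j) y + (if k = j then 1 else 0) * pderiv S l (φ i) y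
      - (pderiv S l (fun z => G z i j) y * X k y + G y i j * pderiv S l (X k) y) := by
    intro l k i j
    have := pderiv_sub hd hy l (((SmoothAlong.const (if k = i then 1 else 0)).mul (hφs j)).add
      ((SmoothAlong.const (if k = j then 1 else 0)).mul (hφs i)))
      ((h.metric.smooth i j).mul (hXs k))
    refine this.trans ?_
    rw [pderiv_add hd hy l ((SmoothAlong.const _).mul (hφs j)) ((SmoothAlong.const _).mul (hφs i)),
      pderiv_mul hd hy l (.const _) (hφs j), pderiv_mul hd hy l (.const _) (hφs i),
      pderiv_mul hd hy l (h.metric.smooth i j) (hXs k), pderiv_const, pderiv_const]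
    ring
  have hcomm : ∀ i j, pderiv S i (φ j) y = pderiv S j (φ i) y :=
    fun i j => pderiv_comm hd hy i h.smooth_log j
  -- The part with derivatives of `T`: the two Kronecker terms give `2 ∂ⱼφₖ`, and the trace of `T`
  -- removes `(m + 1) ∂ⱼφₖ`.
  have hA : ∑ i, (pderiv S i (T i j k) y - pderiv S j (T i i k) y) =
      (1 - m) * pderiv S j (φ k) y - ∑ i, pderiv S i (fun z => G z j k) y * X i y
        - G y j k * ∑ i, pderiv S i (X i) y := by
    have tr : ∑ i, pderiv S j (T i i k) y = (m + 1) * pderiv S j (φ k) y := by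
      rw [← pderiv_sum hd hy j fun i _ => hTs i i k]
      have : ∀ z ∈ U, ∑ i, T i i k z = (m + 1) * φ k z := fun z hz => by
        have := sum_connDiff_trace (h.metric.symm hz) (h.metric.sum_mul_gradient hz (logFactor u)) k
        rw [Fintype.card_fin] at this
        push_cast at this
        exact this
      rw [pderiv_congr hd this hy j, pderiv_mul hd hy j (.const _) (hφs k), pderiv_const]
      ring
    rw [Finset.sum_sub_distrib, tr]
    simp only [hdT, Finset.sum_sub_distrib, Finset.sum_add_distrib, ite_mul, one_mul, zero_mul,
      Finset.sum_ite_eq', Finset.mem_univ, if_true, ← Finset.mul_sum]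
    rw [hcomm k j]
    ring
  have hB := connDiff_linear (g := G y) (φ := fun i => φ i y) (X := fun i => X i y) hgs hgX
    (Γ := fun k i j => christoffel S G k i j y) (h.metric.christoffel_symm hy) j k
  have hC := connDiff_quadratic (g := G y) (φ := fun i => φ i y) (X := fun i => X i y) hgs hgX j k
  -- Metric compatibility of the connection; it turns the last sum of `connDiff_linear` into the
  -- term that `hA` subtracts.
  have hD : ∀ i, ∑ p, (G y k p * christoffel S G p i j y + G y j p * christoffel S G p i k y) =
      pderiv S i (fun z => G z j k) y := by
    intro i
    rw [Finset.sum_add_distrib, h.metric.sum_mul_christoffel hy, h.metric.sum_mul_christoffel hy,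
      h.metric.pderiv_symm hy i k j, h.metric.pderiv_symm hy k i j, h.metric.pderiv_symm hy j i k,
      h.metric.pderiv_symm hy k j i, h.metric.pderiv_symm hy j k i]
    ring
  simp only [hD] at hB
  -- `Ric(Γ + T)` sorted into the derivative terms and the terms linear and quadratic in `T`.
  have hE : ricci S G' j k y = ricci S G j k y
      + ∑ i, (pderiv S i (T i j k) y - pderiv S j (T i i k) y)
      + ∑ i, ∑ p, (christoffel S G i i p y * T p j k y + T i i p y * christoffel S G p j k y
        - christoffel S G i j p y * T p i k y - T i j p y * christoffel S G p i k y)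
      + ∑ i, ∑ p, (T i i p y * T p j k y - T i j p y * T p i k y) := by
    simp only [ricci, hdΓ, hΓ _ _ _ y hy]
    simp only [← Finset.sum_add_distrib]
    refine Finset.sum_congr rfl fun i _ => ?_
    have e : ∑ p, ((christoffel S G i i p y + T i i p y) * (christoffel S G p j k y + T p j k y) -
        (christoffel S G i j p y + T i j p y) * (christoffel S G p i k y + T p i k y)) =
        ∑ p, (christoffel S G i i p y * christoffel S G p j k y
          - christoffel S G i j p y * christoffel S G p i k y)
        + ∑ p, (christoffel S G i i p y * T p j k y + T i i p y * christoffel S G p j k y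
          - christoffel S G i j p y * T p i k y - T i j p y * christoffel S G p i k y)
        + ∑ p, (T i i p y * T p j k y - T i j p y * T p i k y) := by
      rw [← Finset.sum_add_distrib, ← Finset.sum_add_distrib]
      exact Finset.sum_congr rfl fun p _ => by ring
    rw [e]
    ring
  rw [hE, hA]
  refine (congrArg₂ (· + ·) (congrArg₂ (· + ·) rfl hB) hC).trans ?_
  have hF : ∑ i, X i y * pderiv S i (fun z => G z j k) y =
    ∑ i, pderiv S i (fun z => G z j k) y * X i y := Finset.sum_congr rfl fun i _ => mul_comm _ _
  have hH : ∑ i, ∑ k, christoffel S G i i k y * X k y =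
      ∑ p, (∑ i, christoffel S G i i p y) * X p y := by
    rw [Finset.sum_comm]; simp only [Finset.sum_mul]
  simp only [hF, divergence, gradPairing, hH, Fintype.card_fin]
  push_cast
  ring

/-- The conformal change of the scalar curvature, up to a divergence. -/
theorem scalar_sub_scalar (hy : y ∈ U) : scalar S G' y - scalar S G y =
    scalar S G y * ((u y ^ 2)⁻¹ - 1)
      - 2 * m * divergence S G (fun k z => (u z ^ 2)⁻¹ * gradient S G (logFactor u) k z) y
      - m * (m + 3) * ((u y ^ 2)⁻¹ * gradPairing S G (logFactor u) (logFactor u) y) := by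
  have hd := h.metric.dom
  have hu := (h.pos y hy).ne'
  have hX := h.metric.smooth_gradient h.smooth_log
  set q := gradPairing S G (logFactor u) (logFactor u) y with hq
  set D := divergence S G (gradient S G (logFactor u)) y with hD
  have hw : SmoothAlong S U (fun z => (u z ^ 2)⁻¹) :=
    fun z hz => ((h.smooth z hz).pow 2).inv (pow_ne_zero 2 (h.pos z hz).ne')
  -- The factor `-2` here produces the extra `4m`: `m(m-1) + 4m = m(m+3)`.
  have hdw : ∀ k, pderiv S k (fun z => (u z ^ 2)⁻¹) y =
      -2 * (u y ^ 2)⁻¹ * pderiv S k (logFactor u) y := by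
    intro k
    have hd1 : HasDerivAt (fun t : ℝ => (t ^ 2)⁻¹) (-(2 * u y) / (u y ^ 2) ^ 2) (u y) :=
      ((hasDerivAt_pow 2 (u y)).inv (pow_ne_zero 2 hu)).congr_deriv (by simp)
    rw [pderiv_comp_real hd hy k h.smooth hd1, h.pderiv_factor hy]
    field_simp
  rw [h.metric.divergence_mul hy hw hX]
  have h1 : ∑ k, pderiv S k (fun z => (u z ^ 2)⁻¹) y * gradient S G (logFactor u) k y =
      -2 * (u y ^ 2)⁻¹ * q := by
    simp only [hdw, hq, gradPairing, Finset.mul_sum, mul_assoc]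
  have hGG : ∑ j, ∑ k, (G y)⁻¹ j k * G y j k = m + 1 := by
    have : ∀ j, ∑ k, (G y)⁻¹ j k * G y j k = 1 := by
      intro j
      simpa using (Finset.sum_congr rfl fun k _ => by rw [h.metric.symm hy j k]).trans
        (h.metric.sum_inv_mul hy j j)
    simp [this]
  have hφφ : ∑ j, ∑ k, (G y)⁻¹ j k * (pderiv S j (logFactor u) y * pderiv S k (logFactor u) y) =
      q := by
    simp only [hq, gradPairing, gradient, Finset.mul_sum]
    exact Finset.sum_congr rfl fun j _ => Finset.sum_congr rfl fun k _ => by ring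
  -- In the trace the Laplacian gets `-(m-1) - (m+1) = -2m`, and the gradient square gets `(m-1) -
  -- (m-1)(m+1) = -m(m-1)`.
  have h2 : scalar S G' y = (u y ^ 2)⁻¹ * (scalar S G y - 2 * m * D - m * (m - 1) * q) := by
    have e : ∀ j k, (G' y)⁻¹ j k * ricci S G' j k y = (u y ^ 2)⁻¹ * (
        (G y)⁻¹ j k * ricci S G j k y
        - (m - 1) * ((G y)⁻¹ j k * (pderiv S j (pderiv S k (logFactor u)) y
          - ∑ p, pderiv S p (logFactor u) y * christoffel S G p j k y))
        - D * ((G y)⁻¹ j k * G y j k)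
        + (m - 1) * ((G y)⁻¹ j k * (pderiv S j (logFactor u) y * pderiv S k (logFactor u) y))
        - (m - 1) * q * ((G y)⁻¹ j k * G y j k)) := by
      intro j k
      rw [h.inv_eq hy, h.ricci_eq hy]
      ring
    simp only [scalar, e, Finset.sum_add_distrib, Finset.sum_sub_distrib, ← Finset.mul_sum, hGG,
      hφφ, h.metric.trace_hessian hy h.smooth_log]
    rw [← hD]
    ring
  rw [h1, h2]
  ring

end IsConformal

end

section

/-! ### Metric coefficients in charts -/

variable {m : ℕ} {M : Type*} [TopologicalSpace M] [ChartedSpace (EuclideanHalfSpace (m + 1)) M]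


theorem isCoordDomain_target (x : M) : IsCoordDomain (range (𝓡∂ (m + 1))) (extChartAt (𝓡∂ (m + 1)) x).target where
  uniqueDiffOn := (𝓡∂ (m + 1)).uniqueDiffOn
  subset := extChartAt_target_subset_range x
  mem_nhdsWithin _ hz := extChartAt_target_mem_nhdsWithin_of_mem hz
  mem_closure_interior _ hz :=
    (𝓡∂ (m + 1)).range_subset_closure_interior (extChartAt_target_subset_range x hz)

/-- The part of the chart at `x` that overlaps the chart at `x'`, in coordinates. -/
def overlap (m : ℕ) {M : Type*} [TopologicalSpace M] [ChartedSpace (EuclideanHalfSpace (m + 1)) M]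
    (x x' : M) : Set (Coord m) :=
  (extChartAt (𝓡∂ (m + 1)) x).target ∩
    (extChartAt (𝓡∂ (m + 1)) x).symm ⁻¹' (extChartAt (𝓡∂ (m + 1)) x').source

/-- The transition map from the chart at `x` to the chart at `x'`. -/
def transition (m : ℕ) {M : Type*} [TopologicalSpace M]
    [ChartedSpace (EuclideanHalfSpace (m + 1)) M] (x x' : M) (y : Coord m) : Coord m :=
  extChartAt (𝓡∂ (m + 1)) x' ((extChartAt (𝓡∂ (m + 1)) x).symm y)

theorem isCoordDomain_overlap (x x' : M) : IsCoordDomain (range (𝓡∂ (m + 1))) (overlap m x x') where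
  uniqueDiffOn := (𝓡∂ (m + 1)).uniqueDiffOn
  subset _ hz := extChartAt_target_subset_range x hz.1
  mem_nhdsWithin z hz := by
    refine Filter.inter_mem (extChartAt_target_mem_nhdsWithin_of_mem hz.1) ?_
    have h1 : Filter.Tendsto (extChartAt (𝓡∂ (m + 1)) x).symm (nhdsWithin z (range (𝓡∂ (m + 1))))
        (nhds ((extChartAt (𝓡∂ (m + 1)) x).symm z)) :=
      (continuousAt_extChartAt_symm'' hz.1).tendsto.mono_left nhdsWithin_le_nhds
    exact h1 ((isOpen_extChartAt_source x').mem_nhds hz.2)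
  mem_closure_interior _ hz :=
    (𝓡∂ (m + 1)).range_subset_closure_interior (extChartAt_target_subset_range x hz.1)

theorem transition_mem_target {x x' : M} {y : Coord m} (hy : y ∈ overlap m x x') :
    transition m x x' y ∈ (extChartAt (𝓡∂ (m + 1)) x').target :=
  (extChartAt (𝓡∂ (m + 1)) x').map_source hy.2

theorem symm_transition {x x' : M} {y : Coord m} (hy : y ∈ overlap m x x') :
    (extChartAt (𝓡∂ (m + 1)) x').symm (transition m x x' y) = (extChartAt (𝓡∂ (m + 1)) x).symm y :=
  (extChartAt (𝓡∂ (m + 1)) x').left_inv hy.2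

theorem transition_transition {x x' : M} {y : Coord m} (hy : y ∈ overlap m x x') :
    transition m x' x (transition m x x' y) = y := by
  unfold transition
  rw [(extChartAt (𝓡∂ (m + 1)) x').left_inv hy.2, (extChartAt (𝓡∂ (m + 1)) x).right_inv hy.1]

/-- The pointwise definitions use the chart at `p`, which may jump with `p`. Continuity becomes
visible only from a formula in a fixed chart. -/
theorem continuous_of_charts {f : M → ℝ} {F : M → Coord m → ℝ}
    (hF : ∀ x, ContinuousOn (F x) (extChartAt (𝓡∂ (m + 1)) x).target)
    (h : ∀ x, ∀ p ∈ (extChartAt (𝓡∂ (m + 1)) x).source, f p = F x (extChartAt (𝓡∂ (m + 1)) x p)) : Continuous f := by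
  refine continuous_iff_continuousAt.2 fun x => ?_
  have h1 : ContinuousOn (fun p => F x (extChartAt (𝓡∂ (m + 1)) x p)) (extChartAt (𝓡∂ (m + 1)) x).source :=
    (hF x).comp (continuousOn_extChartAt x) (extChartAt (𝓡∂ (m + 1)) x).mapsTo
  exact (h1.congr (h x)).continuousAt (extChartAt_source_mem_nhds x)

variable [IsManifold (𝓡∂ (m + 1)) ∞ M]

theorem contDiffWithinAt_transition {x x' : M} {y : Coord m} (hy : y ∈ overlap m x x') :
    ContDiffWithinAt ℝ ∞ (transition m x x') (range (𝓡∂ (m + 1))) y := by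
  refine contDiffWithinAt_ext_coord_change (I := (𝓡∂ (m + 1))) (n := ∞) x' x ?_
  rw [PartialEquiv.trans_source]
  exact hy

theorem isTransition (x x' : M) : IsTransition (range (𝓡∂ (m + 1))) (overlap m x x')
    (extChartAt (𝓡∂ (m + 1)) x').target (transition m x x') where
  source := isCoordDomain_overlap x x'
  target := isCoordDomain_target x'
  mapsTo _ hy := transition_mem_target hy
  smooth a _ hz := contDiffWithinAt_euclidean.1 (contDiffWithinAt_transition hz) a

/-- The components of a tangent vector in the chart at `x`. -/
def coords (x : M) {p : M} (v : TangentSpace (𝓡∂ (m + 1)) p) : Coord m :=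
  mfderiv (𝓡∂ (m + 1)) 𝓘(ℝ, Coord m) (extChartAt (𝓡∂ (m + 1)) x) p v

omit [IsManifold (𝓡∂ (m + 1)) ∞ M] in
theorem coords_coordVector [IsManifold (𝓡∂ (m + 1)) 1 M] {x : M} {y : Coord m}
    (hy : y ∈ (extChartAt (𝓡∂ (m + 1)) x).target) (i : Fin (m + 1)) :
    coords x (coordVector x y i) = EuclideanSpace.single i (1 : ℝ) :=
  congrArg (fun L => L (EuclideanSpace.single i (1 : ℝ) : Coord m))
    (mfderiv_extChartAt_comp_mfderivWithin_extChartAt_symm hy)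

omit [IsManifold (𝓡∂ (m + 1)) ∞ M] in
theorem eq_sum_coords [IsManifold (𝓡∂ (m + 1)) 1 M] {x : M} {y : Coord m}
    (hy : y ∈ (extChartAt (𝓡∂ (m + 1)) x).target) (u : TangentSpace (𝓡∂ (m + 1)) ((extChartAt (𝓡∂ (m + 1)) x).symm y)) :
    u = ∑ a, coords x u a • coordVector x y a := by
  have h1 : mfderivWithin 𝓘(ℝ, Coord m) (𝓡∂ (m + 1)) (extChartAt (𝓡∂ (m + 1)) x).symm (range (𝓡∂ (m + 1))) y (coords x u) = u :=
    congrArg (fun L => L u) (mfderivWithin_extChartAt_symm_comp_mfderiv_extChartAt hy)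
  have h2 : coords x u = ∑ a, coords x u a • EuclideanSpace.single a (1 : ℝ) := by
    ext b
    simp [Pi.single_apply, EuclideanSpace.single]
  rw [h2] at h1
  exact h1.symm.trans ((map_sum _ _ _).trans (Finset.sum_congr rfl fun a _ => map_smul _ _ _))

/-- In the trivialization of the tangent bundle at `x` the coordinate field is the constant `eᵢ`. -/
theorem contMDiffWithinAt_coordVector (x : M) (i : Fin (m + 1)) {y : Coord m}
    (hy : y ∈ (extChartAt (𝓡∂ (m + 1)) x).target) :
    ContMDiffWithinAt 𝓘(ℝ, Coord m) ((𝓡∂ (m + 1)).prod 𝓘(ℝ, Coord m)) ∞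
      (fun z => Bundle.TotalSpace.mk' (Coord m) (E := fun p : M => TangentSpace (𝓡∂ (m + 1)) p)
        ((extChartAt (𝓡∂ (m + 1)) x).symm z) (coordVector x z i)) (range (𝓡∂ (m + 1))) y := by
  have hsrc : ∀ z ∈ (extChartAt (𝓡∂ (m + 1)) x).target, (extChartAt (𝓡∂ (m + 1)) x).symm z ∈
      (chartAt (EuclideanHalfSpace (m + 1)) x).source := fun z hz => by
    rw [← extChartAt_source (𝓡∂ (m + 1))]; exact (extChartAt (𝓡∂ (m + 1)) x).map_target hz
  have hb : ∀ z ∈ (extChartAt (𝓡∂ (m + 1)) x).target, (extChartAt (𝓡∂ (m + 1)) x).symm z ∈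
      (trivializationAt (Coord m) (fun p : M => TangentSpace (𝓡∂ (m + 1)) p) x).baseSet := fun z hz => by
    rw [TangentBundle.trivializationAt_baseSet]
    exact hsrc z hz
  have : IsManifold (𝓡∂ (m + 1)) 1 M := .of_le (n := ∞) (by simp)
  rw [(trivializationAt (Coord m) (fun p : M => TangentSpace (𝓡∂ (m + 1)) p) x).contMDiffWithinAt_iff
    ((trivializationAt (Coord m) (fun p : M => TangentSpace (𝓡∂ (m + 1)) p) x).mem_source.2 (hb y hy))]
  refine ⟨contMDiffWithinAt_extChartAt_symm_range x hy, ?_⟩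
  have hcoord : ∀ z ∈ (extChartAt (𝓡∂ (m + 1)) x).target,
      ((trivializationAt (Coord m) (fun p : M => TangentSpace (𝓡∂ (m + 1)) p) x)
        ⟨(extChartAt (𝓡∂ (m + 1)) x).symm z, coordVector x z i⟩).2 = EuclideanSpace.single i (1 : ℝ) := by
    intro z hz
    have h1 := congrArg (fun L => L (coordVector x z i))
      (TangentBundle.continuousLinearMapAt_trivializationAt (hsrc z hz))
    exact (congrFun (Bundle.Trivialization.coe_linearMapAt_of_mem (R := ℝ)
      (trivializationAt (Coord m) (fun p : M => TangentSpace (𝓡∂ (m + 1)) p) x) (hb z hz))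
      (coordVector x z i)).symm.trans (h1.trans (coords_coordVector hz i))
  refine ContMDiffWithinAt.congr_of_eventuallyEq (f := fun _ => EuclideanSpace.single i (1 : ℝ))
    contMDiffWithinAt_const ?_ ?_
  · filter_upwards [extChartAt_target_mem_nhdsWithin_of_mem hy] with z hz using hcoord z hz
  · exact hcoord y hy

theorem smooth_coeff (g : SmoothMetric m M) (x : M) (i j : Fin (m + 1)) :
    SmoothAlong (range (𝓡∂ (m + 1))) (extChartAt (𝓡∂ (m + 1)) x).target (fun z => coeff g x z i j) := by
  intro y hy
  have : ContMDiffWithinAt 𝓘(ℝ, Coord m) ((𝓡∂ (m + 1)).prod 𝓘(ℝ, ℝ)) ∞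
      (fun z ↦ Bundle.TotalSpace.mk' ℝ (E := Bundle.Trivial M ℝ) ((extChartAt (𝓡∂ (m + 1)) x).symm z)
        (g.inner ((extChartAt (𝓡∂ (m + 1)) x).symm z) (coordVector x z i) (coordVector x z j)))
      (range (𝓡∂ (m + 1))) y := by
    apply ContMDiffWithinAt.clm_bundle_apply₂ (F₁ := Coord m) (F₂ := Coord m)
    · exact ContMDiffAt.comp_contMDiffWithinAt y g.contMDiff.contMDiffAt
        (contMDiffWithinAt_extChartAt_symm_range x hy)
    · exact contMDiffWithinAt_coordVector x i hy
    · exact contMDiffWithinAt_coordVector x j hy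
  simp only [Bundle.contMDiffWithinAt_totalSpace] at this
  exact this.2.contDiffWithinAt

theorem inner_eq_sum_coeff (g : SmoothMetric m M) {x p : M} (hp : p ∈ (extChartAt (𝓡∂ (m + 1)) x).source)
    (v w : TangentSpace (𝓡∂ (m + 1)) p) : g.inner p v w =
      ∑ a, ∑ b, coords x v a * coords x w b * coeff g x (extChartAt (𝓡∂ (m + 1)) x p) a b := by
  obtain ⟨y, hy, rfl⟩ : ∃ y ∈ (extChartAt (𝓡∂ (m + 1)) x).target, (extChartAt (𝓡∂ (m + 1)) x).symm y = p :=
    ⟨_, (extChartAt (𝓡∂ (m + 1)) x).map_source hp, (extChartAt (𝓡∂ (m + 1)) x).left_inv hp⟩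
  have : IsManifold (𝓡∂ (m + 1)) 1 M := .of_le (n := ∞) (by simp)
  rw [(extChartAt (𝓡∂ (m + 1)) x).right_inv hy]
  conv_lhs => rw [eq_sum_coords hy v, eq_sum_coords hy w]
  simp only [map_sum, map_smul, sum_apply, smul_apply,
    smul_eq_mul, coeff, Matrix.of_apply, Finset.mul_sum]
  rw [Finset.sum_comm]
  exact Finset.sum_congr rfl fun a _ => Finset.sum_congr rfl fun b _ => by ring

theorem posDef_coeff (g : SmoothMetric m M) {x : M} {y : Coord m}
    (hy : y ∈ (extChartAt (𝓡∂ (m + 1)) x).target) : (coeff g x y).PosDef := by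
  have : IsManifold (𝓡∂ (m + 1)) 1 M := .of_le (n := ∞) (by simp)
  refine Matrix.PosDef.of_dotProduct_mulVec_pos ?_ fun c hc => ?_
  · ext i j
    exact g.symm _ _ _
  · set v : TangentSpace (𝓡∂ (m + 1)) ((extChartAt (𝓡∂ (m + 1)) x).symm y) := ∑ a, c a • coordVector x y a with hv
    have hcv : coords x v = WithLp.toLp 2 c := by
      have : coords x v = ∑ a, c a • coords x (coordVector x y a) :=
        (map_sum _ _ _).trans (Finset.sum_congr rfl fun a _ => map_smul _ _ _)
      rw [this]
      simp only [coords_coordVector hy]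
      ext b
      simp [Pi.single_apply, EuclideanSpace.single]
    have hv0 : v ≠ 0 := by
      intro h0
      refine hc ?_
      have h1 : coords x v = 0 := by rw [h0]; exact map_zero _
      rw [hcv] at h1
      ext a
      exact congrArg (fun w : Coord m => w a) h1
    have := g.pos _ v hv0
    rw [inner_eq_sum_coeff g ((extChartAt (𝓡∂ (m + 1)) x).map_target hy), (extChartAt (𝓡∂ (m + 1)) x).right_inv hy,
      hcv] at this
    simp only [dotProduct, Matrix.mulVec, Finset.mul_sum]
    simpa [mul_comm, mul_left_comm, mul_assoc] using this

theorem isMetric_coeff (g : SmoothMetric m M) (x : M) :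
    IsMetric (range (𝓡∂ (m + 1))) (extChartAt (𝓡∂ (m + 1)) x).target (coeff g x) where
  dom := isCoordDomain_target x
  smooth := smooth_coeff g x
  posDef _ hz := posDef_coeff g hz

theorem IsMetric.mono {S U V : Set (Coord m)} {G : Coord m → Matrix (Fin (m + 1)) (Fin (m + 1)) ℝ}
    (hG : IsMetric S U G) (hV : IsCoordDomain S V) (h : V ⊆ U) : IsMetric S V G where
  dom := hV
  smooth i j := (hG.smooth i j).mono h
  posDef z hz := hG.posDef z (h hz)

theorem coords_coordVector_overlap {x x' : M} {y : Coord m} (hy : y ∈ overlap m x x')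
    (i a : Fin (m + 1)) :
    coords x' (coordVector x y i) a = jac (range (𝓡∂ (m + 1))) (transition m x x') y a i := by
  have : IsManifold (𝓡∂ (m + 1)) 1 M := .of_le (n := ∞) (by simp)
  have hsrc : (extChartAt (𝓡∂ (m + 1)) x).symm y ∈ (chartAt (EuclideanHalfSpace (m + 1)) x').source := by
    rw [← extChartAt_source (𝓡∂ (m + 1))]; exact hy.2
  have h1 := mfderiv_comp_mfderivWithin (I := 𝓘(ℝ, Coord m)) (I' := (𝓡∂ (m + 1))) (I'' := 𝓘(ℝ, Coord m)) y
    (mdifferentiableAt_extChartAt hsrc) (mdifferentiableWithinAt_extChartAt_symm hy.1)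
    ((𝓡∂ (m + 1)).uniqueMDiffOn y (extChartAt_target_subset_range x hy.1))
  rw [jac, Matrix.of_apply, pderiv, ← (isTransition x x').fderivWithin_apply hy,
    ← mfderivWithin_eq_fderivWithin]
  exact congrArg (fun L => (L (EuclideanSpace.single i (1 : ℝ) : Coord m) : Coord m) a) h1.symm

/-- Through this instance every invariance statement about `IsIsometry` becomes independence of the
chart. -/
theorem isIsometry (g : SmoothMetric m M) (x x' : M) :
    IsIsometry (range (𝓡∂ (m + 1))) (overlap m x x') (extChartAt (𝓡∂ (m + 1)) x').target (coeff g x) (coeff g x')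
      (transition m x x') where
  transition := isTransition x x'
  source := (isMetric_coeff g x).mono (isCoordDomain_overlap x x') inter_subset_left
  target := isMetric_coeff g x'
  eq z hz := by
    ext i j
    rw [coeff, Matrix.of_apply, inner_eq_sum_coeff g hz.2, Matrix.mul_apply, Finset.sum_comm]
    refine Finset.sum_congr rfl fun b _ => ?_
    rw [Matrix.mul_apply, Finset.sum_mul]
    refine Finset.sum_congr rfl fun a _ => ?_
    rw [coords_coordVector_overlap hz, coords_coordVector_overlap hz, Matrix.transpose_apply]
    change _ * _ * coeff g x' (transition m x x' z) a b = _
    ring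

/-- The scalar curvature may be computed in any chart. -/
theorem scalarCurvature_eq (g : SmoothMetric m M) {x p : M} (hp : p ∈ (extChartAt (𝓡∂ (m + 1)) x).source) :
    scalarCurvature g p = scalar (range (𝓡∂ (m + 1))) (coeff g x) (extChartAt (𝓡∂ (m + 1)) x p) := by
  have hmem : extChartAt (𝓡∂ (m + 1)) p p ∈ overlap m p x := by
    refine ⟨mem_extChartAt_target p, ?_⟩
    rw [mem_preimage, extChartAt_to_inv]; exact hp
  rw [scalarCurvature, (isIsometry g p x).scalar_eq hmem, transition, extChartAt_to_inv]

theorem continuous_scalarCurvature (g : SmoothMetric m M) : Continuous (scalarCurvature g) :=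
  continuous_of_charts (fun x => (isMetric_coeff g x).smooth_scalar.continuousOn
    (isCoordDomain_target x)) fun _ _ hp => scalarCurvature_eq g hp

end

section

/-! ### The divergence theorem on the half-space -/

variable {m : ℕ}

theorem isCoordDomain_range : IsCoordDomain (range (𝓡∂ (m + 1))) (range (𝓡∂ (m + 1))) where
  uniqueDiffOn := (𝓡∂ (m + 1)).uniqueDiffOn
  subset := Subset.rfl
  mem_nhdsWithin _ _ := self_mem_nhdsWithin
  mem_closure_interior _ hz := (𝓡∂ (m + 1)).range_subset_closure_interior hz

theorem mem_range_iff {y : Coord m} : y ∈ range (𝓡∂ (m + 1)) ↔ 0 ≤ y 0 := by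
  rw [range_modelWithCornersEuclideanHalfSpace]; rfl

theorem mem_interior_range_iff {y : Coord m} : y ∈ interior (range (𝓡∂ (m + 1))) ↔ 0 < y 0 := by
  rw [interior_range_modelWithCornersEuclideanHalfSpace]; rfl

/-- Extension by zero of a smooth function with compact support. -/
theorem SmoothAlong.of_compact_support {S U K : Set (Coord m)} {F : Coord m → ℝ}
    (hF : SmoothAlong S U F) (hK : IsCompact K) (hKU : K ⊆ U) (h0 : ∀ y ∉ K, F y = 0) :
    SmoothAlong S S F := by
  intro z _
  by_cases hzK : z ∈ K
  · exact hF z (hKU hzK)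
  · have : F =ᶠ[nhds z] fun _ => 0 :=
      Filter.eventually_of_mem (hK.isClosed.isOpen_compl.mem_nhds hzK) h0
    exact (contDiffAt_const.congr_of_eventuallyEq this).contDiffWithinAt

theorem pderiv_eq_zero_of_notMem {S K : Set (Coord m)} {F : Coord m → ℝ} (hK : IsClosed K)
    (h0 : ∀ y ∉ K, F y = 0) {y : Coord m} (hy : y ∉ K) (k : Fin (m + 1)) :
    pderiv S k F y = 0 := by
  have : F =ᶠ[nhds y] fun _ => 0 := Filter.eventually_of_mem (hK.isOpen_compl.mem_nhds hy) h0
  rw [pderiv, this.fderivWithin_eq_of_nhds]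
  simp

/-- The field, zero off `K`, is integrated over a box `[0, R] × [-R, R]ᵐ` that contains the part of
`K` in the half-space. Of the faces only `{y₀ = 0}` meets `K`; the minus sign is there because the
outer direction on it is `-e₀`. -/
theorem integral_sum_pderiv {U K : Set (Coord m)} (hU : U ⊆ range (𝓡∂ (m + 1))) (hK : IsCompact K)
    (hKU : K ⊆ U) {X : Fin (m + 1) → Coord m → ℝ} (hX : ∀ k, SmoothAlong (range (𝓡∂ (m + 1))) U (X k))
    (h0 : ∀ k, ∀ y ∉ K, X k y = 0) :
    ∫ y in U, ∑ k, pderiv (range (𝓡∂ (m + 1))) k (X k) y = - ∫ z, X 0 (boundaryIncl z) := by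
  have hdom := isCoordDomain_range (m := m)
  have hXs : ∀ k, SmoothAlong (range (𝓡∂ (m + 1))) (range (𝓡∂ (m + 1))) (X k) := fun k =>
    (hX k).of_compact_support hK hKU (h0 k)
  have hS : IsClosed (range (𝓡∂ (m + 1))) := (𝓡∂ (m + 1)).isClosed_range
  set D : Coord m → ℝ := fun y => ∑ k, pderiv (range (𝓡∂ (m + 1))) k (X k) y with hD
  have hD0 : ∀ y ∉ K, D y = 0 := fun y hy =>
    Finset.sum_eq_zero fun k _ => pderiv_eq_zero_of_notMem hK.isClosed (h0 k) hy k
  have hDc : ContinuousOn D (range (𝓡∂ (m + 1))) :=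
    SmoothAlong.continuousOn hdom (.sum fun k _ => (hXs k).pderiv hdom k)
  obtain ⟨R, hR0, hR⟩ : ∃ R : ℝ, 0 < R ∧ ∀ y ∈ K, ∀ i, |y i| < R := by
    obtain ⟨R, hR⟩ := hK.isBounded.exists_norm_le
    refine ⟨|R| + 1, by positivity, fun y hy i => ?_⟩
    have h1 : ‖y i‖ ≤ ‖y‖ := PiLp.norm_apply_le y i
    have := hR y hy
    rw [Real.norm_eq_abs] at h1
    linarith [le_abs_self R]
  have hKz : ∀ y : Coord m, ∀ i, R ≤ |y i| → y ∉ K := fun y i hi hy => (hR y hy i).not_ge hi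
  set a : Fin (m + 1) → ℝ := fun i => if i = 0 then 0 else -R with ha
  set b : Fin (m + 1) → ℝ := fun _ => R with hb
  have ha0 : a 0 = 0 := by simp [ha]
  have hai : ∀ i, i ≠ 0 → a i = -R := fun i hi => by simp [ha, hi]
  have hle : a ≤ b := by
    intro i
    by_cases hi : i = 0
    · subst hi; simpa [ha0, hb] using hR0.le
    · simp only [hai i hi, hb]; linarith
  set B : Set (Coord m) := {y | y.ofLp ∈ Icc a b} with hB
  have hBS : B ⊆ range (𝓡∂ (m + 1)) := fun y hy => mem_range_iff.2 (by
    have := hy.1 0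
    rwa [ha0] at this)
  have hKB : ∀ y ∈ range (𝓡∂ (m + 1)) \ B, D y = 0 := by
    rintro y ⟨hyS, hyB⟩
    refine hD0 y fun hyK => hyB ⟨fun i => ?_, fun i => (le_abs_self _).trans (hR y hyK i).le⟩
    by_cases hi : i = 0
    · subst hi; rw [ha0]; exact mem_range_iff.1 hyS
    · rw [hai i hi]; exact (neg_le_neg (hR y hyK i).le).trans (neg_abs_le _)
  have e1 : ∫ y in U, D y = ∫ y in B, D y := by
    rw [← setIntegral_eq_of_subset_of_forall_sdiff_eq_zero hS.measurableSet hU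
      (fun y hy => hD0 y fun hyK => hy.2 (hKU hyK)),
      ← setIntegral_eq_of_subset_of_forall_sdiff_eq_zero hS.measurableSet hBS hKB]
  have e2 : ∫ y in B, D y = ∫ x in Icc a b, D (WithLp.toLp 2 x) :=
    ((PiLp.volume_preserving_toLp (Fin (m + 1))).setIntegral_preimage_emb
      (MeasurableEquiv.toLp 2 (Fin (m + 1) → ℝ)).measurableEmbedding D B).symm
  have hcont : Continuous (fun x : Fin (m + 1) → ℝ => (WithLp.toLp 2 x : Coord m)) :=
    PiLp.continuous_toLp 2 _
  have hmaps : MapsTo (fun x : Fin (m + 1) → ℝ => (WithLp.toLp 2 x : Coord m)) (Icc a b)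
      (range (𝓡∂ (m + 1))) := fun x hx => hBS hx
  set L : (Fin (m + 1) → ℝ) →L[ℝ] Coord m :=
    ((EuclideanSpace.equiv (Fin (m + 1)) ℝ).symm : (Fin (m + 1) → ℝ) →L[ℝ] Coord m) with hL
  -- Two-sided differentiability is required only inside the open box, where the derivative within
  -- the half-space is the ordinary one; on the closed box continuity suffices.
  have e3 := integral_divergence_of_hasFDerivAt_off_countable' a b hle
    (fun k x => X k (WithLp.toLp 2 x))
    (fun k x => (fderivWithin ℝ (X k) (range (𝓡∂ (m + 1))) (WithLp.toLp 2 x)).comp L) ∅ countable_empty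
    (fun k => ((hXs k).continuousOn hdom).comp hcont.continuousOn hmaps)
    (by
      rintro x ⟨hx, -⟩ k
      have hmem : (WithLp.toLp 2 x : Coord m) ∈ interior (range (𝓡∂ (m + 1))) := by
        rw [mem_interior_range_iff]
        have := (hx 0 (mem_univ _)).1
        rwa [ha0] at this
      have h1 := ((hXs k).differentiableWithinAt (interior_subset hmem)).hasFDerivWithinAt.hasFDerivAt
        (mem_interior_iff_mem_nhds.1 hmem)
      exact HasFDerivAt.comp x (g := X k) (f := L) h1 L.hasFDerivAt)
    ((hDc.comp hcont.continuousOn hmaps).integrableOn_compact isCompact_Icc)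
  have e4 : ∫ x in Icc a b, D (WithLp.toLp 2 x) = _ := e3
  rw [e1, e2, e4, Fin.sum_univ_succ]
  have hz : ∀ (k i : Fin (m + 1)) (t : ℝ) (x : Fin m → ℝ), R ≤ |t| →
      X k (WithLp.toLp 2 (i.insertNth t x)) = 0 := by
    intro k i t x ht
    exact h0 k _ (hKz _ i (by simpa using ht))
  have hz1 : ∀ (k i : Fin (m + 1)) x, X k (WithLp.toLp 2 (i.insertNth (b i) x)) = 0 := fun k i x =>
    hz k i _ x (by simp [hb, abs_of_pos hR0])
  have hz2 : ∀ k (i : Fin m) x, X k (WithLp.toLp 2 (i.succ.insertNth (a i.succ) x)) = 0 :=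
    fun k i x => hz k i.succ _ x (by simp [hai _ (Fin.succ_ne_zero i), abs_of_pos hR0])
  simp only [hz1, hz2, integral_zero, sub_self, Finset.sum_const_zero, add_zero, zero_sub, ha0]
  congr 1
  rw [setIntegral_eq_integral_of_forall_compl_eq_zero]
  · rw [← (PiLp.volume_preserving_ofLp (Fin m)).integral_comp
      (MeasurableEquiv.toLp 2 (Fin m → ℝ)).symm.measurableEmbedding]
    simp only [Fin.insertNth_zero']
    rfl
  · intro x hx
    by_contra hne
    refine hx ?_
    have hxK : (WithLp.toLp 2 (Fin.insertNth 0 0 x) : Coord m) ∈ K := by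
      by_contra h; exact hne (h0 0 _ h)
    have hbd : ∀ i, |x i| < R := fun i => by
      simpa [Fin.insertNth_zero'] using hR _ hxK i.succ
    refine ⟨fun i => ?_, fun i => ?_⟩
    · simp only [Function.comp, Fin.zero_succAbove, hai _ (Fin.succ_ne_zero i)]
      exact (neg_le_neg (hbd i).le).trans (neg_abs_le _)
    · exact (le_abs_self _).trans (hbd i).le

end

section

/-! ### Suprema of compatible measures and push-forwards -/

/-- Agreement on overlaps bounds every `ν j` on `s i` by `ν i`; allowing infinite mass off `s i`
makes this one upper bound for the whole family, so the supremum adds nothing on `s i`. -/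
theorem iSup_measure_restrict {α ι : Type*} [MeasurableSpace α] {ν : ι → Measure α} {s : ι → Set α}
    (hs : ∀ i, MeasurableSet (s i)) (hcar : ∀ i, ν i (s i)ᶜ = 0)
    (hag : ∀ i j E, MeasurableSet E → E ⊆ s i ∩ s j → ν i E = ν j E) (i : ι) :
    (⨆ j, ν j).restrict (s i) = ν i := by
  have hle : ⨆ j, ν j ≤ ν i + (⊤ : Measure α).restrict (s i)ᶜ := by
    refine iSup_le fun j => Measure.le_iff.2 fun E hE => ?_
    rw [← measure_inter_add_sdiff E (hs i), Measure.add_apply]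
    refine add_le_add ?_ ?_
    · have h0 : ν j ((E ∩ s i) \ s j) = 0 := measure_mono_null (fun p hp => hp.2) (hcar j)
      rw [← measure_inter_add_sdiff (E ∩ s i) (hs j), h0, add_zero,
        ← hag i j _ ((hE.inter (hs i)).inter (hs j)) (fun p hp => ⟨hp.1.2, hp.2⟩)]
      exact measure_mono fun p hp => hp.1.1
    · rw [Measure.restrict_apply hE]
      exact (le_top : ν j ≤ ⊤) _
  ext E hE
  rw [Measure.restrict_apply hE]
  have h1 : ν i E = ν i (E ∩ s i) := by
    have h0 : ν i (E \ s i) = 0 := measure_mono_null (fun p hp => hp.2) (hcar i)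
    rw [← measure_inter_add_sdiff E (hs i), h0, add_zero]
  rw [h1]
  refine le_antisymm ?_ ((le_iSup ν i) _)
  refine (hle _).trans ?_
  rw [Measure.add_apply, Measure.restrict_apply (hE.inter (hs i))]
  have : E ∩ s i ∩ (s i)ᶜ = ∅ := by
    ext p; simp only [mem_inter_iff, mem_compl_iff, mem_empty_iff_false, iff_false]; tauto
  simp [this]

section Pushforward

variable {X M : Type*} [TopologicalSpace X] [MeasurableSpace X] [BorelSpace X]
  [TopologicalSpace M] [MeasurableSpace M] [BorelSpace M] {μ : Measure X} {D : Set X} {Φ : X → M}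

theorem _root_.ContinuousOn.measurableSet_preimage_inter (hΦ : ContinuousOn Φ D)
    (hD : MeasurableSet D) {E : Set M} (hE : MeasurableSet E) : MeasurableSet (Φ ⁻¹' E ∩ D) := by
  have h1 : Measurable (D.domRestrict Φ) := (continuousOn_iff_continuous_domRestrict.1 hΦ).measurable
  have h2 := hD.subtype_image (h1 hE)
  convert h2 using 1
  ext z
  simp [and_comm]

theorem map_withDensity_apply [SFinite μ] (hΦ : ContinuousOn Φ D) (hD : MeasurableSet D) (ρ : X → ENNReal)
    {E : Set M} (hE : MeasurableSet E) :
    ((μ.restrict D).withDensity ρ).map Φ E = ∫⁻ z in Φ ⁻¹' E ∩ D, ρ z ∂μ := by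
  have hm : AEMeasurable Φ ((μ.restrict D).withDensity ρ) :=
    (hΦ.aemeasurable hD).mono_ac (withDensity_absolutelyContinuous _ _)
  rw [Measure.map_apply_of_aemeasurable hm hE, withDensity_apply' _ _,
    Measure.restrict_restrict' hD]

/-- Integration against the push-forward of a continuous density, for a function whose pull-back
is continuous with compact support. -/
theorem integral_map_withDensity [IsFiniteMeasureOnCompacts μ] [T2Space X]
    (hΦ : ContinuousOn Φ D) (hD : MeasurableSet D) {ρ : X → ℝ} (hρ : ContinuousOn ρ D)
    (hρ0 : ∀ z ∈ D, 0 ≤ ρ z) {K : Set X} (hK : IsCompact K) (hKD : K ⊆ D) {h : M → ℝ}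
    (hm : AEStronglyMeasurable h
      (((μ.restrict D).withDensity fun z => ENNReal.ofReal (ρ z)).map Φ))
    (hh : ContinuousOn (fun z => h (Φ z)) D) (h0 : ∀ z ∈ D \ K, h (Φ z) = 0) :
    Integrable h (((μ.restrict D).withDensity fun z => ENNReal.ofReal (ρ z)).map Φ) ∧
      ∫ p, h p ∂(((μ.restrict D).withDensity fun z => ENNReal.ofReal (ρ z)).map Φ) =
        ∫ z in D, ρ z * h (Φ z) ∂μ := by
  have hac := withDensity_absolutelyContinuous (μ.restrict D) fun z => ENNReal.ofReal (ρ z)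
  have hΦm : AEMeasurable Φ ((μ.restrict D).withDensity fun z => ENNReal.ofReal (ρ z)) :=
    (hΦ.aemeasurable hD).mono_ac hac
  have hρm : AEMeasurable (fun z => ENNReal.ofReal (ρ z)) (μ.restrict D) :=
    (hρ.aemeasurable hD).ennreal_ofReal
  have hlt : ∀ᵐ z ∂(μ.restrict D), ENNReal.ofReal (ρ z) < ⊤ :=
    Filter.Eventually.of_forall fun z => ENNReal.ofReal_lt_top
  have hae : (fun z => (ENNReal.ofReal (ρ z)).toReal • h (Φ z)) =ᵐ[μ.restrict D]
      fun z => ρ z * h (Φ z) := by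
    filter_upwards [ae_restrict_mem hD] with z hz
    rw [ENNReal.toReal_ofReal (hρ0 z hz), smul_eq_mul]
  refine ⟨?_, ?_⟩
  · rw [integrable_map_measure hm hΦm]
    change Integrable (fun z => h (Φ z)) _
    rw [integrable_withDensity_iff_integrable_smul₀' hρm hlt, integrable_congr hae]
    have hi : IntegrableOn (fun z => ρ z * h (Φ z)) K μ :=
      ((hρ.mul hh).mono hKD).integrableOn_compact hK
    exact hi.of_forall_sdiff_eq_zero hD fun z hz => by rw [h0 z hz, mul_zero]
  · rw [integral_map hΦm hm, integral_withDensity_eq_integral_toReal_smul₀ hρm hlt,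
      integral_congr_ae hae]

end Pushforward

/-! ### The Riemannian volume measure -/

section Volume

variable {m : ℕ} {M : Type*} [TopologicalSpace M] [ChartedSpace (EuclideanHalfSpace (m + 1)) M]

theorem measurableSet_target (x : M) : MeasurableSet (extChartAt (𝓡∂ (m + 1)) x).target := by
  rw [extChartAt_target]
  exact ((chartAt _ x).open_target.preimage (𝓡∂ (m + 1)).continuous_symm).measurableSet.inter
    (𝓡∂ (m + 1)).isClosed_range.measurableSet

variable [IsManifold (𝓡∂ (m + 1)) ∞ M]

theorem det_fderivWithin_transition {x x' : M} {y : Coord m} (hy : y ∈ overlap m x x') :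
    (fderivWithin ℝ (transition m x x') (range (𝓡∂ (m + 1))) y).det =
      (jac (range (𝓡∂ (m + 1))) (transition m x x') y).det := by
  rw [ContinuousLinearMap.det, ← LinearMap.det_toMatrix (EuclideanSpace.basisFun _ ℝ).toBasis]
  congr 1
  ext a i
  rw [LinearMap.toMatrix_apply]
  simp only [OrthonormalBasis.coe_toBasis, EuclideanSpace.basisFun_apply,
    OrthonormalBasis.coe_toBasis_repr_apply, EuclideanSpace.basisFun_repr]
  exact (isTransition x x').fderivWithin_apply hy _ _

variable [MeasurableSpace M] [BorelSpace M]

theorem chartVolume_apply (g : SmoothMetric m M) (x : M) {E : Set M} (hE : MeasurableSet E) :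
    chartVolume g x E = ∫⁻ y in (extChartAt (𝓡∂ (m + 1)) x).symm ⁻¹' E ∩ (extChartAt (𝓡∂ (m + 1)) x).target,
      ENNReal.ofReal √(coeff g x y).det :=
  map_withDensity_apply (continuousOn_extChartAt_symm x) (measurableSet_target x) _ hE

theorem chartVolume_compl_source (g : SmoothMetric m M) (x : M) :
    chartVolume g x (extChartAt (𝓡∂ (m + 1)) x).sourceᶜ = 0 := by
  rw [chartVolume_apply g x (isOpen_extChartAt_source x).measurableSet.compl]
  have : (extChartAt (𝓡∂ (m + 1)) x).symm ⁻¹' (extChartAt (𝓡∂ (m + 1)) x).sourceᶜ ∩ (extChartAt (𝓡∂ (m + 1)) x).target = ∅ := by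
    ext y
    simp only [mem_inter_iff, mem_preimage, mem_compl_iff, mem_empty_iff_false, iff_false, not_and]
    exact fun h hy => h ((extChartAt (𝓡∂ (m + 1)) x).map_target hy)
  rw [this, Measure.restrict_empty, lintegral_zero_measure]

/-- Change of variables along the transition map, with `√det (Jᵀ G J) = |det J| √det G`. -/
theorem chartVolume_eq_of_subset (g : SmoothMetric m M) (x x' : M) {E : Set M}
    (hE : MeasurableSet E) (hsub : E ⊆ (extChartAt (𝓡∂ (m + 1)) x).source ∩ (extChartAt (𝓡∂ (m + 1)) x').source) :
    chartVolume g x E = chartVolume g x' E := by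
  rw [chartVolume_apply g x hE, chartVolume_apply g x' hE]
  set A := (extChartAt (𝓡∂ (m + 1)) x).symm ⁻¹' E ∩ (extChartAt (𝓡∂ (m + 1)) x).target with hA
  have hAm : MeasurableSet A := (continuousOn_extChartAt_symm x).measurableSet_preimage_inter
    (measurableSet_target x) hE
  have hAo : A ⊆ overlap m x x' := fun y hy => ⟨hy.2, (hsub hy.1).2⟩
  have himg : (extChartAt (𝓡∂ (m + 1)) x').symm ⁻¹' E ∩ (extChartAt (𝓡∂ (m + 1)) x').target = transition m x x' '' A := by
    ext z
    constructor
    · rintro ⟨hzE, hzT⟩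
      have hz : z ∈ overlap m x' x := ⟨hzT, (hsub hzE).1⟩
      refine ⟨transition m x' x z, ⟨?_, transition_mem_target hz⟩, transition_transition hz⟩
      rw [mem_preimage, symm_transition hz]; exact hzE
    · rintro ⟨y, hy, rfl⟩
      refine ⟨?_, transition_mem_target (hAo hy)⟩
      rw [mem_preimage, symm_transition (hAo hy)]; exact hy.1
  rw [himg, lintegral_image_eq_lintegral_abs_det_fderiv_mul volume hAm
    (f' := fun y => fderivWithin ℝ (transition m x x') (range (𝓡∂ (m + 1))) y)]
  · refine setLIntegral_congr_fun hAm fun y hy => ?_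
    have hiso := isIsometry g x x'
    rw [det_fderivWithin_transition (hAo hy), ← ENNReal.ofReal_mul (abs_nonneg _),
      hiso.eq y (hAo hy), Matrix.det_mul, Matrix.det_mul, Matrix.det_transpose,
      mul_right_comm, Real.sqrt_mul (mul_self_nonneg _), Real.sqrt_mul_self_eq_abs]
  · intro y hy
    exact (((contDiffWithinAt_transition (hAo hy)).differentiableWithinAt
      (by simp)).hasFDerivWithinAt).mono fun z hz => extChartAt_target_subset_range x hz.2
  · intro y hy z hz h
    rw [← transition_transition (hAo hy), h, transition_transition (hAo hz)]

theorem volumeMeasure_restrict (g : SmoothMetric m M) (x : M) :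
    (volumeMeasure g).restrict (extChartAt (𝓡∂ (m + 1)) x).source = chartVolume g x :=
  iSup_measure_restrict (fun x => (isOpen_extChartAt_source x).measurableSet)
    (chartVolume_compl_source g) (fun x x' _ hE h => chartVolume_eq_of_subset g x x' hE h) x

/-- Nonempty open sets have positive volume. -/
theorem volumeMeasure_pos (g : SmoothMetric m M) {O : Set M} (hO : IsOpen O) {x : M} (hx : x ∈ O) :
    0 < volumeMeasure g O := by
  refine lt_of_lt_of_le ?_ ((le_iSup (chartVolume g) x) O)
  rw [chartVolume_apply g x hO.measurableSet]
  set A := (extChartAt (𝓡∂ (m + 1)) x).symm ⁻¹' O ∩ (extChartAt (𝓡∂ (m + 1)) x).target with hA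
  have hAm : MeasurableSet A := (continuousOn_extChartAt_symm x).measurableSet_preimage_inter
    (measurableSet_target x) hO.measurableSet
  have hxT := mem_extChartAt_target (I := (𝓡∂ (m + 1))) x
  have hAn : A ∈ nhdsWithin (extChartAt (𝓡∂ (m + 1)) x x) (range (𝓡∂ (m + 1))) := by
    refine Filter.inter_mem ?_ (extChartAt_target_mem_nhdsWithin x)
    refine (continuousAt_extChartAt_symm x).mono_left nhdsWithin_le_nhds (hO.mem_nhds ?_)
    rwa [extChartAt_to_inv]
  obtain ⟨N, hN, hxN, hNA⟩ := mem_nhdsWithin.1 hAn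
  -- The point `x` may lie on the boundary, so a Euclidean open subset of `A` is found in the
  -- interior of the half-space nearby.
  have hne : (N ∩ interior (range (𝓡∂ (m + 1)))).Nonempty :=
    mem_closure_iff.1 ((𝓡∂ (m + 1)).range_subset_closure_interior (extChartAt_target_subset_range x hxT))
      N hN hxN
  have hpos : 0 < volume A :=
    lt_of_lt_of_le ((hN.inter isOpen_interior).measure_pos volume hne)
      (measure_mono fun y hy => hNA ⟨hy.1, interior_subset hy.2⟩)
  have hAT : A ⊆ (extChartAt (𝓡∂ (m + 1)) x).target := inter_subset_right
  have hcont : ContinuousOn (fun y => √(coeff g x y).det) A :=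
    (((isMetric_coeff g x).smooth_det.continuousOn (isCoordDomain_target x)).sqrt).mono hAT
  refine pos_iff_ne_zero.2 fun h0 => hpos.ne' ?_
  rw [lintegral_eq_zero_iff' (hcont.aemeasurable hAm).ennreal_ofReal] at h0
  refine Measure.restrict_eq_zero.1 (ae_eq_bot.1 (Filter.eventually_false_iff_eq_bot.1 ?_))
  filter_upwards [h0, ae_restrict_mem hAm] with y hy hyA
  exact (ENNReal.ofReal_pos.2 (Real.sqrt_pos.2 (posDef_coeff g (hAT hyA)).det_pos)).ne' hy

end Volume

end

section

/-! ### The boundary in charts -/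

section BoundaryCharts

variable {m : ℕ}

/-- The inclusion `z ↦ (0, z)` as a continuous linear map. -/
def boundaryInclL (m : ℕ) : EuclideanSpace ℝ (Fin m) →L[ℝ] Coord m :=
  LinearMap.toContinuousLinearMap
    { toFun := boundaryIncl
      map_add' := fun z w => by
        ext i
        refine Fin.cases ?_ (fun a => ?_) i <;> simp [boundaryIncl]
      map_smul' := fun c z => by
        ext i
        refine Fin.cases ?_ (fun a => ?_) i <;> simp [boundaryIncl] }

/-- The projection `(t, z) ↦ z`. -/
def tailL (m : ℕ) : Coord m →L[ℝ] EuclideanSpace ℝ (Fin m) :=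
  LinearMap.toContinuousLinearMap
    { toFun := fun y => WithLp.toLp 2 fun a => y a.succ
      map_add' := fun z w => by ext a; simp
      map_smul' := fun c z => by ext a; simp }

theorem boundaryInclL_apply (z : EuclideanSpace ℝ (Fin m)) : boundaryInclL m z = boundaryIncl z :=
  rfl

theorem tailL_apply (y : Coord m) (a : Fin m) : tailL m y a = y a.succ := rfl

theorem boundaryIncl_zero (z : EuclideanSpace ℝ (Fin m)) : boundaryIncl z 0 = 0 := rfl

theorem boundaryIncl_succ (z : EuclideanSpace ℝ (Fin m)) (a : Fin m) :
    boundaryIncl z a.succ = z a := rfl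

theorem continuous_boundaryIncl : Continuous (boundaryIncl (m := m)) := (boundaryInclL m).continuous

theorem boundaryIncl_tailL {y : Coord m} (hy : y 0 = 0) : boundaryIncl (tailL m y) = y := by
  ext i
  refine Fin.cases ?_ (fun a => ?_) i
  · rw [boundaryIncl_zero, hy]
  · rw [boundaryIncl_succ, tailL_apply]

theorem tailL_boundaryIncl (z : EuclideanSpace ℝ (Fin m)) : tailL m (boundaryIncl z) = z := rfl

theorem boundaryIncl_injective : Function.Injective (boundaryIncl (m := m)) :=
  Function.LeftInverse.injective tailL_boundaryIncl

theorem boundaryIncl_mem_range (z : EuclideanSpace ℝ (Fin m)) : boundaryIncl z ∈ range (𝓡∂ (m + 1)) :=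
  mem_range_iff.2 le_rfl

/-- The lower right block of the determinant. -/
theorem inv_zero_zero (A : Matrix (Fin (m + 1)) (Fin (m + 1)) ℝ) (hA : IsUnit A.det) :
    A⁻¹ 0 0 * A.det = (A.submatrix Fin.succ Fin.succ).det := by
  rw [Matrix.inv_def, Matrix.smul_apply, Matrix.adjugate_fin_succ_eq_det_submatrix, smul_eq_mul,
    Ring.inverse_eq_inv', mul_right_comm, inv_mul_cancel₀ hA.ne_zero]
  simp only [Fin.val_zero, add_zero, pow_zero, one_mul]
  congr 2

variable {M : Type*} [TopologicalSpace M] [ChartedSpace (EuclideanHalfSpace (m + 1)) M]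
  [IsManifold (𝓡∂ (m + 1)) ∞ M]

theorem mem_boundary_iff {x p : M} (hp : p ∈ (extChartAt (𝓡∂ (m + 1)) x).source) :
    p ∈ (𝓡∂ (m + 1)).boundary M ↔ extChartAt (𝓡∂ (m + 1)) x p 0 = 0 := by
  have hsrc : p ∈ (chartAt (EuclideanHalfSpace (m + 1)) x).source := by
    rwa [← extChartAt_source (𝓡∂ (m + 1))]
  have h := ModelWithCorners.isInteriorPoint_iff_of_mem_atlas (I := (𝓡∂ (m + 1))) (n := ∞) (by simp)
    (chart_mem_atlas (EuclideanHalfSpace (m + 1)) x) hsrc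
  have h0 : 0 ≤ extChartAt (𝓡∂ (m + 1)) x p 0 :=
    mem_range_iff.1 (extChartAt_target_subset_range x ((extChartAt (𝓡∂ (m + 1)) x).map_source hp))
  have h1 : p ∈ (𝓡∂ (m + 1)).interior M ↔ 0 < extChartAt (𝓡∂ (m + 1)) x p 0 := by
    rw [← mem_interior_range_iff]
    refine h.trans ⟨fun h => OpenPartialHomeomorph.interior_extend_target_subset_interior_range _ h,
      fun h => OpenPartialHomeomorph.mem_interior_extend_target _
        ((chartAt (EuclideanHalfSpace (m + 1)) x).map_source hsrc) h⟩
  rw [← ModelWithCorners.compl_interior, mem_compl_iff, h1]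
  exact ⟨fun h => le_antisymm (not_lt.1 h) h0, fun h => h.symm ▸ lt_irrefl _⟩

theorem transition_zero_iff {x x' : M} {y : Coord m} (hy : y ∈ overlap m x x') :
    transition m x x' y 0 = 0 ↔ y 0 = 0 := by
  rw [transition, ← mem_boundary_iff hy.2, mem_boundary_iff ((extChartAt (𝓡∂ (m + 1)) x).map_target hy.1),
    (extChartAt (𝓡∂ (m + 1)) x).right_inv hy.1]

/-- At the boundary, the differential of a transition map preserves the boundary and the inner
side of it. -/
theorem jac_transition_zero (g : SmoothMetric m M) {x x' : M} {y : Coord m}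
    (hy : y ∈ overlap m x x') (hy0 : y 0 = 0) :
    ∃ c : ℝ, 0 < c ∧ ∀ i, jac (range (𝓡∂ (m + 1))) (transition m x x') y 0 i = if i = 0 then c else 0 := by
  have hd : HasFDerivWithinAt (fun w => transition m x x' w 0)
      (fderivWithin ℝ (fun w => transition m x x' w 0) (range (𝓡∂ (m + 1))) y) (range (𝓡∂ (m + 1))) y :=
    ((contDiffWithinAt_euclidean.1 (contDiffWithinAt_transition hy) 0).differentiableWithinAt
      (by simp)).hasFDerivWithinAt
  -- The component `ψ₀` is nonnegative and vanishes at `y`, so it has a minimum there. First-order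
  -- conditions on the tangent cone `{v₀ ≥ 0}` give zero along `±eᵢ`, `i ≠ 0`, and a nonnegative
  -- value along `e₀`, which invertibility of the Jacobi matrix makes positive.
  have hmin : IsLocalMinOn (fun w => transition m x x' w 0) (range (𝓡∂ (m + 1))) y := by
    filter_upwards [(isCoordDomain_overlap x x').mem_nhdsWithin y hy] with w hw
    rw [(transition_zero_iff hy).2 hy0]
    exact mem_range_iff.1 (extChartAt_target_subset_range x' (transition_mem_target hw))
  have hcone : ∀ v : Coord m, 0 ≤ v 0 → v ∈ posTangentConeAt (range (𝓡∂ (m + 1))) y := fun v hv => by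
    refine mem_posTangentConeAt_of_segment_subset ?_
    refine (𝓡∂ (m + 1)).convex_range.segment_subset (mem_range_iff.2 hy0.ge) (mem_range_iff.2 ?_)
    rw [PiLp.add_apply, hy0, zero_add]; exact hv
  have hzero : ∀ i, i ≠ 0 → jac (range (𝓡∂ (m + 1))) (transition m x x') y 0 i = 0 := fun i hi =>
    hmin.hasFDerivWithinAt_eq_zero hd (hcone _ (by simp [hi.symm])) (hcone _ (by simp [hi.symm]))
  have hnn : 0 ≤ jac (range (𝓡∂ (m + 1))) (transition m x x') y 0 0 :=
    hmin.hasFDerivWithinAt_nonneg hd (hcone _ (by simp))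
  refine ⟨_, lt_of_le_of_ne hnn fun h => ?_, fun i => ?_⟩
  · refine ((isIsometry g x x').isUnit_det_jac hy).ne_zero (Matrix.det_eq_zero_of_row_eq_zero 0 ?_)
    intro i
    by_cases hi : i = 0
    · rw [hi, ← h]
    · exact hzero i hi
  · split_ifs with hi
    · rw [hi]
    · exact hzero i hi

/-- The domain of the boundary chart. -/
def boundaryTarget (x : M) : Set (EuclideanSpace ℝ (Fin m)) :=
  boundaryIncl ⁻¹' (extChartAt (𝓡∂ (m + 1)) x).target

/-- At the boundary row `0` of `J` vanishes off the diagonal, so the tangential block of `Jᵀ G J`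
involves only the tangential blocks of `J` and `G`. -/
theorem det_boundary_block (g : SmoothMetric m M) {x x' : M} {y : Coord m}
    (hy : y ∈ overlap m x x') (hy0 : y 0 = 0) :
    ((coeff g x y).submatrix Fin.succ Fin.succ).det =
      ((jac (range (𝓡∂ (m + 1))) (transition m x x') y).submatrix Fin.succ Fin.succ).det ^ 2 *
        ((coeff g x' (transition m x x' y)).submatrix Fin.succ Fin.succ).det := by
  obtain ⟨c, -, hc⟩ := jac_transition_zero g hy hy0
  set J := jac (range (𝓡∂ (m + 1))) (transition m x x') y with hJ
  have hJ0 : ∀ a : Fin m, J 0 a.succ = 0 := fun a => by rw [hc, if_neg (Fin.succ_ne_zero a)]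
  have : (coeff g x y).submatrix Fin.succ Fin.succ =
      (J.submatrix Fin.succ Fin.succ).transpose *
        (coeff g x' (transition m x x' y)).submatrix Fin.succ Fin.succ *
        J.submatrix Fin.succ Fin.succ := by
    ext a b
    rw [Matrix.submatrix_apply, (isIsometry g x x').eq y hy]
    simp only [Matrix.mul_apply, Fin.sum_univ_succ (n := m), Matrix.transpose_apply, ← hJ, hJ0,
      Matrix.submatrix_apply, zero_mul, mul_zero, zero_add]
  rw [this, Matrix.det_mul, Matrix.det_mul, Matrix.det_transpose]
  ring

theorem hasFDerivAt_boundary_transition {x x' : M} {z : EuclideanSpace ℝ (Fin m)}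
    (hz : boundaryIncl z ∈ overlap m x x') :
    HasFDerivAt (fun w => tailL m (transition m x x' (boundaryIncl w)))
      ((tailL m).comp ((fderivWithin ℝ (transition m x x') (range (𝓡∂ (m + 1))) (boundaryIncl z)).comp
        (boundaryInclL m))) z := by
  have h1 := ((contDiffWithinAt_transition hz).differentiableWithinAt (by simp)).hasFDerivWithinAt
  have h2 : HasFDerivWithinAt (fun w => boundaryIncl w) (boundaryInclL m) univ z :=
    (boundaryInclL m).hasFDerivWithinAt
  have h3 := h1.comp z h2 (fun w _ => boundaryIncl_mem_range w)
  exact hasFDerivWithinAt_univ.1 ((tailL m).hasFDerivAt.comp_hasFDerivWithinAt z h3)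

theorem det_boundary_transition {x x' : M} {z : EuclideanSpace ℝ (Fin m)}
    (hz : boundaryIncl z ∈ overlap m x x') :
    ((tailL m).comp ((fderivWithin ℝ (transition m x x') (range (𝓡∂ (m + 1))) (boundaryIncl z)).comp
        (boundaryInclL m))).det =
      ((jac (range (𝓡∂ (m + 1))) (transition m x x') (boundaryIncl z)).submatrix Fin.succ Fin.succ).det := by
  rw [ContinuousLinearMap.det, ← LinearMap.det_toMatrix (EuclideanSpace.basisFun _ ℝ).toBasis]
  congr 1
  ext a i
  rw [LinearMap.toMatrix_apply]
  simp only [OrthonormalBasis.coe_toBasis, EuclideanSpace.basisFun_apply,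
    OrthonormalBasis.coe_toBasis_repr_apply, EuclideanSpace.basisFun_repr]
  have hs : boundaryInclL m (EuclideanSpace.single i 1) = EuclideanSpace.single i.succ (1 : ℝ) := by
    ext j
    refine Fin.cases ?_ (fun b => ?_) j
    · rw [boundaryInclL_apply, boundaryIncl_zero]; simp [(Fin.succ_ne_zero i).symm]
    · rw [boundaryInclL_apply, boundaryIncl_succ]; simp
  change fderivWithin ℝ (transition m x x') (range (𝓡∂ (m + 1))) (boundaryIncl z)
    (boundaryInclL m (EuclideanSpace.single i 1)) a.succ = _
  rw [hs]
  exact (isTransition x x').fderivWithin_apply hz _ _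

end BoundaryCharts

/-! ### The area measure of the boundary -/

section Area

variable {m : ℕ} {M : Type*} [TopologicalSpace M] [ChartedSpace (EuclideanHalfSpace (m + 1)) M]

theorem measurableSet_boundaryTarget (x : M) : MeasurableSet (boundaryTarget (m := m) x) :=
  continuous_boundaryIncl.measurable (measurableSet_target x)

theorem continuousOn_boundary_symm (x : M) :
    ContinuousOn (fun z => (extChartAt (𝓡∂ (m + 1)) x).symm (boundaryIncl z)) (boundaryTarget (m := m) x) :=
  (continuousOn_extChartAt_symm x).comp continuous_boundaryIncl.continuousOn fun _ hz => hz

variable [IsManifold (𝓡∂ (m + 1)) ∞ M] [MeasurableSpace M] [BorelSpace M]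

theorem chartArea_apply (g : SmoothMetric m M) (x : M) {E : Set M} (hE : MeasurableSet E) :
    chartArea g x E =
      ∫⁻ z in (fun z => (extChartAt (𝓡∂ (m + 1)) x).symm (boundaryIncl z)) ⁻¹' E ∩ boundaryTarget x,
        ENNReal.ofReal √((coeff g x (boundaryIncl z)).submatrix Fin.succ Fin.succ).det :=
  map_withDensity_apply (continuousOn_boundary_symm x) (measurableSet_boundaryTarget x) _ hE

theorem chartArea_compl_source (g : SmoothMetric m M) (x : M) :
    chartArea g x (extChartAt (𝓡∂ (m + 1)) x).sourceᶜ = 0 := by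
  rw [chartArea_apply g x (isOpen_extChartAt_source x).measurableSet.compl]
  have : (fun z => (extChartAt (𝓡∂ (m + 1)) x).symm (boundaryIncl z)) ⁻¹' (extChartAt (𝓡∂ (m + 1)) x).sourceᶜ ∩
      boundaryTarget x = ∅ := by
    ext y
    simp only [mem_inter_iff, mem_preimage, mem_compl_iff, mem_empty_iff_false, iff_false, not_and]
    exact fun h hy => h ((extChartAt (𝓡∂ (m + 1)) x).map_target hy)
  rw [this, Measure.restrict_empty, lintegral_zero_measure]

theorem measurableSet_boundary : MeasurableSet ((𝓡∂ (m + 1)).boundary M) :=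
  (ModelWithCorners.isClosed_boundary (I := (𝓡∂ (m + 1))) (n := ∞) (by simp)).measurableSet

/-- Infinite mass on the boundary and none elsewhere is an upper bound of all chart areas, hence of
their supremum. -/
theorem boundaryArea_compl_boundary (g : SmoothMetric m M) :
    boundaryArea g ((𝓡∂ (m + 1)).boundary M)ᶜ = 0 := by
  have h : boundaryArea g ≤ (⊤ : Measure M).restrict ((𝓡∂ (m + 1)).boundary M) := by
    refine iSup_le fun x => Measure.le_iff.2 fun E hE => ?_
    rw [Measure.restrict_apply hE, ← measure_inter_add_sdiff E (measurableSet_boundary (m := m))]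
    have h0 : chartArea g x (E \ (𝓡∂ (m + 1)).boundary M) = 0 := by
      rw [chartArea_apply g x (hE.diff measurableSet_boundary)]
      have : (fun z => (extChartAt (𝓡∂ (m + 1)) x).symm (boundaryIncl z)) ⁻¹' (E \ (𝓡∂ (m + 1)).boundary M) ∩
          boundaryTarget x = ∅ := by
        ext z
        simp only [mem_inter_iff, mem_preimage, mem_empty_iff_false, iff_false, not_and]
        refine fun h hz => h.2 ((mem_boundary_iff ((extChartAt (𝓡∂ (m + 1)) x).map_target hz)).2 ?_)
        rw [(extChartAt (𝓡∂ (m + 1)) x).right_inv hz, boundaryIncl_zero]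
      rw [this, Measure.restrict_empty, lintegral_zero_measure]
    rw [h0, add_zero]
    exact (le_top : chartArea g x ≤ ⊤) _
  refine le_antisymm ((h _).trans ?_) zero_le
  rw [Measure.restrict_apply measurableSet_boundary.compl, compl_inter_self, measure_empty]

/-- As for the volume, with the transition map restricted to `{y₀ = 0}`, which it preserves, and
with the tangential block as its Jacobi matrix. -/
theorem chartArea_eq_of_subset (g : SmoothMetric m M) (x x' : M) {E : Set M}
    (hE : MeasurableSet E) (hsub : E ⊆ (extChartAt (𝓡∂ (m + 1)) x).source ∩ (extChartAt (𝓡∂ (m + 1)) x').source) :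
    chartArea g x E = chartArea g x' E := by
  rw [chartArea_apply g x hE, chartArea_apply g x' hE]
  set A := (fun z => (extChartAt (𝓡∂ (m + 1)) x).symm (boundaryIncl z)) ⁻¹' E ∩ boundaryTarget x with hA
  set θ := fun w => tailL m (transition m x x' (boundaryIncl w)) with hθ
  have hAm : MeasurableSet A := (continuousOn_boundary_symm x).measurableSet_preimage_inter
    (measurableSet_boundaryTarget x) hE
  have hAo : ∀ z ∈ A, boundaryIncl z ∈ overlap m x x' := fun y hy => ⟨hy.2, (hsub hy.1).2⟩
  have hθi : ∀ z ∈ A, boundaryIncl (θ z) = transition m x x' (boundaryIncl z) := fun z hz =>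
    boundaryIncl_tailL ((transition_zero_iff (hAo z hz)).2 rfl)
  have himg : (fun z => (extChartAt (𝓡∂ (m + 1)) x').symm (boundaryIncl z)) ⁻¹' E ∩ boundaryTarget x' =
      θ '' A := by
    ext w
    constructor
    · rintro ⟨hzE, hzT⟩
      have hz : boundaryIncl w ∈ overlap m x' x := ⟨hzT, (hsub hzE).1⟩
      have hw : boundaryIncl (tailL m (transition m x' x (boundaryIncl w))) =
        transition m x' x (boundaryIncl w) := boundaryIncl_tailL ((transition_zero_iff hz).2 rfl)
      refine ⟨tailL m (transition m x' x (boundaryIncl w)), ⟨?_, ?_⟩, ?_⟩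
      · rw [mem_preimage, hw, symm_transition hz]; exact hzE
      · rw [boundaryTarget, mem_preimage, hw]; exact transition_mem_target hz
      · simp only [hθ]
        rw [hw, transition_transition hz, tailL_boundaryIncl]
    · rintro ⟨z, hz, rfl⟩
      refine ⟨?_, ?_⟩
      · rw [mem_preimage, hθi z hz, symm_transition (hAo z hz)]; exact hz.1
      · rw [boundaryTarget, mem_preimage, hθi z hz]; exact transition_mem_target (hAo z hz)
  rw [himg, lintegral_image_eq_lintegral_abs_det_fderiv_mul volume hAm
    (fun z hz => (hasFDerivAt_boundary_transition (hAo z hz)).hasFDerivWithinAt)]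
  · refine setLIntegral_congr_fun hAm fun z hz => ?_
    rw [det_boundary_transition (hAo z hz), ← ENNReal.ofReal_mul (abs_nonneg _),
      det_boundary_block g (hAo z hz) rfl, Real.sqrt_mul (sq_nonneg _), Real.sqrt_sq_eq_abs,
      hθi z hz]
  · intro z hz w hw h
    have h1 : transition m x x' (boundaryIncl z) = transition m x x' (boundaryIncl w) := by
      rw [← hθi z hz, ← hθi w hw]; exact congrArg _ h
    refine boundaryIncl_injective ?_
    rw [← transition_transition (hAo z hz), h1, transition_transition (hAo w hw)]

theorem boundaryArea_restrict (g : SmoothMetric m M) (x : M) :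
    (boundaryArea g).restrict (extChartAt (𝓡∂ (m + 1)) x).source = chartArea g x :=
  iSup_measure_restrict (fun x => (isOpen_extChartAt_source x).measurableSet)
    (chartArea_compl_source g) (fun x x' _ hE h => chartArea_eq_of_subset g x x' hE h) x

end Area

end

section

/-! ### Gradient pairing and normal derivative of functions on the manifold -/

section Functions

variable {m : ℕ} {M : Type*} [TopologicalSpace M] [ChartedSpace (EuclideanHalfSpace (m + 1)) M]

/-- The function `f` in the coordinates of the chart at `x`. -/
def inChart (x : M) (f : M → ℝ) (y : Coord m) : ℝ := f ((extChartAt (𝓡∂ (m + 1)) x).symm y)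

theorem inChart_apply {x p : M} (hp : p ∈ (extChartAt (𝓡∂ (m + 1)) x).source) (f : M → ℝ) :
    inChart x f (extChartAt (𝓡∂ (m + 1)) x p) = f p := by
  rw [inChart, (extChartAt (𝓡∂ (m + 1)) x).left_inv hp]

theorem inChart_transition {x x' : M} {y : Coord m} (hy : y ∈ overlap m x x') (f : M → ℝ) :
    inChart x' f (transition m x x' y) = inChart x f y := by
  rw [inChart, symm_transition hy, inChart]

theorem mem_overlap_self {x p : M} (hp : p ∈ (extChartAt (𝓡∂ (m + 1)) x).source) :
    extChartAt (𝓡∂ (m + 1)) p p ∈ overlap m p x := by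
  refine ⟨mem_extChartAt_target p, ?_⟩
  rw [mem_preimage, extChartAt_to_inv]; exact hp

theorem transition_self {x p : M} :
    transition m p x (extChartAt (𝓡∂ (m + 1)) p p) = extChartAt (𝓡∂ (m + 1)) x p := by
  rw [transition, extChartAt_to_inv]

theorem pderiv_inChart_transition {x x' : M} {y : Coord m} (hy : y ∈ overlap m x x') (f : M → ℝ)
    (k : Fin (m + 1)) : pderiv (range (𝓡∂ (m + 1))) k (inChart x f) y =
      pderiv (range (𝓡∂ (m + 1))) k (fun z => inChart x' f (transition m x x' z)) y :=
  pderiv_congr (isCoordDomain_overlap x x') (fun _ hz => (inChart_transition hz f).symm) hy k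

variable [IsManifold (𝓡∂ (m + 1)) ∞ M]

theorem smoothAlong_inChart (x : M) {f : M → ℝ} (hf : ContMDiff (𝓡∂ (m + 1)) 𝓘(ℝ, ℝ) ∞ f) :
    SmoothAlong (range (𝓡∂ (m + 1))) (extChartAt (𝓡∂ (m + 1)) x).target (inChart x f) := fun y hy =>
  (hf.contMDiffAt.comp_contMDiffWithinAt y
    (contMDiffWithinAt_extChartAt_symm_range (n := ∞) x hy)).contDiffWithinAt

/-- The inner product of the gradients of two functions. -/
def gradInner (g : SmoothMetric m M) (f h : M → ℝ) (p : M) : ℝ :=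
  gradPairing (range (𝓡∂ (m + 1))) (coeff g p) (inChart p f) (inChart p h)
    (extChartAt (𝓡∂ (m + 1)) p p)

/-- The derivative of a function in the direction of the exterior unit conormal. (Only used at
boundary points.) -/
def normalDeriv (g : SmoothMetric m M) (f : M → ℝ) (p : M) : ℝ :=
  conormalDeriv (range (𝓡∂ (m + 1))) (coeff g p) (inChart p f) (extChartAt (𝓡∂ (m + 1)) p p)

theorem gradInner_eq (g : SmoothMetric m M) {f h : M → ℝ} (hf : ContMDiff (𝓡∂ (m + 1)) 𝓘(ℝ, ℝ) ∞ f)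
    (hh : ContMDiff (𝓡∂ (m + 1)) 𝓘(ℝ, ℝ) ∞ h) {x p : M} (hp : p ∈ (extChartAt (𝓡∂ (m + 1)) x).source) :
    gradInner g f h p = gradPairing (range (𝓡∂ (m + 1))) (coeff g x) (inChart x f) (inChart x h)
      (extChartAt (𝓡∂ (m + 1)) x p) := by
  have hy := mem_overlap_self hp
  rw [← transition_self, ← (isIsometry g p x).gradPairing_eq hy (smoothAlong_inChart x hf)
    (smoothAlong_inChart x hh)]
  simp only [gradInner, gradPairing, gradient, pderiv_inChart_transition hy]

theorem continuous_gradInner (g : SmoothMetric m M) {f h : M → ℝ}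
    (hf : ContMDiff (𝓡∂ (m + 1)) 𝓘(ℝ, ℝ) ∞ f) (hh : ContMDiff (𝓡∂ (m + 1)) 𝓘(ℝ, ℝ) ∞ h) : Continuous (gradInner g f h) :=
  continuous_of_charts (fun x => ((isMetric_coeff g x).smooth_gradPairing
    (smoothAlong_inChart x hf) (smoothAlong_inChart x hh)).continuousOn (isCoordDomain_target x))
    fun _ _ hp => gradInner_eq g hf hh hp

theorem normalDeriv_eq (g : SmoothMetric m M) {f : M → ℝ} (hf : ContMDiff (𝓡∂ (m + 1)) 𝓘(ℝ, ℝ) ∞ f)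
    {x p : M} (hp : p ∈ (extChartAt (𝓡∂ (m + 1)) x).source) (hb : p ∈ (𝓡∂ (m + 1)).boundary M) :
    normalDeriv g f p = conormalDeriv (range (𝓡∂ (m + 1))) (coeff g x) (inChart x f) (extChartAt (𝓡∂ (m + 1)) x p) := by
  have hy := mem_overlap_self hp
  obtain ⟨c, hc, hJ⟩ := jac_transition_zero g hy
    ((mem_boundary_iff (mem_extChartAt_source p)).1 hb)
  rw [← transition_self, ← (isIsometry g p x).conormalDeriv_eq hy (smoothAlong_inChart x hf) hc hJ]
  simp only [normalDeriv, conormalDeriv, pderiv_inChart_transition hy]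

/-- Continuity is claimed along the boundary only: elsewhere `normalDeriv` depends on the choice of
chart. -/
theorem continuousOn_normalDeriv (g : SmoothMetric m M) {f : M → ℝ}
    (hf : ContMDiff (𝓡∂ (m + 1)) 𝓘(ℝ, ℝ) ∞ f) : ContinuousOn (normalDeriv g f) ((𝓡∂ (m + 1)).boundary M) := by
  intro x hx
  have h1 : ContinuousOn (fun p => conormalDeriv (range (𝓡∂ (m + 1))) (coeff g x) (inChart x f)
      (extChartAt (𝓡∂ (m + 1)) x p)) (extChartAt (𝓡∂ (m + 1)) x).source :=
    (((isMetric_coeff g x).smooth_conormalDeriv (smoothAlong_inChart x hf)).continuousOn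
      (isCoordDomain_target x)).comp (continuousOn_extChartAt x) (extChartAt (𝓡∂ (m + 1)) x).mapsTo
  have h2 := (h1.continuousAt (extChartAt_source_mem_nhds (I := (𝓡∂ (m + 1))) x)).continuousWithinAt
    (s := (𝓡∂ (m + 1)).boundary M)
  refine h2.congr_of_eventuallyEq ?_ (normalDeriv_eq g hf (mem_extChartAt_source x) hx)
  filter_upwards [self_mem_nhdsWithin,
    mem_nhdsWithin_of_mem_nhds (extChartAt_source_mem_nhds (I := (𝓡∂ (m + 1))) x)] with p hb hp
  exact normalDeriv_eq g hf hp hb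

/-- The error terms caused by cutting off with a partition of unity cancel, since the functions add
up to a constant. -/
theorem sum_gradInner {ι : Type*} [Fintype ι] (g : SmoothMetric m M) {χ : ι → M → ℝ}
    (hχ : ∀ i, ContMDiff (𝓡∂ (m + 1)) 𝓘(ℝ, ℝ) ∞ (χ i)) (hsum : ∀ p, ∑ i, χ i p = 1) (f : M → ℝ) (p : M) :
    ∑ i, gradInner g (χ i) f p = 0 := by
  have hy := mem_extChartAt_target (I := (𝓡∂ (m + 1))) p
  have hd := isCoordDomain_target (m := m) p
  simp only [gradInner, gradPairing]
  rw [Finset.sum_comm]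
  refine Finset.sum_eq_zero fun k _ => ?_
  rw [← Finset.sum_mul, ← pderiv_sum hd hy k fun i _ => smoothAlong_inChart p (hχ i),
    pderiv_congr hd (F := fun z => ∑ i, inChart p (χ i) z)
      (F' := fun _ => 1) (fun z _ => hsum _) hy, pderiv_const, zero_mul]

end Functions

/-! ### Integration in charts -/

section Integration

variable {m : ℕ} {M : Type*} [TopologicalSpace M] [ChartedSpace (EuclideanHalfSpace (m + 1)) M]
  [IsManifold (𝓡∂ (m + 1)) ∞ M] [MeasurableSpace M] [BorelSpace M]

theorem integral_of_restrict_eq {α : Type*} [MeasurableSpace α] {μ ν : Measure α} {s : Set α}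
    (hs : μ.restrict s = ν) {h : α → ℝ} (h0 : ∀ p ∉ s, h p = 0) :
    (Integrable h ν → Integrable h μ) ∧ ∫ p, h p ∂μ = ∫ p, h p ∂ν := by
  subst hs
  refine ⟨fun hi => (integrableOn_iff_integrable_of_support_subset fun p hp => ?_).1 hi,
    (setIntegral_eq_integral_of_forall_compl_eq_zero h0).symm⟩
  by_contra hps
  exact hp (h0 p hps)

theorem integral_volumeMeasure (g : SmoothMetric m M) {x : M} {h : M → ℝ} (hh : Continuous h)
    {K : Set M} (hK : IsCompact K) (hKs : K ⊆ (extChartAt (𝓡∂ (m + 1)) x).source) (h0 : ∀ p ∉ K, h p = 0) :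
    Integrable h (volumeMeasure g) ∧ ∫ p, h p ∂(volumeMeasure g) =
      ∫ y in (extChartAt (𝓡∂ (m + 1)) x).target, √(coeff g x y).det * inChart x h y := by
  obtain ⟨h1, h2⟩ := integral_of_restrict_eq (volumeMeasure_restrict g x)
    (fun p hp => h0 p fun hpK => hp (hKs hpK))
  have hc := continuousOn_extChartAt_symm (I := (𝓡∂ (m + 1))) x
  obtain ⟨h3, h4⟩ := integral_map_withDensity (μ := (volume : Measure (Coord m))) hc
    (measurableSet_target x)
    ((isMetric_coeff g x).smooth_det.continuousOn (isCoordDomain_target x)).sqrt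
    (fun z _ => Real.sqrt_nonneg _) (hK.image_of_continuousOn
      ((continuousOn_extChartAt (I := (𝓡∂ (m + 1))) x).mono hKs))
    (by rintro _ ⟨p, hp, rfl⟩; exact (extChartAt (𝓡∂ (m + 1)) x).map_source (hKs hp))
    (h := h) hh.aestronglyMeasurable (hh.comp_continuousOn hc)
    (fun z hz => h0 _ fun hp => hz.2 ⟨_, hp, (extChartAt (𝓡∂ (m + 1)) x).right_inv hz.1⟩)
  exact ⟨h1 h3, h2.trans h4⟩

theorem integral_boundaryArea (g : SmoothMetric m M) {x : M} {h : M → ℝ}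
    (hh : ContinuousOn h ((𝓡∂ (m + 1)).boundary M)) {K : Set M} (hK : IsCompact K)
    (hKs : K ⊆ (extChartAt (𝓡∂ (m + 1)) x).source) (h0 : ∀ p ∉ K, h p = 0) :
    Integrable h (boundaryArea g) ∧ ∫ p, h p ∂(boundaryArea g) =
      ∫ z in boundaryTarget x, √((coeff g x (boundaryIncl z)).submatrix Fin.succ Fin.succ).det *
        inChart x h (boundaryIncl z) := by
  obtain ⟨h1, h2⟩ := integral_of_restrict_eq (boundaryArea_restrict g x)
    (fun p hp => h0 p fun hpK => hp (hKs hpK))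
  have hb := measurableSet_boundary (m := m) (M := M)
  -- `h` is controlled on the boundary only, which suffices because the measure is carried by it.
  have hae : AEStronglyMeasurable h (boundaryArea g) := by
    rw [← Measure.restrict_eq_self_of_ae_mem (s := (𝓡∂ (m + 1)).boundary M) (μ := boundaryArea g)
      (ae_iff.2 (boundaryArea_compl_boundary g))]
    exact hh.aestronglyMeasurable hb
  have hae' : AEStronglyMeasurable h (chartArea g x) := by
    rw [← boundaryArea_restrict]; exact hae.restrict
  set K' := extChartAt (𝓡∂ (m + 1)) x '' K with hK'
  have hKc : IsCompact K' :=
    hK.image_of_continuousOn ((continuousOn_extChartAt (I := (𝓡∂ (m + 1))) x).mono hKs)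
  have hsub : tailL m '' (K' ∩ {y | y 0 = 0}) ⊆ boundaryTarget x := by
    rintro _ ⟨y, ⟨⟨p, hp, rfl⟩, hy0⟩, rfl⟩
    rw [boundaryTarget, mem_preimage, boundaryIncl_tailL hy0]
    exact (extChartAt (𝓡∂ (m + 1)) x).map_source (hKs hp)
  have hclosed : IsClosed {y : Coord m | y 0 = 0} :=
    isClosed_eq (EuclideanSpace.proj (𝕜 := ℝ) (0 : Fin (m + 1))).continuous continuous_const
  have hdet : ContinuousOn (fun z => √((coeff g x (boundaryIncl z)).submatrix
      Fin.succ Fin.succ).det) (boundaryTarget x) := by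
    refine ContinuousOn.sqrt ?_
    have h5 : SmoothAlong (range (𝓡∂ (m + 1))) (extChartAt (𝓡∂ (m + 1)) x).target
        (fun y => ((coeff g x y).submatrix Fin.succ Fin.succ).det) :=
      SmoothAlong.det fun i j => smooth_coeff g x i.succ j.succ
    exact (h5.continuousOn (isCoordDomain_target x)).comp continuous_boundaryIncl.continuousOn
      fun z hz => hz
  obtain ⟨h3, h4⟩ := integral_map_withDensity
    (μ := (volume : Measure (EuclideanSpace ℝ (Fin m)))) (continuousOn_boundary_symm x)
    (measurableSet_boundaryTarget x) hdet (fun z _ => Real.sqrt_nonneg _)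
    ((hKc.inter_right hclosed).image (tailL m).continuous) hsub (h := h) hae'
    (hh.comp (continuousOn_boundary_symm x) fun z hz =>
      (mem_boundary_iff ((extChartAt (𝓡∂ (m + 1)) x).map_target hz)).2 (by
        rw [(extChartAt (𝓡∂ (m + 1)) x).right_inv hz, boundaryIncl_zero]))
    (fun z hz => h0 _ fun hp => hz.2 ⟨boundaryIncl z,
      ⟨⟨_, hp, (extChartAt (𝓡∂ (m + 1)) x).right_inv hz.1⟩, rfl⟩, tailL_boundaryIncl z⟩)
  exact ⟨h1 h3, h2.trans h4⟩

end Integration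

end

section

/-! ### The divergence theorem -/

section DivergenceTheorem

variable {m : ℕ} {M : Type*} [TopologicalSpace M] [ChartedSpace (EuclideanHalfSpace (m + 1)) M]
  [IsManifold (𝓡∂ (m + 1)) ∞ M]

theorem gradInner_eq_zero (g : SmoothMetric m M) {χ : M → ℝ} (f : M → ℝ) {p : M}
    (hp : p ∉ tsupport χ) : gradInner g χ f p = 0 := by
  have h1 : inChart p χ =ᶠ[nhdsWithin (extChartAt (𝓡∂ (m + 1)) p p) (range (𝓡∂ (m + 1)))] fun _ => 0 := by
    have h2 : χ =ᶠ[nhds p] 0 := notMem_tsupport_iff_eventuallyEq.1 hp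
    rw [← extChartAt_to_inv (I := (𝓡∂ (m + 1))) p] at h2
    exact ((continuousAt_extChartAt_symm (I := (𝓡∂ (m + 1))) p).eventually h2).filter_mono nhdsWithin_le_nhds
  rw [gradInner, gradPairing]
  refine Finset.sum_eq_zero fun k _ => ?_
  rw [pderiv, h1.fderivWithin_eq (h1.self_of_nhdsWithin
    (extChartAt_target_subset_range p (mem_extChartAt_target p)))]
  simp

variable [MeasurableSpace M] [BorelSpace M]

/-- Integration by parts in one chart. -/
theorem integral_mul_divergence (g : SmoothMetric m M) [CompactSpace M] {x : M}
    {χ a f D : M → ℝ} (hχ : ContMDiff (𝓡∂ (m + 1)) 𝓘(ℝ, ℝ) ∞ χ) (ha : ContMDiff (𝓡∂ (m + 1)) 𝓘(ℝ, ℝ) ∞ a)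
    (hf : ContMDiff (𝓡∂ (m + 1)) 𝓘(ℝ, ℝ) ∞ f) (hD : Continuous D)
    (hsupp : tsupport χ ⊆ (extChartAt (𝓡∂ (m + 1)) x).source)
    (hDx : ∀ p ∈ (extChartAt (𝓡∂ (m + 1)) x).source, D p = divergence (range (𝓡∂ (m + 1))) (coeff g x)
      (fun k z => inChart x a z * gradient (range (𝓡∂ (m + 1))) (coeff g x) (inChart x f) k z)
      (extChartAt (𝓡∂ (m + 1)) x p)) :
    Integrable (fun p => χ p * D p + a p * gradInner g χ f p) (volumeMeasure g) ∧
    Integrable (fun p => χ p * (a p * normalDeriv g f p)) (boundaryArea g) ∧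
    ∫ p, (χ p * D p + a p * gradInner g χ f p) ∂(volumeMeasure g) =
      ∫ p, χ p * (a p * normalDeriv g f p) ∂(boundaryArea g) := by
  have hK : IsCompact (tsupport χ) := (isClosed_tsupport χ).isCompact
  obtain ⟨i1, e1⟩ := integral_volumeMeasure g (x := x)
    (h := fun p => χ p * D p + a p * gradInner g χ f p)
    ((hχ.continuous.mul hD).add (ha.continuous.mul (continuous_gradInner g hχ hf))) hK hsupp
    (fun p hp => by
      rw [image_eq_zero_of_notMem_tsupport hp, gradInner_eq_zero g f hp, zero_mul, mul_zero,
        add_zero])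
  obtain ⟨i2, e2⟩ := integral_boundaryArea g (x := x)
    (h := fun p => χ p * (a p * normalDeriv g f p))
    (hχ.continuous.continuousOn.mul (ha.continuous.continuousOn.mul
      (continuousOn_normalDeriv g hf))) hK hsupp
    (fun p hp => by rw [image_eq_zero_of_notMem_tsupport hp, zero_mul])
  refine ⟨i1, i2, ?_⟩
  rw [e1, e2]
  have hG := isMetric_coeff g x
  set S := range (𝓡∂ (m + 1)) with hS
  set T := (extChartAt (𝓡∂ (m + 1)) x).target with hT
  set G := coeff g x with hGd
  set W : Fin (m + 1) → Coord m → ℝ := fun k z => inChart x a z * gradient S G (inChart x f) k z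
    with hW
  have hWs : ∀ k, SmoothAlong S T (W k) := fun k =>
    (smoothAlong_inChart x ha).mul (hG.smooth_gradient (smoothAlong_inChart x hf) k)
  have hχs := smoothAlong_inChart x hχ
  have hds : SmoothAlong S T fun z => √(G z).det :=
    hG.smooth_det.sqrt fun _ hz => (hG.det_pos hz).ne'
  set K := extChartAt (𝓡∂ (m + 1)) x '' tsupport χ with hKd
  have hKc : IsCompact K :=
    hK.image_of_continuousOn ((continuousOn_extChartAt (I := (𝓡∂ (m + 1))) x).mono hsupp)
  have hKT : K ⊆ T := by
    rintro _ ⟨p, hp, rfl⟩; exact (extChartAt (𝓡∂ (m + 1)) x).map_source (hsupp hp)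
  have hχ0 : ∀ z ∈ T, z ∉ K → inChart x χ z = 0 := fun z hz hzK =>
    image_eq_zero_of_notMem_tsupport (f := χ) fun h => hzK ⟨_, h, (extChartAt (𝓡∂ (m + 1)) x).right_inv hz⟩
  -- Outside the chart's target the inverse chart takes irrelevant values, so `χ` in coordinates
  -- need not vanish there; the indicator enforces compact support.
  set X : Fin (m + 1) → Coord m → ℝ := fun k =>
    K.indicator fun z => √(G z).det * (inChart x χ z * W k z) with hX
  have hX0 : ∀ k, ∀ y ∉ K, X k y = 0 := fun k y hy => indicator_of_notMem hy _
  have hXT : ∀ k, ∀ z ∈ T, X k z = √(G z).det * (inChart x χ z * W k z) := fun k z hz => by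
    by_cases hzK : z ∈ K
    · exact indicator_of_mem hzK _
    · rw [hX0 k z hzK, hχ0 z hz hzK, zero_mul, mul_zero]
  have hXs : ∀ k, SmoothAlong S T (X k) := fun k =>
    (hds.mul (hχs.mul (hWs k))).congr hG.dom (hXT k)
  have key := integral_sum_pderiv hG.dom.subset hKc hKT hXs hX0
  have hl : ∀ y ∈ T, ∑ k, pderiv S k (X k) y =
      √(G y).det * inChart x (fun p => χ p * D p + a p * gradInner g χ f p) y := fun y hy => by
    have hsrc := (extChartAt (𝓡∂ (m + 1)) x).map_target hy
    simp only [pderiv_congr hG.dom (hXT _) hy]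
    rw [hG.sum_pderiv_density_mul hy fun k => hχs.mul (hWs k), hG.divergence_mul hy hχs hWs]
    simp only [inChart]
    rw [hDx _ hsrc, gradInner_eq g hχ hf hsrc, (extChartAt (𝓡∂ (m + 1)) x).right_inv hy]
    simp only [gradPairing, Finset.mul_sum, hW]
    congr 2
    exact Finset.sum_congr rfl fun k _ => by simp only [inChart]; ring
  have hr : ∀ z, - X 0 (boundaryIncl z) = (boundaryTarget x).indicator (fun z =>
      √((G (boundaryIncl z)).submatrix Fin.succ Fin.succ).det *
        inChart x (fun p => χ p * (a p * normalDeriv g f p)) (boundaryIncl z)) z := fun z => by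
    by_cases hz : z ∈ boundaryTarget x
    · have hy : boundaryIncl z ∈ T := hz
      have hsrc := (extChartAt (𝓡∂ (m + 1)) x).map_target hy
      have hpos := hG.inv_zero_zero_pos hy
      have hsq : √((G (boundaryIncl z))⁻¹ 0 0) ≠ 0 := (Real.sqrt_pos.2 hpos).ne'
      rw [indicator_of_mem hz, hXT 0 _ hy, ← inv_zero_zero _ (hG.isUnit_det hy),
        Real.sqrt_mul hpos.le]
      simp only [inChart]
      rw [normalDeriv_eq g hf hsrc ((mem_boundary_iff hsrc).2 (by
        rw [(extChartAt (𝓡∂ (m + 1)) x).right_inv hy, boundaryIncl_zero])), (extChartAt (𝓡∂ (m + 1)) x).right_inv hy]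
      -- The area density is `√g⁰⁰` times the volume density, and this factor cancels the
      -- normalization of the conormal. The Euclidean flux is therefore the Riemannian flux.
      have hN : √((G (boundaryIncl z))⁻¹ 0 0) * conormalDeriv S G (inChart x f) (boundaryIncl z) =
          - gradient S G (inChart x f) 0 (boundaryIncl z) := by
        simp only [conormalDeriv, conormal, gradient, Finset.mul_sum, ← Finset.sum_neg_distrib]
        refine Finset.sum_congr rfl fun k _ => ?_
        rw [hG.inv_symm hy k 0]
        field_simp
      simp only [hW, inChart]
      linear_combination (-(√(G (boundaryIncl z)).det) *
        χ ((extChartAt (𝓡∂ (m + 1)) x).symm (boundaryIncl z)) *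
        a ((extChartAt (𝓡∂ (m + 1)) x).symm (boundaryIncl z))) * hN
    · rw [indicator_of_notMem hz, hX0 0 _ fun h => hz (hKT h), neg_zero]
  rw [← setIntegral_congr_fun (measurableSet_target x) hl, key, ← integral_neg,
    ← integral_indicator (measurableSet_boundaryTarget x)]
  exact integral_congr_ae (Filter.Eventually.of_forall hr)

/-- A finite partition of unity subordinate to charts. -/
theorem exists_partition (m : ℕ) (M : Type*) [TopologicalSpace M]
    [ChartedSpace (EuclideanHalfSpace (m + 1)) M] [IsManifold (𝓡∂ (m + 1)) ∞ M] [T2Space M] [CompactSpace M] :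
    ∃ (t : Finset M) (χ : t → M → ℝ), (∀ i, ContMDiff (𝓡∂ (m + 1)) 𝓘(ℝ, ℝ) ∞ (χ i)) ∧
      (∀ i, tsupport (χ i) ⊆ (extChartAt (𝓡∂ (m + 1)) (i : M)).source) ∧ ∀ p, ∑ i, χ i p = 1 := by
  obtain ⟨t, ht⟩ := isCompact_univ.elim_finite_subcover (fun x : M => (extChartAt (𝓡∂ (m + 1)) x).source)
    (fun x => isOpen_extChartAt_source x)
    (fun x _ => mem_iUnion.2 ⟨x, mem_extChartAt_source x⟩)
  obtain ⟨f, hf⟩ := SmoothPartitionOfUnity.exists_isSubordinate (𝓡∂ (m + 1)) isClosed_univ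
    (fun i : t => (extChartAt (𝓡∂ (m + 1)) (i : M)).source) (fun i => isOpen_extChartAt_source _)
    (fun x hx => by
      obtain ⟨i, hi, hxi⟩ := mem_iUnion₂.1 (ht hx)
      exact mem_iUnion.2 ⟨⟨i, hi⟩, hxi⟩)
  refine ⟨t, fun i => f i, fun i => (f i).contMDiff, hf, fun p => ?_⟩
  rw [← finsum_eq_sum_of_fintype]
  exact f.sum_eq_one (mem_univ p)

variable [T2Space M] [CompactSpace M]

theorem integrable_volumeMeasure (g : SmoothMetric m M) {h : M → ℝ} (hh : Continuous h) :
    Integrable h (volumeMeasure g) := by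
  obtain ⟨t, χ, hχ, hsupp, hsum⟩ := exists_partition m M
  have : h = fun p => ∑ i, χ i p * h p := by
    ext p; rw [← Finset.sum_mul, hsum, one_mul]
  rw [this]
  exact integrable_finsetSum _ fun i _ => (integral_volumeMeasure g
    (h := fun p => χ i p * h p) ((hχ i).continuous.mul hh) (isClosed_tsupport (χ i)).isCompact (hsupp i)
    (fun p hp => by rw [image_eq_zero_of_notMem_tsupport hp, zero_mul])).1

/-- The divergence theorem for a vector field of the form `a ∇f`. -/
theorem integral_divergence (g : SmoothMetric m M) {a f D : M → ℝ}
    (ha : ContMDiff (𝓡∂ (m + 1)) 𝓘(ℝ, ℝ) ∞ a) (hf : ContMDiff (𝓡∂ (m + 1)) 𝓘(ℝ, ℝ) ∞ f) (hD : Continuous D)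
    (hDx : ∀ x, ∀ p ∈ (extChartAt (𝓡∂ (m + 1)) x).source, D p = divergence (range (𝓡∂ (m + 1))) (coeff g x)
      (fun k z => inChart x a z * gradient (range (𝓡∂ (m + 1))) (coeff g x) (inChart x f) k z)
      (extChartAt (𝓡∂ (m + 1)) x p)) :
    ∫ p, D p ∂(volumeMeasure g) = ∫ p, a p * normalDeriv g f p ∂(boundaryArea g) := by
  obtain ⟨t, χ, hχ, hsupp, hsum⟩ := exists_partition m M
  have key := fun i => integral_mul_divergence g (hχ i) ha hf hD (hsupp i) (hDx i)
  have e1 : ∀ p, D p = ∑ i, (χ i p * D p + a p * gradInner g (χ i) f p) := fun p => by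
    rw [Finset.sum_add_distrib, ← Finset.sum_mul, ← Finset.mul_sum, hsum,
      sum_gradInner g hχ hsum, one_mul, mul_zero, add_zero]
  have e2 : ∀ p, a p * normalDeriv g f p = ∑ i, χ i p * (a p * normalDeriv g f p) := fun p => by
    rw [← Finset.sum_mul, hsum, one_mul]
  rw [integral_congr_ae (Filter.Eventually.of_forall e1),
    integral_congr_ae (Filter.Eventually.of_forall e2),
    integral_finsetSum _ fun i _ => (key i).1, integral_finsetSum _ fun i _ => (key i).2.1]
  exact Finset.sum_congr rfl fun i _ => (key i).2.2

end DivergenceTheorem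

end

section

/-! ### Conformal metrics on a manifold with boundary -/

section Conformal

variable {m : ℕ} {M : Type*} [TopologicalSpace M] [ChartedSpace (EuclideanHalfSpace (m + 1)) M]

theorem contMDiff_log {μ : M → ℝ} (hμ : ContMDiff (𝓡∂ (m + 1)) 𝓘(ℝ, ℝ) ∞ μ) (h0 : ∀ p, 0 < μ p) :
    ContMDiff (𝓡∂ (m + 1)) 𝓘(ℝ, ℝ) ∞ fun p => Real.log (μ p) := fun p =>
  ((Real.contDiffAt_log (n := ∞)).2 (h0 p).ne').contMDiffAt.comp p (hμ p)

theorem contMDiff_sq_inv {μ : M → ℝ} (hμ : ContMDiff (𝓡∂ (m + 1)) 𝓘(ℝ, ℝ) ∞ μ) (h0 : ∀ p, 0 < μ p) :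
    ContMDiff (𝓡∂ (m + 1)) 𝓘(ℝ, ℝ) ∞ fun p => (μ p ^ 2)⁻¹ := fun p =>
  ContMDiffAt.comp (g := fun t : ℝ => (t ^ 2)⁻¹) p
    ((contDiffAt_id.pow 2).inv (pow_ne_zero 2 (h0 p).ne')).contMDiffAt (hμ p)

variable [IsManifold (𝓡∂ (m + 1)) ∞ M]

theorem isConformal_coeff {g₀ g : SmoothMetric m M} {μ : M → ℝ} (hμ : ContMDiff (𝓡∂ (m + 1)) 𝓘(ℝ, ℝ) ∞ μ)
    (h0 : ∀ p, 0 < μ p)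
    (hg : ∀ (p : M) (v w : TangentSpace (𝓡∂ (m + 1)) p), g.inner p v w = μ p ^ 2 * g₀.inner p v w) (x : M) :
    IsConformal (range (𝓡∂ (m + 1))) (extChartAt (𝓡∂ (m + 1)) x).target (coeff g₀ x) (coeff g x) (inChart x μ) where
  metric := isMetric_coeff g₀ x
  smooth := smoothAlong_inChart x hμ
  pos _ _ := h0 _
  eq _ _ _ _ := hg _ _ _

/-- The conformal factor is `1` where the metrics agree. -/
theorem factor_eq_one {g₀ g : SmoothMetric m M} {μ : M → ℝ} (h0 : ∀ p, 0 < μ p)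
    (hg : ∀ (p : M) (v w : TangentSpace (𝓡∂ (m + 1)) p), g.inner p v w = μ p ^ 2 * g₀.inner p v w) {p : M}
    (hp : g.inner p = g₀.inner p) : μ p = 1 := by
  have hy := mem_extChartAt_target (I := (𝓡∂ (m + 1))) p
  have hpos := (posDef_coeff g₀ hy).diag_pos (i := 0)
  -- The coordinate vectors live over `q`, which equals `p` only propositionally, so the comparison
  -- is made at `q`. Positivity of `g₀(∂₀, ∂₀)` then gives `μ² = 1`.
  set q := (extChartAt (𝓡∂ (m + 1)) p).symm (extChartAt (𝓡∂ (m + 1)) p p) with hq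
  have hqp : q = p := extChartAt_to_inv p
  have h1 : g.inner q = g₀.inner q := by rw [hqp]; exact hp
  have h2 := hg q (coordVector p (extChartAt (𝓡∂ (m + 1)) p p) 0) (coordVector p (extChartAt (𝓡∂ (m + 1)) p p) 0)
  rw [h1] at h2
  have h3 : coeff g₀ p (extChartAt (𝓡∂ (m + 1)) p p) 0 0 = μ q ^ 2 * coeff g₀ p (extChartAt (𝓡∂ (m + 1)) p p) 0 0 := h2
  have h4 : μ q ^ 2 = 1 := mul_right_cancel₀ hpos.ne' (by rw [← h3, one_mul])
  rw [hqp] at h4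
  nlinarith [h0 p]

theorem gradPairing_self_nonneg {S U : Set (Coord m)}
    {G : Coord m → Matrix (Fin (m + 1)) (Fin (m + 1)) ℝ} (hG : IsMetric S U G) {y : Coord m}
    (hy : y ∈ U) (f : Coord m → ℝ) : 0 ≤ gradPairing S G f f y :=
  (hG.posDef y hy).inv.posSemidef.dotProduct_mulVec_nonneg fun k => pderiv S k f y

theorem pderiv_eq_zero_of_gradPairing_self {S U : Set (Coord m)}
    {G : Coord m → Matrix (Fin (m + 1)) (Fin (m + 1)) ℝ} (hG : IsMetric S U G) {y : Coord m}
    (hy : y ∈ U) {f : Coord m → ℝ} (h : gradPairing S G f f y = 0) (k : Fin (m + 1)) :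
    pderiv S k f y = 0 := by
  by_contra hk
  exact ((hG.posDef y hy).inv.dotProduct_mulVec_pos (x := fun k => pderiv S k f y)
    fun h0 => hk (congrFun h0 k)).ne' h

theorem fderivWithin_eq_zero {S : Set (Coord m)} {f : Coord m → ℝ} {y : Coord m}
    (h : ∀ k, pderiv S k f y = 0) : fderivWithin ℝ f S y = 0 := by
  ext v
  have hv : v = ∑ a, v a • EuclideanSpace.single a (1 : ℝ) := by
    ext b
    simp [Pi.single_apply, EuclideanSpace.single]
  rw [hv, map_sum]
  refine Finset.sum_eq_zero fun a _ => ?_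
  rw [map_smul, show fderivWithin ℝ f S y (EuclideanSpace.single a 1) = 0 from h a, smul_zero]

/-- A function with vanishing gradient is locally constant. -/
theorem isLocallyConstant_of_gradInner (g : SmoothMetric m M) {f : M → ℝ}
    (hf : ContMDiff (𝓡∂ (m + 1)) 𝓘(ℝ, ℝ) ∞ f) (h : ∀ p, gradInner g f f p = 0) : IsLocallyConstant f := by
  refine (IsLocallyConstant.iff_eventually_eq f).2 fun x => ?_
  have hs := smoothAlong_inChart x hf
  have hz : ∀ y ∈ (extChartAt (𝓡∂ (m + 1)) x).target, fderivWithin ℝ (inChart x f) (range (𝓡∂ (m + 1))) y = 0 := by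
    intro y hy
    have h1 := h ((extChartAt (𝓡∂ (m + 1)) x).symm y)
    rw [gradInner_eq g hf hf ((extChartAt (𝓡∂ (m + 1)) x).map_target hy), (extChartAt (𝓡∂ (m + 1)) x).right_inv hy] at h1
    exact fderivWithin_eq_zero (pderiv_eq_zero_of_gradPairing_self (isMetric_coeff g x) hy h1)
  have hxT := mem_extChartAt_target (I := (𝓡∂ (m + 1))) x
  obtain ⟨r, hr, hball⟩ := Metric.mem_nhdsWithin_iff.1 (extChartAt_target_mem_nhdsWithin (I := (𝓡∂ (m + 1))) x)
  have hconst : ∀ y ∈ Metric.ball (extChartAt (𝓡∂ (m + 1)) x x) r ∩ range (𝓡∂ (m + 1)),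
      inChart x f y = inChart x f (extChartAt (𝓡∂ (m + 1)) x x) := fun y hy => by
    -- A half-ball is convex, so a vanishing one-sided derivative forces constancy at boundary
    -- points as well.
    refine ((convex_ball _ r).inter (𝓡∂ (m + 1)).convex_range).is_const_of_fderivWithin_eq_zero (𝕜 := ℝ)
      (fun z hz => (hs.differentiableWithinAt (hball hz)).mono inter_subset_right)
      (fun z hz' => ?_) hy ⟨Metric.mem_ball_self hr, extChartAt_target_subset_range x hxT⟩
    rw [inter_comm, fderivWithin_inter (Metric.isOpen_ball.mem_nhds hz'.1)]
    exact hz z (hball hz')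
  filter_upwards [extChartAt_source_mem_nhds (I := (𝓡∂ (m + 1))) x,
    (continuousAt_extChartAt (I := (𝓡∂ (m + 1))) x).preimage_mem_nhds (Metric.ball_mem_nhds _ hr)] with p hp hpb
  have h2 := hconst _ ⟨hpb, extChartAt_target_subset_range x ((extChartAt (𝓡∂ (m + 1)) x).map_source hp)⟩
  rwa [inChart_apply hp, inChart_apply (mem_extChartAt_source x)] at h2

theorem gradInner_self_nonneg (g : SmoothMetric m M) (f : M → ℝ) (p : M) :
    0 ≤ gradInner g f f p :=
  gradPairing_self_nonneg (isMetric_coeff g p) (mem_extChartAt_target p) _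

/-- The mean curvatures of two conformal metrics that agree at a boundary point. -/
theorem meanCurvature_sub {g₀ g : SmoothMetric m M} {μ : M → ℝ} (hμ : ContMDiff (𝓡∂ (m + 1)) 𝓘(ℝ, ℝ) ∞ μ)
    (h0 : ∀ p, 0 < μ p)
    (hg : ∀ (p : M) (v w : TangentSpace (𝓡∂ (m + 1)) p), g.inner p v w = μ p ^ 2 * g₀.inner p v w) {p : M}
    (hp : μ p = 1) : meanCurvature g p - meanCurvature g₀ p =
      m * normalDeriv g₀ (fun p => Real.log (μ p)) p := by
  have h := (isConformal_coeff hμ h0 hg p).divergence_conormal (mem_extChartAt_target p)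
  rw [inChart_apply (mem_extChartAt_source p), hp, inv_one, one_mul] at h
  rw [meanCurvature, h, meanCurvature, add_sub_cancel_left]
  rfl

variable [MeasurableSpace M] [BorelSpace M] [T2Space M] [CompactSpace M]

theorem eq_zero_of_integral_eq_zero (g : SmoothMetric m M) {h : M → ℝ} (hh : Continuous h)
    (hnn : ∀ p, 0 ≤ h p) (hint : ∫ p, h p ∂(volumeMeasure g) = 0) (p : M) : h p = 0 := by
  have h1 := (integral_eq_zero_iff_of_nonneg hnn (integrable_volumeMeasure g hh)).1 hint
  by_contra hp
  refine (volumeMeasure_pos g (isOpen_ne_fun hh continuous_const) (x := p) hp).ne' ?_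
  exact ae_iff.1 h1

/-- The integrated difference of the scalar and mean curvatures of two conformal metrics that agree
on the boundary. -/
theorem integral_curvature_sub (hm : 1 ≤ m) {g₀ g : SmoothMetric m M} {μ : M → ℝ}
    (hμ : ContMDiff (𝓡∂ (m + 1)) 𝓘(ℝ, ℝ) ∞ μ) (h0 : ∀ p, 0 < μ p)
    (hg : ∀ (p : M) (v w : TangentSpace (𝓡∂ (m + 1)) p), g.inner p v w = μ p ^ 2 * g₀.inner p v w)
    (hbd : ∀ p ∈ (𝓡∂ (m + 1)).boundary M, μ p = 1) :
    ∫ p, (scalarCurvature g p - scalarCurvature g₀ p) ∂(volumeMeasure g₀)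
        + 2 * ∫ p, (meanCurvature g p - meanCurvature g₀ p) ∂(boundaryArea g₀) =
      - ∫ p, scalarCurvature g₀ p * (1 - (μ p ^ 2)⁻¹) ∂(volumeMeasure g₀)
      - m * (m + 3) * ∫ p, (μ p ^ 2)⁻¹ * gradInner g₀ (fun p => Real.log (μ p))
          (fun p => Real.log (μ p)) p ∂(volumeMeasure g₀) := by
  set f : M → ℝ := fun p => Real.log (μ p) with hf
  set a : M → ℝ := fun p => (μ p ^ 2)⁻¹ with ha
  have hfs := contMDiff_log hμ h0
  have has := contMDiff_sq_inv hμ h0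
  have hm0 : (m : ℝ) ≠ 0 := by positivity
  -- `D` is `div(μ⁻² ∇f)`, solved for from `scalar_sub_scalar`. In this form it is defined on all of
  -- `M` and visibly continuous; dividing by `2m` uses `1 ≤ m`.
  set D : M → ℝ := fun p => (-(scalarCurvature g₀ p * (1 - a p))
    - m * (m + 3) * (a p * gradInner g₀ f f p) - (scalarCurvature g p - scalarCurvature g₀ p))
      / (2 * m) with hD
  have hR := continuous_scalarCurvature g
  have hR0 := continuous_scalarCurvature g₀
  have hA : Continuous fun p => scalarCurvature g₀ p * (1 - a p) :=
    hR0.mul (continuous_const.sub has.continuous)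
  have hE : Continuous fun p => a p * gradInner g₀ f f p :=
    has.continuous.mul (continuous_gradInner g₀ hfs hfs)
  have hDc : Continuous D :=
    ((hA.neg.sub (continuous_const.mul hE)).sub (hR.sub hR0)).div_const _
  have hdiv := integral_divergence g₀ has hfs hDc fun x p hp => by
    have h1 := (isConformal_coeff hμ h0 hg x).scalar_sub_scalar ((extChartAt (𝓡∂ (m + 1)) x).map_source hp)
    rw [inChart_apply hp] at h1
    change _ = _ * (a p - 1) - 2 * m * divergence (range (𝓡∂ (m + 1))) (coeff g₀ x)
      (fun k z => inChart x a z * gradient (range (𝓡∂ (m + 1))) (coeff g₀ x) (inChart x f) k z) _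
      - m * (m + 3) * (a p * gradPairing (range (𝓡∂ (m + 1))) (coeff g₀ x) (inChart x f) (inChart x f) _) at h1
    simp only [hD]
    rw [gradInner_eq g₀ hfs hfs hp, scalarCurvature_eq g hp, scalarCurvature_eq g₀ hp,
      div_eq_iff (by positivity)]
    linear_combination -h1
  -- The weight `μ⁻²` is `1` on the boundary and can be inserted freely, which matches the boundary
  -- term of the divergence theorem.
  have hH : ∫ p, (meanCurvature g p - meanCurvature g₀ p) ∂(boundaryArea g₀) =
      m * ∫ p, a p * normalDeriv g₀ f p ∂(boundaryArea g₀) := by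
    rw [← integral_const_mul]
    refine integral_congr_ae ?_
    filter_upwards [ae_iff.2 (boundaryArea_compl_boundary g₀)] with p hp
    rw [meanCurvature_sub hμ h0 hg (hbd p hp)]
    simp only [ha, hbd p hp, one_pow, inv_one, one_mul, hf]
  have hS : ∀ p, scalarCurvature g p - scalarCurvature g₀ p =
      -(scalarCurvature g₀ p * (1 - a p)) - m * (m + 3) * (a p * gradInner g₀ f f p)
        - 2 * m * D p := fun p => by
    simp only [hD]; field_simp; ring
  rw [hH, integral_congr_ae (Filter.Eventually.of_forall hS), ← hdiv, integral_sub, integral_sub,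
    integral_neg, integral_const_mul, integral_const_mul]
  · ring
  · exact integrable_volumeMeasure g₀ hA.neg
  · exact integrable_volumeMeasure g₀ (continuous_const.mul hE)
  · exact integrable_volumeMeasure g₀ (hA.neg.sub (continuous_const.mul hE))
  · exact integrable_volumeMeasure g₀ (continuous_const.mul hDc)

end Conformal

end

end BoundaryGeometry

end

/-! ### The rigidity theorem -/

theorem mainTheorem3 {m : ℕ} (hm : 1 ≤ m) {M : Type*} [TopologicalSpace M] [T2Space M]
    [CompactSpace M] [ConnectedSpace M] [ChartedSpace (EuclideanHalfSpace (m + 1)) M]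
    [IsManifold (𝓡∂ (m + 1)) ∞ M] [MeasurableSpace M] [BorelSpace M]
    (hbd : ((𝓡∂ (m + 1)).boundary M).Nonempty)
    (g₀ g : BoundaryGeometry.SmoothMetric m M)
    (μ : M → ℝ) (hμ : ContMDiff (𝓡∂ (m + 1)) 𝓘(ℝ, ℝ) ∞ μ) (hμpos : ∀ p, 0 < μ p)
    (hg : ∀ (p : M) (v w : TangentSpace (𝓡∂ (m + 1)) p),
      g.inner p v w = μ p ^ 2 * g₀.inner p v w)
    (hgbd : ∀ p ∈ (𝓡∂ (m + 1)).boundary M, g.inner p = g₀.inner p)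
    (hint : 0 ≤
      (∫ p, (BoundaryGeometry.scalarCurvature g p - BoundaryGeometry.scalarCurvature g₀ p)
          ∂(BoundaryGeometry.volumeMeasure g₀))
        + 2 * (∫ p, (BoundaryGeometry.meanCurvature g p - BoundaryGeometry.meanCurvature g₀ p)
          ∂(BoundaryGeometry.boundaryArea g₀)))
    (hR : 0 ≤ ∫ p, BoundaryGeometry.scalarCurvature g₀ p * (1 - (μ p ^ 2)⁻¹)
      ∂(BoundaryGeometry.volumeMeasure g₀)) :
    g = g₀ := by
  have hone : ∀ p ∈ (𝓡∂ (m + 1)).boundary M, μ p = 1 := fun p hp =>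
    BoundaryGeometry.factor_eq_one hμpos hg (hgbd p hp)
  set f : M → ℝ := fun p => Real.log (μ p) with hf
  set E : M → ℝ := fun p => (μ p ^ 2)⁻¹ * BoundaryGeometry.gradInner g₀ f f p with hE
  have hfs := BoundaryGeometry.contMDiff_log hμ hμpos
  have hEc : Continuous E := (BoundaryGeometry.contMDiff_sq_inv hμ hμpos).continuous.mul
    (BoundaryGeometry.continuous_gradInner g₀ hfs hfs)
  have hE0 : ∀ p, 0 ≤ E p := fun p =>
    mul_nonneg (inv_nonneg.2 (sq_nonneg _)) (BoundaryGeometry.gradInner_self_nonneg g₀ f p)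
  have hint0 : ∫ p, E p ∂(BoundaryGeometry.volumeMeasure g₀) = 0 := by
    rw [BoundaryGeometry.integral_curvature_sub hm hμ hμpos hg hone] at hint
    -- The coefficient `m(m+3)` is positive because `1 ≤ m`, so the two hypotheses leave no room for
    -- a positive gradient integral.
    refine le_antisymm (le_of_mul_le_mul_left (a := (m : ℝ) * (m + 3)) ?_ (by positivity))
      (integral_nonneg hE0)
    linarith
  have hgrad : ∀ p, BoundaryGeometry.gradInner g₀ f f p = 0 := fun p =>
    (mul_eq_zero.1 (BoundaryGeometry.eq_zero_of_integral_eq_zero g₀ hEc hE0 hint0 p)).resolve_left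
      (inv_ne_zero (pow_ne_zero 2 (hμpos p).ne'))
  have hconst := BoundaryGeometry.isLocallyConstant_of_gradInner g₀ hfs hgrad
  obtain ⟨b, hb⟩ := hbd
  -- Connectedness carries the boundary value `μ b = 1` to every point.
  have hμ1 : ∀ p, μ p = 1 := fun p => by
    have h1 : Real.log (μ p) = Real.log (μ b) := hconst.apply_eq_of_preconnectedSpace p b
    rw [Real.log_injOn_pos (hμpos p) (hμpos b) h1, hone b hb]
  have hinner : g.inner = g₀.inner := by
    funext p
    refine ContinuousLinearMap.ext fun v => ContinuousLinearMap.ext fun w => ?_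
    rw [hg, hμ1, one_pow, one_mul]
  cases g
  cases g₀
  cases hinner
  rfl
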